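/- For a finite undirected loopless graph $G$, the vertex integrity is $$\mathrm{vi}(G)=\min_{S\subseteq V(G)}\Bigl(|S|+\max_{D}|V(D)|\Bigr),$$ where $D$ ranges over the connected components of $G-S$ (the maximum is $0$ if $G-S$ has no vertices), and $\mathrm{vc}(G)$ is the minimum size of a vertex cover of $G$. The problem Unweighted Vertex Integrity asks, given a graph $G$ and an integer $k$, whether $\mathrm{vi}(G)\le k$. Theorem. Unweighted Vertex Integrity can be solved in time $5^{\mathrm{vc}(G)}\cdot n^{O(1)}$, where $n=|V(G)|$. That is, there are a single deterministic random access machine program and constants $C,c$ such that, for every $n\ge 0$, every graph $G$ on $n$ vertices (given by its adjacency matrix) and every integer $k$, the program halts on input $(G,k)$ after at most $C\cdot 5^{\mathrm{vc}(G)}\cdot (n+1)^c$ steps and answers correctly whether $\mathrm{vi}(G)\le k$. (No vertex cover is given as part of the input. The random access machine has unit cost per step; it may copy and compare numbers, add or subtract one, and use indirect addressing.) -/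

import Mathlib

/-! ### Vertex integrity -/

/-- The vertex integrity of a finite graph: the minimum, over all sets `S` of vertices, of `|S|`
plus the largest number of vertices of a connected component of `G - S`
(this maximum is `0` if `G - S` has no vertices). -/
noncomputable def vertexIntegrity {V : Type*} [Finite V] (G : SimpleGraph V) : ℕ :=
  ⨅ S : Set V, (S.ncard + ⨆ D : (G.induce Sᶜ).ConnectedComponent, D.supp.ncard)

/-! ### Random access machines with a step count -/

namespace RAM

/-- The memory of a random access machine: registers and arrays, both numbered by `ℕ`, all holding
natural numbers. (A program is finite, so it names only finitely many registers and arrays.) -/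
structure State where
  reg : ℕ → ℕ
  arr : ℕ → ℕ → ℕ

/-- Overwrite register `r` by the value `x`. -/
def State.setReg (s : State) (r x : ℕ) : State :=
  { s with reg := Function.update s.reg r x }

/-- Overwrite the cell with index `i` of array `a` by the value `x`. -/
def State.setCell (s : State) (a i x : ℕ) : State :=
  { s with arr := Function.update s.arr a (Function.update (s.arr a) i x) }

/-- Comparisons between the contents of two registers. -/
inductive Test where
  | eq (r r' : ℕ)
  | ne (r r' : ℕ)
  | lt (r r' : ℕ)
  | le (r r' : ℕ)

/-- The truth value of a comparison. -/
def Test.Holds (s : State) : Test → Prop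
  | .eq r r' => s.reg r = s.reg r'
  | .ne r r' => s.reg r ≠ s.reg r'
  | .lt r r' => s.reg r < s.reg r'
  | .le r r' => s.reg r ≤ s.reg r'

/-- Programs of a random access machine. The only arithmetic is adding or subtracting one; so the
numbers in memory grow by at most one per step and a unit charge per step is realistic: every usual
random access machine (with words of sufficient logarithmic length, say) runs such programs with no
loss. -/
inductive Program where
  /-- do nothing -/
  | skip
  /-- `reg r := x`, for a number `x` written in the program -/
  | const (r x : ℕ)
  /-- `reg r := reg r'` -/
  | copy (r r' : ℕ)
  /-- `reg r := reg r + 1` -/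
  | succ (r : ℕ)
  /-- `reg r := reg r - 1` (and `0` stays `0`) -/
  | pred (r : ℕ)
  /-- `reg r := arr a [reg i]` -/
  | load (r a i : ℕ)
  /-- `arr a [reg i] := reg r` -/
  | store (a i r : ℕ)
  /-- `p`, then `q` -/
  | seq (p q : Program)
  /-- if `b` then `p` else `q` -/
  | ite (b : Test) (p q : Program)
  /-- while `b` do `p` -/
  | while (b : Test) (p : Program)

/-- `Exec p s t s'`: the program `p`, started with memory `s`, halts after exactly `t` steps with
memory `s'`. Every elementary instruction and every evaluation of a test takes one step. -/
inductive Exec : Program → State → ℕ → State → Prop where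
  | skip (s : State) : Exec .skip s 1 s
  | const (r x : ℕ) (s : State) : Exec (.const r x) s 1 (s.setReg r x)
  | copy (r r' : ℕ) (s : State) : Exec (.copy r r') s 1 (s.setReg r (s.reg r'))
  | succ (r : ℕ) (s : State) : Exec (.succ r) s 1 (s.setReg r (s.reg r + 1))
  | pred (r : ℕ) (s : State) : Exec (.pred r) s 1 (s.setReg r (s.reg r - 1))
  | load (r a i : ℕ) (s : State) : Exec (.load r a i) s 1 (s.setReg r (s.arr a (s.reg i)))
  | store (a i r : ℕ) (s : State) : Exec (.store a i r) s 1 (s.setCell a (s.reg i) (s.reg r))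
  | seq {p q : Program} {s s' s'' : State} {t t' : ℕ} :
      Exec p s t s' → Exec q s' t' s'' → Exec (.seq p q) s (t + t') s''
  | ite_true {b : Test} {p q : Program} {s s' : State} {t : ℕ} :
      b.Holds s → Exec p s t s' → Exec (.ite b p q) s (t + 1) s'
  | ite_false {b : Test} {p q : Program} {s s' : State} {t : ℕ} :
      ¬ b.Holds s → Exec q s t s' → Exec (.ite b p q) s (t + 1) s'
  | while_true {b : Test} {p : Program} {s s' s'' : State} {t t' : ℕ} :
      b.Holds s → Exec p s t s' → Exec (.while b p) s' t' s'' →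
        Exec (.while b p) s (t + t' + 1) s''
  | while_false {b : Test} {p : Program} {s : State} :
      ¬ b.Holds s → Exec (.while b p) s 1 s

/-- The machine is deterministic: running time and result are determined by program and input. -/
theorem Exec.deterministic {p : Program} {s s₁ s₂ : State} {t₁ t₂ : ℕ}
    (h₁ : Exec p s t₁ s₁) (h₂ : Exec p s t₂ s₂) : t₁ = t₂ ∧ s₁ = s₂ := by
  induction h₁ generalizing t₂ s₂ with
  | skip | const | copy | succ | pred | load | store => cases h₂; exact ⟨rfl, rfl⟩
  | seq _ _ ih ih' =>
    cases h₂ with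
    | seq g g' =>
      obtain ⟨rfl, rfl⟩ := ih g
      obtain ⟨rfl, rfl⟩ := ih' g'
      exact ⟨rfl, rfl⟩
  | ite_true hb _ ih =>
    cases h₂ with
    | ite_true _ g => obtain ⟨rfl, rfl⟩ := ih g; exact ⟨rfl, rfl⟩
    | ite_false hb' _ => exact absurd hb hb'
  | ite_false hb _ ih =>
    cases h₂ with
    | ite_true hb' _ => exact absurd hb' hb
    | ite_false _ g => obtain ⟨rfl, rfl⟩ := ih g; exact ⟨rfl, rfl⟩
  | while_true hb _ _ ih ih' =>
    cases h₂ with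
    | while_true _ g g' =>
      obtain ⟨rfl, rfl⟩ := ih g
      obtain ⟨rfl, rfl⟩ := ih' g'
      exact ⟨rfl, rfl⟩
    | while_false hb' => exact absurd hb hb'
  | while_false hb =>
    cases h₂ with
    | while_true hb' _ _ => exact absurd hb' hb
    | while_false _ => exact ⟨rfl, rfl⟩

open Classical in
/-- The initial memory for the instance `(G, k)`: register `0` holds the number `n` of vertices,
registers `1` and `2` hold the absolute value and the sign (`1` if negative) of `k`, array `0` holds
the adjacency matrix of `G` row by row, and everything else is `0`. -/
noncomputable def inputState {n : ℕ} (G : SimpleGraph (Fin n)) (k : ℤ) : State where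
  reg := fun r =>
    if r = 0 then n
    else if r = 1 then k.natAbs
    else if r = 2 then (if k < 0 then 1 else 0)
    else 0
  arr := fun a i =>
    if a = 0 ∧ ∃ u v : Fin n, i = (u : ℕ) * n + (v : ℕ) ∧ G.Adj u v then 1 else 0

end RAM

/-!
# Vertex integrity in time `5 ^ vc(G)` times a polynomial

The vertex integrity of `G` is at most `k` if and only if `n ≤ k`, or there are a number
`1 ≤ l ≤ n` and a set `K` of vertices to be kept such that `n - |K| + l ≤ k` and `K` falls into
blocks of at most `l` vertices without edges between different blocks
(`vertexIntegrity_le_iff_splits`). So it suffices to maximize `|K|` for each `l`, and this can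
be done with a vertex cover `C` of minimum size at hand, in time `4 ^ |C|` times a polynomial in `n`.

*The cover.* For each size `j` in turn, all words of `j` digits are tried. A word directs a greedy
search: each edge not yet covered consumes a digit, which says which of its ends is chosen. If there
is a cover of size `j`, some word follows it (`Branch.exists_fits`), so the search stops with
`j ≤ vc(G)` (`runs_findCover`).

*The dynamic program.* A vertex outside `C` has neighbours in `C` only. Hence it can be kept in a
block that meets `C` if all its neighbours are in this block or deleted and it has a neighbour in
the block, and it can be kept as a block of its own if all its neighbours are deleted. Blocks are
formed one after another. A word in base four labels the vertices of `C`: later block (`0`), current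
block (`1`), finished block (`2`), deleted (`3`). If the current block is `Z`, has no edge to a
finished block, and `I` is the set of vertices outside `C` that fit into it, then it contributes
`min (|Z| + |I|) l` kept vertices: superfluous vertices of `I` can be deleted, without consequences
for the other blocks. The table entry for a word with labels `0`, `2`, `3` is the largest number of
kept vertices found so far in its finished blocks. A word `w` with current block `Z` reads the entry
for the word `src w` in which `Z` is still among the later blocks, and writes the entry for the word
`tgt w` in which `Z` is finished. As `src w ≤ w ≤ tgt w`, a single pass over the `4 ^ |C|` words in
increasing order processes all sequences of blocks. Soundness is `Inst.Success.splits`;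
completeness, by induction on the part of `C` covered by a union of blocks, is `Inst.exists_word`
and `Inst.splits_success`.

*The machine.* The machine can only count, but expressions with sums over `x < N`, comparisons and
array access are compiled to it, and `E.exec_code` bounds the time for all of them at once by a
power of `M + 2`, where `M` bounds the registers and cells of polynomial size. Words are
exponentially large; they are taken apart and put together by means of tables (`tables`), which are
built by counting. Rules for commands (`Runs`) then give the total time `L ^ 8 * 4 ^ vc(G)` with `L`
a power of `n + 6` (`runs_main`), and `4 ^ vc(G) ≤ 5 ^ vc(G)`.
-/

namespace RAM

/-! ### Named registers and arrays -/

/-- The named registers of the program; the first three are those of the input. -/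
inductive Var where
  | size | kin | sgn | bound | ans | pow | next | len | found | idx | dgt | round | word | src | dst
  | guess | cnt | fits | pick | lim | old | new | vtx | nbr | row | stp | val | pos | acc
  deriving DecidableEq

/-- The named arrays of the program; the first one holds the adjacency matrix of the input. -/
inductive Arr where
  | adj | quad | quot | rem | cov | pos | f | lab
  deriving DecidableEq

/-- The machine register that holds a named register. -/
def Var.num (x : Var) : ℕ := x.ctorIdx

/-- The machine array that holds a named array. -/
def Arr.num (a : Arr) : ℕ := a.ctorIdx

theorem Var.num_injective : Function.Injective Var.num := fun x y h => by
  have H : ∀ x : Var, Var.ofNat x.num = x := fun x => by cases x <;> rfl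
  rw [← H x, h, H y]

theorem Arr.num_injective : Function.Injective Arr.num := fun x y h => by
  have H : ∀ x : Arr, Arr.ofNat x.num = x := fun x => by cases x <;> rfl
  rw [← H x, h, H y]

theorem Var.num_lt (x : Var) : x.num < 32 := by cases x <;> decide

/-- The contents of the named registers and arrays. -/
structure Store where
  reg : Var → ℕ
  arr : Arr → ℕ → ℕ

/-- Overwrite the named register `x`. -/
def Store.set (σ : Store) (x : Var) (m : ℕ) : Store :=
  { σ with reg := fun y => if y = x then m else σ.reg y }

/-- Overwrite one cell of the named array `a`. -/
def Store.setCell (σ : Store) (a : Arr) (i m : ℕ) : Store :=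
  { σ with arr := fun b j => if b = a ∧ j = i then m else σ.arr b j }

@[simp] theorem Store.set_reg (σ : Store) (x y : Var) (m : ℕ) :
    (σ.set x m).reg y = if y = x then m else σ.reg y := rfl

@[simp] theorem Store.set_arr (σ : Store) (x : Var) (m : ℕ) : (σ.set x m).arr = σ.arr := rfl

@[simp] theorem Store.setCell_reg (σ : Store) (a : Arr) (i m : ℕ) :
    (σ.setCell a i m).reg = σ.reg := rfl

@[simp] theorem Store.setCell_arr (σ : Store) (a b : Arr) (i m j : ℕ) :
    (σ.setCell a i m).arr b j = if b = a ∧ j = i then m else σ.arr b j := rfl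

/-- The memory `s` of the machine has the contents `σ` in its named registers and arrays. -/
structure Rep (s : State) (σ : Store) : Prop where
  reg : ∀ x : Var, s.reg x.num = σ.reg x
  arr : ∀ a : Arr, s.arr a.num = σ.arr a

/-- `s` and `s'` agree on the temporary registers below `d`. Registers from `32` on are temporary:
they hold no named register. -/
def Frame (d : ℕ) (s s' : State) : Prop := ∀ r, 32 ≤ r → r < d → s'.reg r = s.reg r

@[simp] theorem State.setReg_reg (s : State) (r r' x : ℕ) :
    (s.setReg r x).reg r' = if r' = r then x else s.reg r' := by
  simp [State.setReg, Function.update_apply]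

@[simp] theorem State.setReg_arr (s : State) (r x : ℕ) : (s.setReg r x).arr = s.arr := rfl

theorem Frame.refl (d : ℕ) (s : State) : Frame d s s := fun _ _ _ => rfl

theorem Frame.trans {d : ℕ} {s s' s'' : State} (h : Frame d s s') (h' : Frame d s' s'') :
    Frame d s s'' := fun r h1 h2 => (h' r h1 h2).trans (h r h1 h2)

theorem Frame.mono {d d' : ℕ} {s s' : State} (h : Frame d s s') (hd : d' ≤ d) : Frame d' s s' :=
  fun r h1 h2 => h r h1 (h2.trans_le hd)

theorem Frame.setReg {d : ℕ} {s s' : State} (h : Frame d s s') {r : ℕ} (hr : d ≤ r) (x : ℕ) :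
    Frame d s (s'.setReg r x) := fun r' h1 h2 => by
  rw [State.setReg_reg, if_neg (by omega)]; exact h r' h1 h2

theorem Frame.setVar {d : ℕ} {s s' : State} (h : Frame d s s') (y : Var) (x : ℕ) :
    Frame d s (s'.setReg y.num x) := fun r' h1 h2 => by
  have := y.num_lt
  rw [State.setReg_reg, if_neg (by omega)]; exact h r' h1 h2

theorem Rep.setReg {s : State} {σ : Store} (h : Rep s σ) {r : ℕ} (hr : 32 ≤ r) (x : ℕ) :
    Rep (s.setReg r x) σ where
  reg y := by
    have := y.num_lt
    rw [State.setReg_reg, if_neg (by omega)]; exact h.reg y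
  arr := h.arr

theorem Rep.setVar {s : State} {σ : Store} (h : Rep s σ) (y : Var) (x : ℕ) :
    Rep (s.setReg y.num x) (σ.set y x) where
  reg z := by simp [h.reg, Var.num_injective.eq_iff]
  arr := h.arr

theorem Rep.setCell {s : State} {σ : Store} (h : Rep s σ) (a : Arr) (i x : ℕ) :
    Rep (s.setCell a.num i x) (σ.setCell a i x) where
  reg := h.reg
  arr b := by
    funext j
    by_cases hb : b = a
    · subst hb; simp [State.setCell, Function.update_apply, h.arr]
    · simp [State.setCell, Arr.num_injective.eq_iff, hb, h.arr]

/-- Overwriting a named register and putting the old value back. -/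
theorem Rep.restore {s : State} {σ : Store} {x : Var} {m : ℕ} (h : Rep s (σ.set x m)) :
    Rep (s.setReg x.num (σ.reg x)) σ where
  reg y := by
    have := h.reg y
    by_cases hy : y = x
    · simp [hy]
    · simpa [Var.num_injective.eq_iff, hy] using this
  arr := h.arr

/-! ### Counted loops -/

/-- A loop with a counter in register `i` and an upper bound in register `N`. -/
theorem Exec.loop {p : Program} {i N m T : ℕ} (Inv : ℕ → State → Prop)
    (hInv : ∀ k s, Inv k s → s.reg i = k ∧ s.reg N = m)
    (hp : ∀ k s, k < m → Inv k s → ∃ t s', Exec p s t s' ∧ t ≤ T ∧ s'.reg i = k ∧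
      Inv (k + 1) (s'.setReg i (k + 1)))
    {s : State} (hs : Inv 0 s) :
    ∃ t s', Exec (.while (.lt i N) (.seq p (.succ i))) s t s' ∧ t ≤ m * (T + 2) + 1 ∧
      Inv m s' := by
  suffices H : ∀ (l k : ℕ) (s : State), k + l = m → Inv k s →
      ∃ t s', Exec (.while (.lt i N) (.seq p (.succ i))) s t s' ∧ t ≤ l * (T + 2) + 1 ∧
        Inv m s' by
    exact H m 0 s (by omega) hs
  intro l
  induction l with
  | zero =>
    intro k s hk h
    obtain ⟨h1, h2⟩ := hInv k s h
    refine ⟨1, s, .while_false ?_, by omega, ?_⟩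
    · simp only [Test.Holds]; omega
    · rwa [← show k = m by omega]
  | succ l ih =>
    intro k s hk h
    obtain ⟨h1, h2⟩ := hInv k s h
    obtain ⟨t, s', e, ht, hi, h'⟩ := hp k s (by omega) h
    have e2 := Exec.succ i s'
    rw [hi] at e2
    obtain ⟨t', s'', e3, ht', h3⟩ := ih (k + 1) _ (by omega) h'
    refine ⟨_, s'', .while_true ?_ (.seq e e2) e3, ?_, h3⟩
    · simp only [Test.Holds]; omega
    · have : (l + 1) * (T + 2) = l * (T + 2) + (T + 2) := by ring
      omega

/-- Adding register `m` to register `d`; register `e` is used for the number zero. -/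
def addLoop (d m e : ℕ) : Program :=
  .seq (.const e 0) (.while (.ne m e) (.seq (.succ d) (.pred m)))

/-- Subtracting register `m` from register `d`; register `e` is used for the number zero. -/
def subLoop (d m e : ℕ) : Program :=
  .seq (.const e 0) (.while (.ne m e) (.seq (.pred d) (.pred m)))

theorem exec_addLoop {d m e : ℕ} (h1 : d ≠ m) (h2 : d ≠ e) (h3 : m ≠ e) (s : State) :
    ∃ t s', Exec (addLoop d m e) s t s' ∧ t ≤ 3 * s.reg m + 2 ∧ s'.arr = s.arr ∧
      s'.reg d = s.reg d + s.reg m ∧ ∀ r, r ≠ d → r ≠ m → r ≠ e → s'.reg r = s.reg r := by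
  have H : ∀ (l : ℕ) (s : State), s.reg m = l → s.reg e = 0 →
      ∃ t s', Exec (.while (.ne m e) (.seq (.succ d) (.pred m))) s t s' ∧ t ≤ 3 * l + 1 ∧
        s'.arr = s.arr ∧ s'.reg d = s.reg d + l ∧
        ∀ r, r ≠ d → r ≠ m → r ≠ e → s'.reg r = s.reg r := by
    intro l
    induction l with
    | zero =>
      intro s hm he
      exact ⟨1, s, .while_false (by simp [Test.Holds, hm, he]), by omega, rfl, rfl, by simp⟩
    | succ l ih =>
      intro s hm he
      obtain ⟨t, s', ex, ht, ha, hd, hr⟩ := ih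
        ((s.setReg d (s.reg d + 1)).setReg m ((s.setReg d (s.reg d + 1)).reg m - 1))
        (by simp [h1.symm, hm]) (by simp [h3.symm, h2.symm, he])
      refine ⟨_, s', .while_true (by simp [Test.Holds, hm, he])
        (.seq (.succ _ _) (.pred _ _)) ex, by omega, ha, ?_, ?_⟩
      · rw [hd]; simp [h1]; omega
      · intro r a b c
        rw [hr r a b c]; simp [a, b]
  obtain ⟨t, s', ex, ht, ha, hd, hr⟩ := H (s.reg m) (s.setReg e 0) (by simp [h3]) (by simp)
  refine ⟨_, s', .seq (.const _ _ _) ex, by omega, ha, by simpa [h2] using hd, ?_⟩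
  intro r a b c
  rw [hr r a b c]; simp [c]

theorem exec_subLoop {d m e : ℕ} (h1 : d ≠ m) (h2 : d ≠ e) (h3 : m ≠ e) (s : State) :
    ∃ t s', Exec (subLoop d m e) s t s' ∧ t ≤ 3 * s.reg m + 2 ∧ s'.arr = s.arr ∧
      s'.reg d = s.reg d - s.reg m ∧ ∀ r, r ≠ d → r ≠ m → r ≠ e → s'.reg r = s.reg r := by
  have H : ∀ (l : ℕ) (s : State), s.reg m = l → s.reg e = 0 →
      ∃ t s', Exec (.while (.ne m e) (.seq (.pred d) (.pred m))) s t s' ∧ t ≤ 3 * l + 1 ∧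
        s'.arr = s.arr ∧ s'.reg d = s.reg d - l ∧
        ∀ r, r ≠ d → r ≠ m → r ≠ e → s'.reg r = s.reg r := by
    intro l
    induction l with
    | zero =>
      intro s hm he
      exact ⟨1, s, .while_false (by simp [Test.Holds, hm, he]), by omega, rfl, rfl, by simp⟩
    | succ l ih =>
      intro s hm he
      obtain ⟨t, s', ex, ht, ha, hd, hr⟩ := ih
        ((s.setReg d (s.reg d - 1)).setReg m ((s.setReg d (s.reg d - 1)).reg m - 1))
        (by simp [h1.symm, hm]) (by simp [h3.symm, h2.symm, he])
      refine ⟨_, s', .while_true (by simp [Test.Holds, hm, he])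
        (.seq (.pred _ _) (.pred _ _)) ex, by omega, ha, ?_, ?_⟩
      · rw [hd]; simp [h1]; omega
      · intro r a b c
        rw [hr r a b c]; simp [a, b]
  obtain ⟨t, s', ex, ht, ha, hd, hr⟩ := H (s.reg m) (s.setReg e 0) (by simp [h3]) (by simp)
  refine ⟨_, s', .seq (.const _ _ _) ex, by omega, ha, by simpa [h2] using hd, ?_⟩
  intro r a b c
  rw [hr r a b c]; simp [c]

/-! ### Expressions -/

/-- Expressions over the named registers and arrays. Comparisons have the value `0` or `1`, and a
condition counts as true if its value is not `0`. The registers bound in `sum` and `fold` are local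
to the last argument. -/
inductive E where
  | lit (m : ℕ)
  | var (x : Var)
  | get (a : Arr) (i : E)
  | add (e e' : E)
  | sub (e e' : E)
  | lt (e e' : E)
  | eq (e e' : E)
  | ite (b e e' : E)
  /-- the sum of `e` over all `x < N` -/
  | sum (x : Var) (N e : E)
  /-- start with `y = e₀`, and replace `y` by the value of `e` for `x = 0, …, N - 1` in turn -/
  | fold (x y : Var) (N e₀ e : E)

/-- The value of an expression. -/
def E.eval : E → Store → ℕ
  | lit m, _ => m
  | var x, σ => σ.reg x
  | get a i, σ => σ.arr a (i.eval σ)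
  | add e e', σ => e.eval σ + e'.eval σ
  | sub e e', σ => e.eval σ - e'.eval σ
  | lt e e', σ => if e.eval σ < e'.eval σ then 1 else 0
  | eq e e', σ => if e.eval σ = e'.eval σ then 1 else 0
  | ite b e e', σ => if b.eval σ ≠ 0 then e.eval σ else e'.eval σ
  | sum x N e, σ => ∑ i ∈ Finset.range (N.eval σ), e.eval (σ.set x i)
  | fold x y N e₀ e, σ =>
    Nat.rec (e₀.eval σ) (fun i m => e.eval ((σ.set x i).set y m)) (N.eval σ)

/-- The program that computes the value of an expression into the register `d`, with registers
above `d` for its intermediate results. Bound registers are saved and restored. -/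
def E.code : E → ℕ → Program
  | lit m, d => .const d m
  | var x, d => .copy d x.num
  | get a i, d => .seq (i.code d) (.load d a.num d)
  | add e e', d => .seq (e.code d) (.seq (e'.code (d + 1)) (addLoop d (d + 1) (d + 2)))
  | sub e e', d => .seq (e.code d) (.seq (e'.code (d + 1)) (subLoop d (d + 1) (d + 2)))
  | lt e e', d => .seq (e.code d) (.seq (e'.code (d + 1))
      (.ite (.lt d (d + 1)) (.const d 1) (.const d 0)))
  | eq e e', d => .seq (e.code d) (.seq (e'.code (d + 1))
      (.ite (.eq d (d + 1)) (.const d 1) (.const d 0)))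
  | ite b e e', d => .seq (b.code d) (.seq (.const (d + 1) 0)
      (.ite (.ne d (d + 1)) (e.code d) (e'.code d)))
  | sum x N e, d =>
    .seq (N.code (d + 1)) (.seq (.copy (d + 2) x.num) (.seq (.const d 0) (.seq (.const (d + 3) 0)
      (.seq (.while (.lt (d + 3) (d + 1))
        (.seq (.seq (.copy x.num (d + 3)) (.seq (e.code (d + 4)) (addLoop d (d + 4) (d + 5))))
          (.succ (d + 3))))
      (.copy x.num (d + 2))))))
  | fold x y N e₀ e, d =>
    .seq (e₀.code d) (.seq (N.code (d + 1)) (.seq (.copy (d + 2) x.num) (.seq (.copy (d + 3) y.num)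
      (.seq (.const (d + 4) 0)
        (.seq (.while (.lt (d + 4) (d + 1))
          (.seq (.seq (.copy x.num (d + 4)) (.seq (.copy y.num d)
            (.seq (e.code (d + 5)) (.copy d (d + 5))))) (.succ (d + 4))))
        (.seq (.copy y.num (d + 3)) (.copy x.num (d + 2))))))))

/-- The registers that only hold numbers of size polynomial in the number of vertices. -/
def Var.small : Var → Bool
  | kin | pow | next | idx | word | guess | old | new | val | acc => false
  | _ => true

/-- The arrays all of whose cells are of size polynomial in the number of vertices. -/
def Arr.small : Arr → Bool
  | pos => true
  | _ => false

/-- A syntactic condition for the value of an expression to be small, see `E.eval_le`. -/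
def E.small : E → Bool
  | lit _ => true
  | var x => x.small
  | get a _ => a.small
  | add e e' => e.small && e'.small
  | sub e _ => e.small
  | lt _ _ => true
  | eq _ _ => true
  | ite _ e e' => e.small && e'.small
  | sum _ _ _ => true
  | fold _ _ _ _ _ => false

/-- A syntactic condition for the evaluation of an expression to be fast, see `E.exec_code`: all
numbers of repetitions are small, where adding or subtracting `m` takes `m` repetitions. -/
def E.ok : E → Bool
  | lit _ => true
  | var _ => true
  | get _ i => i.ok
  | add e e' => e.ok && e'.ok && e'.small
  | sub e e' => e.ok && e'.ok && e'.small
  | lt e e' => e.ok && e'.ok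
  | eq e e' => e.ok && e'.ok
  | ite b e e' => b.ok && e.ok && e'.ok
  | sum _ N e => N.ok && N.small && e.ok && e.small
  | fold _ y N e₀ e => e₀.ok && N.ok && N.small && e.ok && !y.small

/-- If all small registers and cells are at most `M`, then `(M + 2) ^ e.deg` bounds the time for the
evaluation of `e`, and its value if `e` is small. -/
def E.deg : E → ℕ
  | lit m => m + 1
  | var _ => 1
  | get _ i => i.deg + 1
  | add e e' => e.deg + e'.deg + 4
  | sub e e' => e.deg + e'.deg + 4
  | lt e e' => e.deg + e'.deg + 4
  | eq e e' => e.deg + e'.deg + 4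
  | ite b e e' => b.deg + e.deg + e'.deg + 4
  | sum _ N e => N.deg + (N.deg + 1) * e.deg + 5
  | fold _ _ N e₀ e => e₀.deg + N.deg + (N.deg + 1) * e.deg + 5

/-- All small registers and cells are at most `M`. -/
structure Small (M : ℕ) (σ : Store) : Prop where
  reg : ∀ x : Var, x.small = true → σ.reg x ≤ M
  arr : ∀ a : Arr, a.small = true → ∀ i, σ.arr a i ≤ M

theorem Small.mono {M M' : ℕ} {σ : Store} (h : Small M σ) (hM : M ≤ M') : Small M' σ :=
  ⟨fun x hx => (h.reg x hx).trans hM, fun a ha i => (h.arr a ha i).trans hM⟩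

theorem Small.set {M : ℕ} {σ : Store} (h : Small M σ) {x : Var} {m : ℕ}
    (hm : x.small = true → m ≤ M) : Small M (σ.set x m) := by
  refine ⟨fun y hy => ?_, h.arr⟩
  by_cases hyx : y = x
  · subst hyx; simpa using hm hy
  · simpa [hyx] using h.reg y hy

theorem Small.setCell {M : ℕ} {σ : Store} (h : Small M σ) {a : Arr} {i m : ℕ}
    (hm : a.small = true → m ≤ M) : Small M (σ.setCell a i m) := by
  refine ⟨h.reg, fun b hb j => ?_⟩
  by_cases hyx : b = a ∧ j = i
  · obtain ⟨rfl, rfl⟩ := hyx; simpa using hm hb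
  · simpa [hyx] using h.arr b hb j

theorem E.one_le_deg (e : E) : 1 ≤ e.deg := by cases e <;> simp [E.deg]

/-- Two polynomial bounds compose to a polynomial bound. -/
theorem pow_comp_le {X a b : ℕ} (hX : 2 ≤ X) (ha : 1 ≤ a) :
    (X ^ a + 2) ^ b ≤ X ^ ((a + 1) * b) := by
  rw [pow_mul]
  refine Nat.pow_le_pow_left ?_ b
  have h1 : X ≤ X ^ a := Nat.le_self_pow (by omega) X
  have : X ^ a * 2 ≤ X ^ a * X := Nat.mul_le_mul_left _ hX
  rw [pow_succ]; omega

theorem sixteen_mul_le {X a : ℕ} (hX : 2 ≤ X) : 16 * X ^ a ≤ X ^ (a + 4) := by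
  have : 2 ^ 4 ≤ X ^ 4 := Nat.pow_le_pow_left hX 4
  rw [pow_add, mul_comm]
  exact Nat.mul_le_mul_left _ this

theorem Small.set_bound {M B : ℕ} {σ : Store} (h : Small M σ) {e : E} (hB : B ≤ (M + 2) ^ e.deg)
    {i : ℕ} (hi : i < B) (x : Var) : Small ((M + 2) ^ e.deg) (σ.set x i) := by
  refine (h.mono ?_).set fun _ => by omega
  have : M + 2 ≤ (M + 2) ^ e.deg := Nat.le_self_pow (by have := e.one_le_deg; omega) _
  omega

/-- The value of a small expression is polynomially bounded. A sum is evaluated with its bound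
register as large as the number of terms, so that the bounds are composed; `E.deg` allows for
this. -/
theorem E.eval_le {e : E} (h : e.ok = true) (hs : e.small = true) {M : ℕ} {σ : Store}
    (hσ : Small M σ) : e.eval σ ≤ (M + 2) ^ e.deg := by
  induction e generalizing M σ with
  | lit m =>
    calc m ≤ 2 ^ (m + 1) := by have := @Nat.lt_two_pow_self (m + 1); omega
      _ ≤ _ := Nat.pow_le_pow_left (by omega) _
  | var x => have := hσ.reg x hs; simp only [eval, deg, pow_one]; omega
  | get a i _ =>
    have := hσ.arr a hs (i.eval σ)
    have h2 : (M + 2) ≤ (M + 2) ^ (i.deg + 1) := Nat.le_self_pow (by omega) _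
    simp only [eval, deg]; omega
  | add e e' ih ih' =>
    simp only [ok, small, Bool.and_eq_true] at h hs
    have h1 := ih h.1.1 hs.1 hσ
    have h2 := ih' h.1.2 hs.2 hσ
    have h3 := sixteen_mul_le (X := M + 2) (a := e.deg + e'.deg) (by omega)
    have h4 : (M + 2) ^ e.deg ≤ (M + 2) ^ (e.deg + e'.deg) :=
      Nat.pow_le_pow_right (by omega) (by omega)
    have h5 : (M + 2) ^ e'.deg ≤ (M + 2) ^ (e.deg + e'.deg) :=
      Nat.pow_le_pow_right (by omega) (by omega)
    simp only [eval, deg]; omega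
  | sub e e' ih _ =>
    simp only [ok, small, Bool.and_eq_true] at h hs
    have h1 := ih h.1.1 hs hσ
    have h4 : (M + 2) ^ e.deg ≤ (M + 2) ^ (e.deg + e'.deg + 4) :=
      Nat.pow_le_pow_right (by omega) (by omega)
    simp only [eval, deg]; omega
  | lt e e' _ _ | eq e e' _ _ =>
    have : 1 ≤ (M + 2) ^ (e.deg + e'.deg + 4) := Nat.one_le_pow _ _ (by omega)
    simp only [eval, deg]; split_ifs <;> omega
  | ite b e e' _ ih ih' =>
    simp only [ok, small, Bool.and_eq_true] at h hs
    have h1 := ih h.1.2 hs.1 hσ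
    have h2 := ih' h.2 hs.2 hσ
    have h4 : (M + 2) ^ e.deg ≤ (M + 2) ^ (b.deg + e.deg + e'.deg + 4) :=
      Nat.pow_le_pow_right (by omega) (by omega)
    have h5 : (M + 2) ^ e'.deg ≤ (M + 2) ^ (b.deg + e.deg + e'.deg + 4) :=
      Nat.pow_le_pow_right (by omega) (by omega)
    simp only [eval, deg]; split_ifs <;> omega
  | sum x N e ihN ih =>
    simp only [ok, Bool.and_eq_true] at h
    have h1 := ihN h.1.1.1 h.1.1.2 hσ
    simp only [eval, deg]
    calc _ ≤ ∑ i ∈ Finset.range (N.eval σ), (M + 2) ^ ((N.deg + 1) * e.deg) := by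
          refine Finset.sum_le_sum fun i hi => ?_
          refine (ih h.1.2 h.2 (hσ.set_bound h1 (Finset.mem_range.1 hi) x)).trans ?_
          exact pow_comp_le (by omega) N.one_le_deg
      _ = N.eval σ * (M + 2) ^ ((N.deg + 1) * e.deg) := by simp
      _ ≤ (M + 2) ^ N.deg * (M + 2) ^ ((N.deg + 1) * e.deg) := Nat.mul_le_mul_right _ h1
      _ = (M + 2) ^ (N.deg + (N.deg + 1) * e.deg) := (pow_add _ _ _).symm
      _ ≤ _ := Nat.pow_le_pow_right (by omega) (by omega)
  | fold => simp [small] at hs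

/-- The code of an expression computes its value, changes no named register or array, and takes
polynomial time if the expression is `ok`. -/
theorem E.exec_code {e : E} (h : e.ok = true) {M : ℕ} {σ : Store} (hσ : Small M σ) {d : ℕ}
    (hd : 32 ≤ d) {s : State} (hs : Rep s σ) :
    ∃ t s', Exec (e.code d) s t s' ∧ t ≤ (M + 2) ^ e.deg ∧ Rep s' σ ∧ Frame d s s' ∧
      s'.reg d = e.eval σ := by
  induction e generalizing M σ d s with
  | lit m =>
    exact ⟨1, _, .const _ _ _, Nat.one_le_pow _ _ (by omega), hs.setReg hd _,
      (Frame.refl _ _).setReg le_rfl _, by simp [eval]⟩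
  | var x =>
    exact ⟨1, _, .copy _ _ _, Nat.one_le_pow _ _ (by omega), hs.setReg hd _,
      (Frame.refl _ _).setReg le_rfl _, by simp [eval, hs.reg]⟩
  | get a i ih =>
    obtain ⟨t, s', ex, ht, hr, hf, hv⟩ := ih h hσ hd hs
    refine ⟨_, _, .seq ex (.load _ _ _ _), ?_, hr.setReg hd _, hf.setReg le_rfl _, ?_⟩
    · have : 1 ≤ (M + 2) ^ i.deg := Nat.one_le_pow _ _ (by omega)
      have h2 : (M + 2) ^ i.deg * 2 ≤ (M + 2) ^ i.deg * (M + 2) := Nat.mul_le_mul_left _ (by omega)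
      simp only [deg, pow_succ]; omega
    · simp [eval, hv, hr.arr]
  | add e e' ih ih' =>
    simp only [ok, Bool.and_eq_true] at h
    obtain ⟨t, s', ex, ht, hr, hf, hv⟩ := ih h.1.1 hσ hd hs
    obtain ⟨t', s'', ex', ht', hr', hf', hv'⟩ := ih' h.1.2 hσ (show 32 ≤ d + 1 by omega) hr
    obtain ⟨t2, s3, ex2, ht2, ha, hv2, hr2⟩ := exec_addLoop (d := d) (m := d + 1) (e := d + 2)
      (by omega) (by omega) (by omega) s''
    refine ⟨_, s3, .seq ex (.seq ex' ex2), ?_, ?_, ?_, ?_⟩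
    · have h0 := E.eval_le h.1.2 h.2 hσ
      have h3 := sixteen_mul_le (X := M + 2) (a := e.deg + e'.deg) (by omega)
      have h4 : (M + 2) ^ e.deg ≤ (M + 2) ^ (e.deg + e'.deg) :=
        Nat.pow_le_pow_right (by omega) (by omega)
      have h5 : (M + 2) ^ e'.deg ≤ (M + 2) ^ (e.deg + e'.deg) :=
        Nat.pow_le_pow_right (by omega) (by omega)
      have h6 : 1 ≤ (M + 2) ^ (e.deg + e'.deg) := Nat.one_le_pow _ _ (by omega)
      rw [hv'] at ht2
      simp only [deg]; omega
    · refine ⟨fun x => ?_, fun a => by rw [ha]; exact hr'.arr a⟩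
      have := x.num_lt
      rw [hr2 _ (by omega) (by omega) (by omega)]; exact hr'.reg x
    · intro r h1 h2
      rw [hr2 _ (by omega) (by omega) (by omega), hf' r h1 (by omega), hf r h1 h2]
    · rw [hv2, hv', hf' d hd (by omega), hv]; rfl
  | sub e e' ih ih' =>
    simp only [ok, Bool.and_eq_true] at h
    obtain ⟨t, s', ex, ht, hr, hf, hv⟩ := ih h.1.1 hσ hd hs
    obtain ⟨t', s'', ex', ht', hr', hf', hv'⟩ := ih' h.1.2 hσ (show 32 ≤ d + 1 by omega) hr
    obtain ⟨t2, s3, ex2, ht2, ha, hv2, hr2⟩ := exec_subLoop (d := d) (m := d + 1) (e := d + 2)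
      (by omega) (by omega) (by omega) s''
    refine ⟨_, s3, .seq ex (.seq ex' ex2), ?_, ?_, ?_, ?_⟩
    · have h0 := E.eval_le h.1.2 h.2 hσ
      have h3 := sixteen_mul_le (X := M + 2) (a := e.deg + e'.deg) (by omega)
      have h4 : (M + 2) ^ e.deg ≤ (M + 2) ^ (e.deg + e'.deg) :=
        Nat.pow_le_pow_right (by omega) (by omega)
      have h5 : (M + 2) ^ e'.deg ≤ (M + 2) ^ (e.deg + e'.deg) :=
        Nat.pow_le_pow_right (by omega) (by omega)
      have h6 : 1 ≤ (M + 2) ^ (e.deg + e'.deg) := Nat.one_le_pow _ _ (by omega)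
      rw [hv'] at ht2
      simp only [deg]; omega
    · refine ⟨fun x => ?_, fun a => by rw [ha]; exact hr'.arr a⟩
      have := x.num_lt
      rw [hr2 _ (by omega) (by omega) (by omega)]; exact hr'.reg x
    · intro r h1 h2
      rw [hr2 _ (by omega) (by omega) (by omega), hf' r h1 (by omega), hf r h1 h2]
    · rw [hv2, hv', hf' d hd (by omega), hv]; rfl
  | lt e e' ih ih' =>
    simp only [ok, Bool.and_eq_true] at h
    obtain ⟨t, s', ex, ht, hr, hf, hv⟩ := ih h.1 hσ hd hs
    obtain ⟨t', s'', ex', ht', hr', hf', hv'⟩ := ih' h.2 hσ (show 32 ≤ d + 1 by omega) hr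
    have h3 := sixteen_mul_le (X := M + 2) (a := e.deg + e'.deg) (by omega)
    have h4 : (M + 2) ^ e.deg ≤ (M + 2) ^ (e.deg + e'.deg) :=
      Nat.pow_le_pow_right (by omega) (by omega)
    have h5 : (M + 2) ^ e'.deg ≤ (M + 2) ^ (e.deg + e'.deg) :=
      Nat.pow_le_pow_right (by omega) (by omega)
    have h6 : 1 ≤ (M + 2) ^ (e.deg + e'.deg) := Nat.one_le_pow _ _ (by omega)
    have hd1 : s''.reg d = e.eval σ := by rw [hf' d hd (by omega), hv]
    have hF : Frame d s s'' := hf.trans (hf'.mono (by omega))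
    by_cases hb : Test.Holds s'' (.lt d (d + 1))
    · refine ⟨_, _, .seq ex (.seq ex' (.ite_true hb (.const _ _ _))), ?_, hr'.setReg hd _,
        hF.setReg le_rfl _, ?_⟩
      · simp only [deg]; omega
      · simp only [Test.Holds, hv', hd1] at hb
        simp [eval, hb]
    · refine ⟨_, _, .seq ex (.seq ex' (.ite_false hb (.const _ _ _))), ?_, hr'.setReg hd _,
        hF.setReg le_rfl _, ?_⟩
      · simp only [deg]; omega
      · simp only [Test.Holds, hv', hd1] at hb
        simp [eval]; omega
  | eq e e' ih ih' =>
    simp only [ok, Bool.and_eq_true] at h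
    obtain ⟨t, s', ex, ht, hr, hf, hv⟩ := ih h.1 hσ hd hs
    obtain ⟨t', s'', ex', ht', hr', hf', hv'⟩ := ih' h.2 hσ (show 32 ≤ d + 1 by omega) hr
    have h3 := sixteen_mul_le (X := M + 2) (a := e.deg + e'.deg) (by omega)
    have h4 : (M + 2) ^ e.deg ≤ (M + 2) ^ (e.deg + e'.deg) :=
      Nat.pow_le_pow_right (by omega) (by omega)
    have h5 : (M + 2) ^ e'.deg ≤ (M + 2) ^ (e.deg + e'.deg) :=
      Nat.pow_le_pow_right (by omega) (by omega)
    have h6 : 1 ≤ (M + 2) ^ (e.deg + e'.deg) := Nat.one_le_pow _ _ (by omega)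
    have hd1 : s''.reg d = e.eval σ := by rw [hf' d hd (by omega), hv]
    have hF : Frame d s s'' := hf.trans (hf'.mono (by omega))
    by_cases hb : Test.Holds s'' (.eq d (d + 1))
    · refine ⟨_, _, .seq ex (.seq ex' (.ite_true hb (.const _ _ _))), ?_, hr'.setReg hd _,
        hF.setReg le_rfl _, ?_⟩
      · simp only [deg]; omega
      · simp only [Test.Holds, hv', hd1] at hb
        simp [eval, hb]
    · refine ⟨_, _, .seq ex (.seq ex' (.ite_false hb (.const _ _ _))), ?_, hr'.setReg hd _,
        hF.setReg le_rfl _, ?_⟩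
      · simp only [deg]; omega
      · simp only [Test.Holds, hv', hd1] at hb
        simp [eval]; omega
  | ite b e e' ihb ih ih' =>
    simp only [ok, Bool.and_eq_true] at h
    obtain ⟨t, s', ex, ht, hr, hf, hv⟩ := ihb h.1.1 hσ hd hs
    have h3 := sixteen_mul_le (X := M + 2) (a := b.deg + e.deg + e'.deg) (by omega)
    have h4 : (M + 2) ^ e.deg ≤ (M + 2) ^ (b.deg + e.deg + e'.deg) :=
      Nat.pow_le_pow_right (by omega) (by omega)
    have h5 : (M + 2) ^ e'.deg ≤ (M + 2) ^ (b.deg + e.deg + e'.deg) :=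
      Nat.pow_le_pow_right (by omega) (by omega)
    have h7 : (M + 2) ^ b.deg ≤ (M + 2) ^ (b.deg + e.deg + e'.deg) :=
      Nat.pow_le_pow_right (by omega) (by omega)
    have h6 : 1 ≤ (M + 2) ^ (b.deg + e.deg + e'.deg) := Nat.one_le_pow _ _ (by omega)
    have hr1 := hr.setReg (r := d + 1) (by omega) 0
    have hf1 : Frame d s (s'.setReg (d + 1) 0) := hf.setReg (by omega) _
    by_cases hb : Test.Holds (s'.setReg (d + 1) 0) (.ne d (d + 1))
    · obtain ⟨t1, s1, ex1, ht1, hr1, hf2, hv1⟩ := ih h.1.2 hσ hd hr1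
      refine ⟨_, _, .seq ex (.seq (.const _ _ _) (.ite_true hb ex1)), ?_, hr1, hf1.trans hf2, ?_⟩
      · simp only [deg]; omega
      · simp [Test.Holds, hv] at hb
        simp [eval, hb, hv1]
    · obtain ⟨t1, s1, ex1, ht1, hr1, hf2, hv1⟩ := ih' h.2 hσ hd hr1
      refine ⟨_, _, .seq ex (.seq (.const _ _ _) (.ite_false hb ex1)), ?_, hr1, hf1.trans hf2, ?_⟩
      · simp only [deg]; omega
      · simp [Test.Holds, hv] at hb
        simp [eval, hb, hv1]
  | sum x N e ihN ih =>
    simp only [ok, Bool.and_eq_true] at h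
    obtain ⟨t, s1, ex, ht, hr, hf, hv⟩ := ihN h.1.1.1 hσ (show 32 ≤ d + 1 by omega) hs
    have hN := E.eval_le h.1.1.1 h.1.1.2 hσ
    have hx := x.num_lt
    set s2 := ((s1.setReg (d + 2) (s1.reg x.num)).setReg d 0).setReg (d + 3) 0 with hs2
    set B := (M + 2) ^ ((N.deg + 1) * e.deg) with hB
    obtain ⟨t', s3, ex', ht', h1, h2, h3, h4, ⟨m, h5⟩, h6⟩ := Exec.loop
      (p := .seq (.copy x.num (d + 3)) (.seq (e.code (d + 4)) (addLoop d (d + 4) (d + 5))))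
      (i := d + 3) (N := d + 1) (m := N.eval σ) (T := 4 * B + 3)
      (fun k s' => s'.reg (d + 3) = k ∧ s'.reg (d + 1) = N.eval σ ∧ s'.reg (d + 2) = σ.reg x ∧
        s'.reg d = ∑ i ∈ Finset.range k, e.eval (σ.set x i) ∧ (∃ m, Rep s' (σ.set x m)) ∧
        Frame d s s')
      (fun k s' h => ⟨h.1, h.2.1⟩)
      (by
        rintro k s' hk ⟨h1, h2, h3, h4, ⟨m, h5⟩, h6⟩
        have hr1 : Rep (s'.setReg x.num (s'.reg (d + 3))) (σ.set x k) := by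
          rw [h1]
          have := h5.setVar x k
          convert this using 1
          simp only [Store.set, Store.mk.injEq, and_true]
          funext y; split_ifs <;> rfl
        have hsm := hσ.set_bound hN hk x
        obtain ⟨t1, s4, ex1, ht1, hr4, hf4, hv4⟩ := ih h.1.2 hsm (show 32 ≤ d + 4 by omega) hr1
        obtain ⟨t2, s5, ex2, ht2, ha5, hv5, hr5⟩ := exec_addLoop (d := d) (m := d + 4)
          (e := d + 5) (by omega) (by omega) (by omega) s4
        have hcomp := pow_comp_le (X := M + 2) (a := N.deg) (b := e.deg) (by omega) N.one_le_deg
        have hval := E.eval_le h.1.2 h.2 hsm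
        have hreg : ∀ r, d < r → r < d + 4 → s5.reg r = s'.reg r := fun r ha hb => by
          rw [hr5 _ (by omega) (by omega) (by omega), hf4 _ (by omega) (by omega)]
          simp; omega
        refine ⟨_, s5, .seq (.copy _ _ _) (.seq ex1 ex2), ?_, ?_, ?_, ?_, ?_, ?_, ⟨k, ?_, ?_⟩, ?_⟩
        · rw [hv4] at ht2; omega
        · rw [hreg _ (by omega) (by omega), h1]
        · simp
        · simp [hreg, h2]
        · simp [hreg, h3]
        · simp [hv5, hv4, Finset.sum_range_succ, hf4 d hd (by omega), h4,
            show ¬ d = x.num by omega]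
        · intro y
          have := y.num_lt
          simp only [State.setReg_reg, if_neg (show ¬ y.num = d + 3 by omega)]
          rw [hr5 _ (by omega) (by omega) (by omega)]
          exact hr4.reg y
        · intro a
          rw [State.setReg_arr, ha5]; exact hr4.arr a
        · intro r hr1 hr2
          simp only [State.setReg_reg, if_neg (show ¬ r = d + 3 by omega)]
          rw [hr5 _ (by omega) (by omega) (by omega), hf4 _ hr1 (by omega), State.setReg_reg,
            if_neg (by omega)]
          exact h6 r hr1 hr2)
      (s := s2) (by
        refine ⟨by simp [hs2], by simp [hs2, hv], by simp [hs2, hr.reg], by simp [hs2],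
          ⟨σ.reg x, ?_⟩, ?_⟩
        · have : σ.set x (σ.reg x) = σ := by
            simp only [Store.set]
            congr; funext y; split_ifs with hy <;> simp [hy]
          rw [this]
          exact ((hr.setReg (by omega) _).setReg (by omega) _).setReg (by omega) _
        · exact (((hf.mono (by omega)).setReg (by omega) _).setReg le_rfl _).setReg (by omega) _)
    refine ⟨_, _, .seq ex (.seq (.copy _ _ _) (.seq (.const _ _ _) (.seq (.const _ _ _)
      (.seq ex' (.copy _ _ _))))), ?_, ?_, ?_, ?_⟩
    · have h7 : 1 ≤ (M + 2) ^ N.deg := Nat.one_le_pow _ _ (by omega)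
      have h8 : 1 ≤ B := Nat.one_le_pow _ _ (by omega)
      have h9 : N.eval σ * (4 * B + 3 + 2) ≤ (M + 2) ^ N.deg * (9 * B) :=
        Nat.mul_le_mul hN (by omega)
      have h10 := Nat.mul_le_mul_left ((M + 2) ^ N.deg) h8
      have h11 := sixteen_mul_le (X := M + 2) (a := N.deg + (N.deg + 1) * e.deg) (by omega)
      simp only [deg]
      rw [pow_add (M + 2) N.deg, ← hB] at h11
      rw [pow_succ]
      have h12 := Nat.mul_le_mul_left ((M + 2) ^ (N.deg + (N.deg + 1) * e.deg + 4))
        (show 1 ≤ M + 2 by omega)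
      have h13 : (M + 2) ^ N.deg * (9 * B) = 9 * ((M + 2) ^ N.deg * B) := by ring
      omega
    · rw [h3]; exact h5.restore
    · exact h6.setVar _ _
    · simp [h4, eval, show ¬ d = x.num by omega]
  | fold x y N e₀ e ihN ih₀ ih =>
    simp only [ok, Bool.and_eq_true, Bool.not_eq_true'] at h
    obtain ⟨⟨⟨⟨hok₀, hokN⟩, hsN⟩, hok⟩, hsy⟩ := h
    obtain ⟨t₀, s₀, ex₀, ht₀, hr₀, hf₀, hv₀⟩ := ih₀ hok₀ hσ hd hs
    obtain ⟨t, s1, ex, ht, hr, hf, hv⟩ := ihN hokN hσ (show 32 ≤ d + 1 by omega) hr₀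
    have hN := E.eval_le hokN hsN hσ
    have hx := x.num_lt
    have hy := y.num_lt
    set s2 := ((s1.setReg (d + 2) (s1.reg x.num)).setReg (d + 3)
      ((s1.setReg (d + 2) (s1.reg x.num)).reg y.num)).setReg (d + 4) 0 with hs2
    set B := (M + 2) ^ ((N.deg + 1) * e.deg) with hB
    have hs1 : s1.reg d = e₀.eval σ := by rw [hf d hd (by omega), hv₀]
    obtain ⟨t', s3, ex', ht', h1, h2, h3, h3', h4, h5, h5', h6⟩ := Exec.loop
      (p := .seq (.copy x.num (d + 4)) (.seq (.copy y.num d)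
            (.seq (e.code (d + 5)) (.copy d (d + 5)))))
      (i := d + 4) (N := d + 1) (m := N.eval σ) (T := B + 3)
      (fun k s' => s'.reg (d + 4) = k ∧ s'.reg (d + 1) = N.eval σ ∧ s'.reg (d + 2) = σ.reg x ∧
        s'.reg (d + 3) = σ.reg y ∧
        s'.reg d = Nat.rec (e₀.eval σ) (fun i m => e.eval ((σ.set x i).set y m)) k ∧
        (∀ z : Var, z ≠ x → z ≠ y → s'.reg z.num = σ.reg z) ∧
        (∀ a : Arr, s'.arr a.num = σ.arr a) ∧ Frame d s s')
      (fun k s' h => ⟨h.1, h.2.1⟩)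
      (by
        rintro k s' hk ⟨h1, h2, h3, h3', h4, h5, h5', h6⟩
        have hr1 : Rep ((s'.setReg x.num (s'.reg (d + 4))).setReg y.num
            ((s'.setReg x.num (s'.reg (d + 4))).reg d)) ((σ.set x k).set y (s'.reg d)) := by
          refine ⟨fun z => ?_, h5'⟩
          have hdx : ¬ d = x.num := by omega
          by_cases hzy : z = y
          · simp [hzy, hdx]
          · by_cases hzx : z = x
            · simp [hzx ▸ hzy, hzx, h1, Var.num_injective.eq_iff]
            · simp [hzy, hzx, h5, Var.num_injective.eq_iff]
        have hsm : Small ((M + 2) ^ N.deg) ((σ.set x k).set y (s'.reg d)) :=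
          (hσ.set_bound hN hk x).set (by simp [hsy])
        obtain ⟨t1, s4, ex1, ht1, hr4, hf4, hv4⟩ := ih hok hsm (show 32 ≤ d + 5 by omega) hr1
        have hcomp := pow_comp_le (X := M + 2) (a := N.deg) (b := e.deg) (by omega) N.one_le_deg
        have hreg : ∀ r, d < r → r < d + 5 → s4.reg r = s'.reg r := fun r ha hb => by
          rw [hf4 _ (by omega) (by omega), State.setReg_reg, if_neg (by omega), State.setReg_reg,
            if_neg (by omega)]
        refine ⟨_, _, .seq (.copy _ _ _) (.seq (.copy _ _ _) (.seq ex1 (.copy _ _ _))), ?_, ?_, ?_,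
          ?_, ?_, ?_, ?_, ?_, ?_, ?_⟩
        · omega
        · simp [hreg, h1]
        · simp
        · simp [hreg, h2]
        · simp [hreg, h3]
        · simp [hreg, h3']
        · simp [hv4, h4]
        · intro z hzx hzy
          have := z.num_lt
          rw [State.setReg_reg, State.setReg_reg, if_neg (by omega), if_neg (by omega), hr4.reg]
          simp [hzx, hzy]
        · intro a
          rw [State.setReg_arr, State.setReg_arr, hr4.arr]
          rfl
        · intro r hr1 hr2
          rw [State.setReg_reg, State.setReg_reg, if_neg (by omega), if_neg (by omega),
            hf4 _ hr1 (by omega), State.setReg_reg, if_neg (by omega), State.setReg_reg,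
            if_neg (by omega)]
          exact h6 r hr1 hr2)
      (s := s2) (by
        refine ⟨by simp [hs2], by simp [hs2, hv], by simp [hs2, hr.reg], ?_, by simp [hs2, hs1],
          ?_, hr.arr, ?_⟩
        · simp [hs2, hr.reg, show ¬ y.num = d + 2 by omega]
        · intro z _ _
          have := z.num_lt
          simp only [hs2, State.setReg_reg]
          rw [if_neg (by omega), if_neg (by omega), if_neg (by omega), hr.reg]
        · exact ((((hf₀.trans (hf.mono (by omega))).setReg (by omega) _).setReg (by omega) _).setReg
            (by omega) _))
    refine ⟨_, _, .seq ex₀ (.seq ex (.seq (.copy _ _ _) (.seq (.copy _ _ _) (.seq (.const _ _ _)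
      (.seq ex' (.seq (.copy _ _ _) (.copy _ _ _))))))), ?_, ⟨fun z => ?_, h5'⟩, ?_, ?_⟩
    · have h7 : 1 ≤ (M + 2) ^ N.deg := Nat.one_le_pow _ _ (by omega)
      have h8 : 1 ≤ B := Nat.one_le_pow _ _ (by omega)
      have h9 : N.eval σ * (B + 3 + 2) ≤ (M + 2) ^ N.deg * (6 * B) :=
        Nat.mul_le_mul hN (by omega)
      have h11 := sixteen_mul_le (X := M + 2) (a := e₀.deg + N.deg + (N.deg + 1) * e.deg) (by omega)
      simp only [deg]
      have h14 : 1 ≤ (M + 2) ^ e₀.deg := Nat.one_le_pow _ _ (by omega)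
      rw [pow_add (M + 2) (e₀.deg + N.deg), pow_add (M + 2) e₀.deg, ← hB] at h11
      have h15 : ∀ p q r : ℕ, 1 ≤ p → 1 ≤ q → 1 ≤ r → p ≤ p * q * r ∧ q ≤ p * q * r ∧
          q * r ≤ p * q * r := by
        intro p q r hp hq hr
        refine ⟨?_, ?_, ?_⟩
        · rw [mul_assoc]; exact Nat.le_mul_of_pos_right _ (Nat.mul_pos hq hr)
        · rw [mul_comm p, mul_assoc]; exact Nat.le_mul_of_pos_right _ (Nat.mul_pos hp hr)
        · rw [mul_assoc]; exact Nat.le_mul_of_pos_left _ hp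
      obtain ⟨i1, i2, i3⟩ := h15 _ _ _ h14 h7 h8
      have i4 := Nat.mul_pos h7 h8
      have h13 : (M + 2) ^ N.deg * (6 * B) = 6 * ((M + 2) ^ N.deg * B) := by ring
      rw [pow_succ]
      have h12 := Nat.mul_le_mul_left ((M + 2) ^ (e₀.deg + N.deg + (N.deg + 1) * e.deg + 4))
        (show 2 ≤ M + 2 by omega)
      omega
    · by_cases hzx : z = x
      · simp [hzx, h3, show ¬ d + 2 = y.num by omega]
      · by_cases hzy : z = y
        · simp [hzy, Var.num_injective.eq_iff, hzy ▸ hzx, h3']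
        · simp [Var.num_injective.eq_iff, hzx, hzy, h5]
    · exact (h6.setVar _ _).setVar _ _
    · simp [h4, eval, show ¬ d = x.num by omega, show ¬ d = y.num by omega]

/-! ### Commands -/

/-- A command: a program for each number `d` from which on the temporary registers are free. -/
def Cmd := ℕ → Program

namespace Cmd

/-- `x := e` -/
def assign (x : Var) (e : E) : Cmd := fun d => .seq (e.code d) (.copy x.num d)

/-- `a[i] := e` -/
def store (a : Arr) (i e : E) : Cmd := fun d =>
  .seq (i.code d) (.seq (e.code (d + 1)) (.store a.num d (d + 1)))

/-- do nothing -/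
def skip : Cmd := fun _ => .skip

/-- `p`, then `q` -/
def seq (p q : Cmd) : Cmd := fun d => .seq (p d) (q d)

/-- if the value of `e` is not `0` then `p` else `q` -/
def ite (e : E) (p q : Cmd) : Cmd := fun d =>
  .seq (e.code d) (.seq (.const (d + 1) 0) (.ite (.ne d (d + 1)) (p d) (q d)))

/-- `p` for `x = 0, …, N - 1` in turn; `N` is evaluated once, before the first round -/
def loop (x : Var) (N : E) (p : Cmd) : Cmd := fun d =>
  .seq (N.code d) (.seq (.const (d + 1) 0)
    (.while (.lt (d + 1) d) (.seq (.seq (.copy x.num (d + 1)) (p (d + 2))) (.succ (d + 1)))))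

end Cmd

infixr:60 " ;; " => Cmd.seq

/-- The command `p`, started with contents `σ`, halts after at most `T` steps with contents that
satisfy `Q`, and leaves the temporary registers in use as they are. -/
def Runs (p : Cmd) (σ : Store) (T : ℕ) (Q : Store → Prop) : Prop :=
  ∀ d s, 32 ≤ d → Rep s σ →
    ∃ t s' σ', Exec (p d) s t s' ∧ t ≤ T ∧ Rep s' σ' ∧ Frame d s s' ∧ Q σ'

/-- A bound for the degrees of the expressions in the program. Only its being a constant matters:
for each expression the bound is checked by evaluation. -/
def maxDeg : ℕ := 1000

/-- `L` bounds the time for the evaluation of every expression that occurs in the program, if the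
small registers and cells are at most `M`. -/
structure Clock (M L : ℕ) : Prop where
  cost : ∀ e : E, e.deg ≤ maxDeg → (M + 2) ^ e.deg + 3 ≤ L

theorem clock_pow (M : ℕ) : Clock M ((M + 2) ^ (maxDeg + 3)) := by
  refine ⟨fun e he => ?_⟩
  have h : (M + 2) ^ e.deg ≤ (M + 2) ^ maxDeg := Nat.pow_le_pow_right (by omega) he
  have h1 : 1 ≤ (M + 2) ^ maxDeg := Nat.one_le_pow _ _ (by omega)
  have h2 : (M + 2) ^ maxDeg * 2 ^ 3 ≤ (M + 2) ^ maxDeg * (M + 2) ^ 3 :=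
    Nat.mul_le_mul_left _ (Nat.pow_le_pow_left (by omega) 3)
  rw [pow_add]
  omega

theorem Clock.le {M L : ℕ} (hL : Clock M L) : M + 5 ≤ L := by
  simpa [E.deg] using hL.cost (.var .size) (by decide)

theorem Clock.big {M L : ℕ} (hL : Clock M L) : 64 ≤ L := by
  have := hL.cost (.lit 5) (by decide)
  have h : 2 ^ 6 ≤ (M + 2) ^ (E.lit 5).deg := Nat.pow_le_pow_left (by omega) 6
  omega

theorem Runs.mono {p : Cmd} {σ : Store} {T T' : ℕ} {Q Q' : Store → Prop} (h : Runs p σ T Q)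
    (hT : T ≤ T') (hQ : ∀ σ', Q σ' → Q' σ') : Runs p σ T' Q' := fun d s hd hs => by
  obtain ⟨t, s', σ', h1, h2, h3, h4, h5⟩ := h d s hd hs
  exact ⟨t, s', σ', h1, h2.trans hT, h3, h4, hQ _ h5⟩

theorem Runs.time {p : Cmd} {σ : Store} {T T' : ℕ} {Q : Store → Prop} (h : Runs p σ T Q)
    (hT : T ≤ T') : Runs p σ T' Q := h.mono hT fun _ h => h

theorem Runs.skip {σ : Store} {Q : Store → Prop} (h : Q σ) : Runs Cmd.skip σ 1 Q :=
  fun _ s _ hs => ⟨1, s, σ, .skip _, le_rfl, hs, Frame.refl _ _, h⟩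

theorem Runs.seq {p q : Cmd} {σ : Store} {T T' : ℕ} {Q Q' : Store → Prop} (h : Runs p σ T Q')
    (h' : ∀ σ', Q' σ' → Runs q σ' T' Q) : Runs (p ;; q) σ (T + T') Q := fun d s hd hs => by
  obtain ⟨t, s', σ', h1, h2, h3, h4, h5⟩ := h d s hd hs
  obtain ⟨t', s'', σ'', g1, g2, g3, g4, g5⟩ := h' σ' h5 d s' hd h3
  exact ⟨_, s'', σ'', .seq h1 g1, by omega, g3, h4.trans g4, g5⟩

section

variable {M L : ℕ} {σ : Store} {Q : Store → Prop}

theorem Runs.assign (hL : Clock M L) (hσ : Small M σ) {x : Var} {e : E} (he : e.ok = true)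
    (hd : e.deg ≤ maxDeg) (h : Q (σ.set x (e.eval σ))) : Runs (Cmd.assign x e) σ L Q :=
  fun d s hd' hs => by
    obtain ⟨t, s', h1, h2, h3, h4, h5⟩ := e.exec_code he hσ hd' hs
    have := hL.cost e hd
    refine ⟨_, _, _, .seq h1 (.copy _ _ _), by omega, h3.setVar x _, h4.setVar _ _, ?_⟩
    rwa [h5]

theorem Runs.store (hL : Clock M L) (hσ : Small M σ) {a : Arr} {i e : E} (hi : i.ok = true)
    (he : e.ok = true) (hdi : i.deg ≤ maxDeg) (hde : e.deg ≤ maxDeg)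
    (h : Q (σ.setCell a (i.eval σ) (e.eval σ))) : Runs (Cmd.store a i e) σ (2 * L) Q :=
  fun d s hd' hs => by
    obtain ⟨t, s', h1, h2, h3, h4, h5⟩ := i.exec_code hi hσ hd' hs
    obtain ⟨t', s'', h1', h2', h3', h4', h5'⟩ := e.exec_code he hσ (show 32 ≤ d + 1 by omega) h3
    have := hL.cost i hdi
    have := hL.cost e hde
    refine ⟨_, _, _, .seq h1 (.seq h1' (.store _ _ _ _)), by omega, h3'.setCell a _ _, ?_, ?_⟩
    · exact h4.trans (h4'.mono (Nat.le_succ _))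
    · rwa [h4' d hd' (by omega), h5, h5']

theorem Runs.assign_seq (hL : Clock M L) (hσ : Small M σ) {x : Var} {e : E} (he : e.ok = true)
    (hd : e.deg ≤ maxDeg) {p : Cmd} {T m : ℕ} (hm : e.eval σ = m) (h : Runs p (σ.set x m) T Q) :
    Runs (Cmd.assign x e ;; p) σ (L + T) Q :=
  Runs.seq (Q' := fun σ' => σ' = σ.set x m) (Runs.assign hL hσ he hd (by rw [hm]))
    (by rintro _ rfl; exact h)

theorem Runs.store_seq (hL : Clock M L) (hσ : Small M σ) {a : Arr} {i e : E} (hi : i.ok = true)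
    (he : e.ok = true) (hdi : i.deg ≤ maxDeg) (hde : e.deg ≤ maxDeg) {p : Cmd} {T l m : ℕ}
    (hl : i.eval σ = l) (hm : e.eval σ = m) (h : Runs p (σ.setCell a l m) T Q) :
    Runs (Cmd.store a i e ;; p) σ (2 * L + T) Q :=
  Runs.seq (Q' := fun σ' => σ' = σ.setCell a l m)
    (Runs.store hL hσ hi he hdi hde (by rw [hl, hm])) (by rintro _ rfl; exact h)

theorem Runs.ite (hL : Clock M L) (hσ : Small M σ) {e : E} (he : e.ok = true)
    (hd : e.deg ≤ maxDeg) {p q : Cmd} {T : ℕ} (hp : e.eval σ ≠ 0 → Runs p σ T Q)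
    (hq : e.eval σ = 0 → Runs q σ T Q) : Runs (Cmd.ite e p q) σ (L + T) Q :=
  fun d s hd' hs => by
    obtain ⟨t, s', h1, h2, h3, h4, h5⟩ := e.exec_code he hσ hd' hs
    have := hL.cost e hd
    have hr := h3.setReg (r := d + 1) (by omega) 0
    have hf : Frame d s (s'.setReg (d + 1) 0) := h4.setReg (Nat.le_succ _) 0
    by_cases hb : e.eval σ = 0
    · obtain ⟨t', s'', σ'', g1, g2, g3, g4, g5⟩ := hq hb d _ hd' hr
      refine ⟨_, s'', σ'', .seq h1 (.seq (.const _ _ _) (.ite_false ?_ g1)), by omega, g3,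
        hf.trans g4, g5⟩
      simp [Test.Holds, h5, hb]
    · obtain ⟨t', s'', σ'', g1, g2, g3, g4, g5⟩ := hp hb d _ hd' hr
      refine ⟨_, s'', σ'', .seq h1 (.seq (.const _ _ _) (.ite_true ?_ g1)), by omega, g3,
        hf.trans g4, g5⟩
      simp [Test.Holds, h5, hb]

theorem Runs.loop (hL : Clock M L) (hσ : Small M σ) {x : Var} {N : E} (he : N.ok = true)
    (hd : N.deg ≤ maxDeg) {p : Cmd} {T m : ℕ} (Inv : ℕ → Store → Prop) (hm : N.eval σ = m)
    (h0 : Inv 0 σ) (hp : ∀ i < m, ∀ σ', Inv i σ' → Runs p (σ'.set x i) T (Inv (i + 1)))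
    (hQ : ∀ σ', Inv m σ' → Q σ') : Runs (Cmd.loop x N p) σ (L + m * (T + 3)) Q :=
  fun d s hd' hs => by
    obtain ⟨t, s', h1, h2, h3, h4, h5⟩ := N.exec_code he hσ hd' hs
    have := hL.cost N hd
    obtain ⟨t', s'', g1, g2, g3, g4, σ'', g5, g6, g7⟩ := Exec.loop
      (p := .seq (.copy x.num (d + 1)) (p (d + 2))) (i := d + 1) (N := d) (m := m) (T := T + 1)
      (fun k s' => s'.reg (d + 1) = k ∧ s'.reg d = m ∧ ∃ σ', Rep s' σ' ∧ Frame d s s' ∧ Inv k σ')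
      (fun k s h => ⟨h.1, h.2.1⟩)
      (by
        rintro k s₁ hk ⟨i1, i2, σ₁, i3, i4, i5⟩
        have hr := i3.setVar x (s₁.reg (d + 1))
        have hx := x.num_lt
        rw [i1] at hr
        obtain ⟨t₂, s₂, σ₂, j1, j2, j3, j4, j5⟩ := hp k hk σ₁ i5 (d + 2) _ (by omega) hr
        rw [← i1] at j1
        refine ⟨_, s₂, .seq (.copy _ _ _) j1, by omega, ?_, by simp, ?_, σ₂,
          j3.setReg (by omega) _, ?_, j5⟩
        · rw [j4 _ (by omega) (by omega), State.setReg_reg, if_neg (by omega), i1]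
        · rw [State.setReg_reg, if_neg (by omega), j4 _ (by omega) (by omega), State.setReg_reg,
            if_neg (by omega), i2]
        · exact ((i4.setVar x _).trans (j4.mono (by omega))).setReg (by omega) _)
      (s := s'.setReg (d + 1) 0)
      ⟨by simp, by simp [h5, hm], σ, h3.setReg (by omega) _, h4.setReg (by omega) _, h0⟩
    refine ⟨_, s'', σ'', .seq h1 (.seq (.const _ _ _) g1), ?_, g5, g6, hQ _ g7⟩
    have : m * (T + 1 + 2) = m * (T + 3) := by ring
    omega

end

/-- `σ'` agrees with `σ` except on the registers in `xs` and the arrays in `as`. -/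
structure Keep (xs : List Var) (as : List Arr) (σ σ' : Store) : Prop where
  reg : ∀ x, x ∉ xs → σ'.reg x = σ.reg x
  arr : ∀ a, a ∉ as → σ'.arr a = σ.arr a

theorem Keep.refl (xs : List Var) (as : List Arr) (σ : Store) : Keep xs as σ σ :=
  ⟨fun _ _ => rfl, fun _ _ => rfl⟩

theorem Keep.set {xs : List Var} {as : List Arr} {σ σ' : Store} (h : Keep xs as σ σ') {x : Var}
    (hx : x ∈ xs) (m : ℕ) : Keep xs as σ (σ'.set x m) :=
  ⟨fun y hy => by rw [Store.set_reg, if_neg (by rintro rfl; exact hy hx), h.reg y hy], h.arr⟩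

theorem Keep.setCell {xs : List Var} {as : List Arr} {σ σ' : Store} (h : Keep xs as σ σ') {a : Arr}
    (ha : a ∈ as) (i m : ℕ) : Keep xs as σ (σ'.setCell a i m) :=
  ⟨h.reg, fun b hb => by
    funext j
    rw [Store.setCell_arr, if_neg (by rintro ⟨rfl, -⟩; exact hb ha), h.arr b hb]⟩

theorem Keep.trans {xs xs' : List Var} {as as' : List Arr} {σ σ' σ'' : Store}
    (h : Keep xs as σ σ') (h' : Keep xs' as' σ' σ'') (hx : xs' ⊆ xs) (ha : as' ⊆ as) :
    Keep xs as σ σ'' :=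
  ⟨fun x hx' => (h'.reg x fun h => hx' (hx h)).trans (h.reg x hx'),
    fun a ha' => (h'.arr a fun h => ha' (ha h)).trans (h.arr a ha')⟩

/-! ### Tables for numbers in base four -/

/-- Tables of `4 * i` for `i < pow`, and of `i / 4` and `i % 4` for `i < 4 * pow`. With them, a
digit of a word is found in polynomial time, although the word itself is exponentially large and the
machine can only count. -/
def tables : Cmd :=
  .assign .next (.lit 0) ;;
  .loop .idx (.var .pow) (
    .store .quad (.var .idx) (.var .next) ;;
    .loop .dgt (.lit 4) (
      .store .quot (.var .next) (.var .idx) ;;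
      .store .rem (.var .next) (.var .dgt) ;;
      .assign .next (.add (.var .next) (.lit 1))))

/-- The tables are correct for numbers below `m`. -/
structure Tables (m : ℕ) (σ : Store) : Prop where
  quad : ∀ i < m, σ.arr .quad i = 4 * i
  quot : ∀ i < m, σ.arr .quot i = i / 4
  rem : ∀ i < m, σ.arr .rem i = i % 4

theorem runs_tables {M L m : ℕ} {σ : Store} (hL : Clock M L) (hM : 4 ≤ M) (hσ : Small M σ)
    (hm : σ.reg .pow = m) :
    Runs tables σ (L ^ 3 * (m + 1)) fun σ' =>
      Keep [.next, .idx, .dgt] [.quad, .quot, .rem] σ σ' ∧ Small M σ' ∧ Tables m σ' ∧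
        σ'.reg .next = 4 * m := by
  have hbig := hL.big
  have hT : L + (L + m * (2 * L + (L + 4 * (2 * L + (2 * L + L) + 3)) + 3)) ≤ L ^ 3 * (m + 1) := by
    have h1 : 64 * L ≤ L * L := Nat.mul_le_mul_right _ hbig
    have h2 : 64 * (L * L) ≤ L * (L * L) := Nat.mul_le_mul_right _ hbig
    have h3 : L ^ 3 = L * (L * L) := by ring
    calc _ ≤ L + (L + m * L ^ 3) := by gcongr; omega
      _ ≤ L ^ 3 * (m + 1) := by rw [mul_add, mul_one, mul_comm m]; omega
  refine (Runs.assign_seq hL hσ (by decide) (by decide) (m := 0) rfl ?_).time hT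
  have hσ1 : Small M (σ.set .next 0) := hσ.set (by simp)
  refine Runs.loop hL hσ1 (by decide) (by decide) (m := m) (fun k σ' =>
    Keep [.next, .idx, .dgt] [.quad, .quot, .rem] σ σ' ∧ Small M σ' ∧
    (∀ i < k, σ'.arr .quad i = 4 * i) ∧ (∀ i < 4 * k, σ'.arr .quot i = i / 4) ∧
    (∀ i < 4 * k, σ'.arr .rem i = i % 4) ∧ σ'.reg .next = 4 * k) (by simpa [E.eval] using hm)
    ⟨(Keep.refl _ _ _).set (by decide) _, hσ1, by simp, by simp, by simp, by simp⟩ ?_ ?_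
  · rintro k hk σ1 ⟨i1, i2, i3, i4, i5, i6⟩
    have hs1 : Small M (σ1.set .idx k) := i2.set (by simp [Var.small])
    refine Runs.store_seq hL hs1 (by decide) (by decide) (by decide) (by decide)
      (l := k) (m := 4 * k) (by simp [E.eval]) (by simp [E.eval, i6]) ?_
    have hs2 : Small M ((σ1.set .idx k).setCell .quad k (4 * k)) :=
      hs1.setCell (by simp [Arr.small])
    refine Runs.loop hL hs2 (by decide) (by decide) (m := 4) (fun r σ' =>
      Keep [.next, .idx, .dgt] [.quad, .quot, .rem] σ σ' ∧ Small M σ' ∧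
      (∀ i < k + 1, σ'.arr .quad i = 4 * i) ∧ (∀ i < 4 * k + r, σ'.arr .quot i = i / 4) ∧
      (∀ i < 4 * k + r, σ'.arr .rem i = i % 4) ∧ σ'.reg .next = 4 * k + r ∧ σ'.reg .idx = k)
      rfl ⟨(i1.set (by decide) _).setCell (by decide) _ _, hs2, ?_, ?_, ?_, ?_, ?_⟩ ?_ ?_
    · intro i hi
      by_cases h : i = k
      · simp [h]
      · simp [h, i3 i (by omega)]
    · simpa using i4
    · simpa using i5
    · simpa using i6
    · simp
    · rintro r hr σ2 ⟨j1, j2, j3, j4, j5, j6, j7⟩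
      have hs3 : Small M (σ2.set .dgt r) := j2.set (by intro; omega)
      refine Runs.store_seq hL hs3 (by decide) (by decide) (by decide) (by decide)
        (l := 4 * k + r) (m := k) (by simp [E.eval, j6]) (by simp [E.eval, j7]) ?_
      have hs4 : Small M ((σ2.set .dgt r).setCell .quot (4 * k + r) k) :=
        hs3.setCell (by simp [Arr.small])
      refine Runs.store_seq hL hs4 (by decide) (by decide) (by decide) (by decide)
        (l := 4 * k + r) (m := r) (by simp [E.eval, j6]) (by simp [E.eval]) ?_
      have hs5 := hs4.setCell (a := .rem) (i := 4 * k + r) (m := r) (by simp [Arr.small])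
      refine Runs.assign hL hs5 (by decide) (by decide) ⟨?_, hs5.set (by simp [Var.small]), ?_, ?_,
        ?_, ?_, ?_⟩
      · exact (((j1.set (by decide) _).setCell (by decide) _ _).setCell (by decide) _ _).set
          (by decide) _
      · intro i hi; simp [j3 i hi]
      · intro i hi
        by_cases h : i = 4 * k + r
        · simp [h]; omega
        · simp [h, j4 i (by omega)]
      · intro i hi
        by_cases h : i = 4 * k + r
        · simp [h]; omega
        · simp [h, j5 i (by omega)]
      · simp [E.eval, j6]; omega
      · simp [j7]
    · rintro σ' ⟨j1, j2, j3, j4, j5, j6, j7⟩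
      exact ⟨j1, j2, j3, fun i hi => j4 i (by omega), fun i hi => j5 i (by omega),
        by rw [j6]; ring⟩
  · rintro σ' ⟨i1, i2, i3, i4, i5, i6⟩
    exact ⟨i1, i2, ⟨i3, fun i hi => i4 i (by omega), fun i hi => i5 i (by omega)⟩, i6⟩

/-! ### Vertex covers by branching -/

/-- A state of the search for a vertex cover: the vertices `u` with `cov u ≠ 0` are chosen, `cnt` is
their number and `pos` numbers them; the base-four digits of `guess` tell how to branch, and `fits`
becomes `0` if more vertices are needed than allowed. Two choices per step would need binary digits
only; base four lets the search share its tables with the dynamic program. -/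
structure Branch where
  cov : ℕ → ℕ
  pos : ℕ → ℕ
  cnt : ℕ
  guess : ℕ
  fits : ℕ

open Classical in
/-- If `e` is an edge that is not covered, put one of its ends into the cover, the first one if the
last digit of `guess` is `0`; at most `j` vertices may be chosen. -/
noncomputable def Branch.step (A : ℕ → ℕ → Prop) (j : ℕ) (st : Branch) (e : ℕ × ℕ) : Branch :=
  if A e.1 e.2 ∧ st.cov e.1 = 0 ∧ st.cov e.2 = 0 then
    if st.cnt < j then
      { st with
        cov := Function.update st.cov (if st.guess % 4 = 0 then e.1 else e.2) 1
        pos := Function.update st.pos (if st.guess % 4 = 0 then e.1 else e.2) st.cnt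
        cnt := st.cnt + 1
        guess := st.guess / 4 }
    else { st with fits := 0 }
  else st

/-- All pairs of numbers below `n`. -/
def pairs (n : ℕ) : List (ℕ × ℕ) :=
  (List.range n).flatMap fun u => (List.range n).map fun v => (u, v)

theorem mem_pairs {n : ℕ} {e : ℕ × ℕ} : e ∈ pairs n ↔ e.1 < n ∧ e.2 < n := by
  obtain ⟨u, v⟩ := e
  simp only [pairs, List.mem_flatMap, List.mem_range, List.mem_map, Prod.mk.injEq]
  constructor
  · rintro ⟨a, ha, b, hb, rfl, rfl⟩; exact ⟨ha, hb⟩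
  · rintro ⟨h1, h2⟩; exact ⟨u, h1, v, h2, rfl, rfl⟩

/-- The outcome of the search directed by `w`. -/
noncomputable def Branch.result (A : ℕ → ℕ → Prop) (n j : ℕ) (pos : ℕ → ℕ) (w : ℕ) : Branch :=
  (pairs n).foldl (Branch.step A j) ⟨fun _ => 0, pos, 0, w, 1⟩

/-- `cov` and `pos` describe a vertex cover of the graph on the numbers below `n` with adjacency
`A`, numbered by numbers below `c`. -/
structure IsCover (A : ℕ → ℕ → Prop) (n c : ℕ) (cov pos : ℕ → ℕ) : Prop where
  cover : ∀ u v, u < n → v < n → A u v → cov u ≠ 0 ∨ cov v ≠ 0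
  inj : ∀ u v, cov u ≠ 0 → cov v ≠ 0 → pos u = pos v → u = v
  pos_lt : ∀ u, cov u ≠ 0 → pos u < c

/-- The invariant of the search after the edges in `l` have been covered. -/
structure Branch.Valid (A : ℕ → ℕ → Prop) (n j : ℕ) (l : List (ℕ × ℕ)) (st : Branch) : Prop where
  cover : st.fits ≠ 0 → ∀ e ∈ l, A e.1 e.2 → st.cov e.1 ≠ 0 ∨ st.cov e.2 ≠ 0
  lt : ∀ u, st.cov u ≠ 0 → u < n
  inj : ∀ u v, st.cov u ≠ 0 → st.cov v ≠ 0 → st.pos u = st.pos v → u = v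
  pos_lt : ∀ u, st.cov u ≠ 0 → st.pos u < st.cnt
  cnt_le : st.cnt ≤ j

theorem Branch.Valid.step {A : ℕ → ℕ → Prop} {n j : ℕ} {l : List (ℕ × ℕ)} {st : Branch}
    (h : st.Valid A n j l) {e : ℕ × ℕ} (he : e.1 < n ∧ e.2 < n) :
    (st.step A j e).Valid A n j (l ++ [e]) := by
  by_cases h1 : A e.1 e.2 ∧ st.cov e.1 = 0 ∧ st.cov e.2 = 0
  swap
  · rw [Branch.step, if_neg h1]
    refine ⟨fun hf e' he' hA => ?_, h.lt, h.inj, h.pos_lt, h.cnt_le⟩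
    rcases List.mem_append.1 he' with h' | h'
    · exact h.cover hf e' h' hA
    · rw [List.mem_singleton.1 h'] at hA ⊢
      by_contra hc
      exact h1 ⟨hA, by tauto, by tauto⟩
  by_cases h2 : st.cnt < j
  · rw [Branch.step, if_pos h1, if_pos h2]
    set x := if st.guess % 4 = 0 then e.1 else e.2 with hx
    have hxe : x = e.1 ∨ x = e.2 := by rw [hx]; split_ifs <;> simp
    have hup : ∀ u, Function.update st.cov x 1 u ≠ 0 ↔ u = x ∨ st.cov u ≠ 0 := by
      intro u; by_cases hu : u = x <;> simp [hu]
    refine ⟨?_, ?_, ?_, ?_, h2⟩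
    · intro hf e' he' hA
      simp only [hup]
      rcases List.mem_append.1 he' with h' | h'
      · rcases h.cover hf e' h' hA with h' | h' <;> simp [h']
      · rw [List.mem_singleton.1 h']
        rcases hxe with h' | h' <;> simp [h']
    · intro u hu
      rcases (hup u).1 hu with rfl | hu
      · rcases hxe with h' | h' <;> rw [h']
        exacts [he.1, he.2]
      · exact h.lt u hu
    · intro u v hu hv huv
      have hu := (hup u).1 hu
      have hv := (hup v).1 hv
      simp only [Function.update_apply] at huv
      split_ifs at huv with h3 h4 h4
      · rw [h3, h4]
      · have := h.pos_lt v (hv.resolve_left h4); omega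
      · have := h.pos_lt u (hu.resolve_left h3); omega
      · exact h.inj u v (hu.resolve_left h3) (hv.resolve_left h4) huv
    · intro u hu
      have hu := (hup u).1 hu
      simp only [Function.update_apply]
      split_ifs with h3
      · omega
      · have := h.pos_lt u (hu.resolve_left h3); omega
  · rw [Branch.step, if_pos h1, if_neg h2]
    exact ⟨by simp, h.lt, h.inj, h.pos_lt, h.cnt_le⟩

theorem Branch.Valid.foldl {A : ℕ → ℕ → Prop} {n j : ℕ} {l l' : List (ℕ × ℕ)} {st : Branch}
    (h : st.Valid A n j l) (hl : ∀ e ∈ l', e.1 < n ∧ e.2 < n) :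
    (l'.foldl (Branch.step A j) st).Valid A n j (l ++ l') := by
  induction l' generalizing l st with
  | nil => simpa using h
  | cons e l' ih =>
    have := ih (h.step (hl e (by simp))) fun e' he' => hl e' (by simp [he'])
    simpa using this

theorem Branch.valid_init (A : ℕ → ℕ → Prop) (n j : ℕ) (pos : ℕ → ℕ) (w : ℕ) :
    (⟨fun _ => 0, pos, 0, w, 1⟩ : Branch).Valid A n j [] :=
  ⟨by simp, by simp, by simp, by simp, by simp⟩

theorem Branch.isCover_result {A : ℕ → ℕ → Prop} {n j w : ℕ} {pos : ℕ → ℕ}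
    (h : (Branch.result A n j pos w).fits ≠ 0) :
    IsCover A n j (Branch.result A n j pos w).cov (Branch.result A n j pos w).pos := by
  have H := (Branch.valid_init A n j pos w).foldl (l' := pairs n) fun e he => mem_pairs.1 he
  exact ⟨fun u v hu hv hA => H.cover h (u, v) (by simpa using mem_pairs.2 ⟨hu, hv⟩) hA, H.inj,
    fun u hu => (H.pos_lt u hu).trans_le H.cnt_le⟩

/-- If `K` is a vertex cover that contains the chosen vertices, then there are digits that make the
search stay within `K`. -/
theorem Branch.exists_guess {A : ℕ → ℕ → Prop} {j : ℕ} (K : Finset ℕ) (l : List (ℕ × ℕ))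
    (hl : ∀ e ∈ l, A e.1 e.2 → e.1 ∈ K ∨ e.2 ∈ K) (cov : ℕ → ℕ) (cnt : ℕ)
    (hj : cnt + (K.filter (cov · = 0)).card ≤ j) :
    ∃ w < 4 ^ (j - cnt), ∀ pos, (l.foldl (Branch.step A j) ⟨cov, pos, cnt, w, 1⟩).fits = 1 := by
  induction l generalizing cov cnt with
  | nil => exact ⟨0, by positivity, fun _ => rfl⟩
  | cons e l ih =>
    by_cases h1 : A e.1 e.2 ∧ cov e.1 = 0 ∧ cov e.2 = 0
    · obtain ⟨b, hb, hbK, hb0⟩ : ∃ b < 2, (if b = 0 then e.1 else e.2) ∈ K ∧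
          cov (if b = 0 then e.1 else e.2) = 0 := by
        rcases hl e (by simp) h1.1 with h | h
        · exact ⟨0, by omega, by simpa using h, by simpa using h1.2.1⟩
        · exact ⟨1, by omega, by simpa using h, by simpa using h1.2.2⟩
      set x := if b = 0 then e.1 else e.2 with hx
      have hcard : (K.filter (Function.update cov x 1 · = 0)).card + 1
          ≤ (K.filter (cov · = 0)).card := by
        rw [← Finset.card_erase_add_one (a := x) (s := K.filter (cov · = 0)) (by simp [hbK, hb0])]
        gcongr
        intro y hy
        simp only [Finset.mem_filter, Function.update_apply, Finset.mem_erase] at hy ⊢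
        by_cases hyx : y = x
        · simp [hyx] at hy
        · simpa [hyx] using hy
      obtain ⟨w, hw, H⟩ := ih (fun e' he' => hl e' (by simp [he'])) (Function.update cov x 1)
        (cnt + 1) (by omega)
      refine ⟨4 * w + b, ?_, fun pos => ?_⟩
      · have : 4 ^ (j - cnt) = 4 ^ (j - (cnt + 1)) * 4 := by
          rw [← pow_succ]; congr 1; omega
        omega
      · have hm : (4 * w + b) % 4 = b := by omega
        have hd : (4 * w + b) / 4 = w := by omega
        rw [List.foldl_cons, Branch.step]
        simp only [if_pos h1, if_pos (show cnt < j by omega), hm, hd, ← hx]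
        exact H _
    · obtain ⟨w, hw, H⟩ := ih (fun e' he' => hl e' (by simp [he'])) cov cnt hj
      refine ⟨w, hw, fun pos => ?_⟩
      rw [List.foldl_cons, Branch.step]
      simp only [if_neg h1]
      exact H _

/-- With a vertex cover of size at most `j` some branch succeeds. -/
theorem Branch.exists_fits {A : ℕ → ℕ → Prop} {n j : ℕ} (K : Finset ℕ)
    (hK : ∀ u v, u < n → v < n → A u v → u ∈ K ∨ v ∈ K) (hj : K.card ≤ j) :
    ∃ w < 4 ^ j, ∀ pos, (Branch.result A n j pos w).fits = 1 :=
  Branch.exists_guess K (pairs n)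
    (fun e he => hK e.1 e.2 (mem_pairs.1 he).1 (mem_pairs.1 he).2) (fun _ => 0) 0 (by simpa)

/-! ### The search program -/

/-- The entry of the adjacency matrix in the row `e` and the column `e'`; the product of `e` and the
size is a sum of `size` terms `e`. -/
def adjE (e e' : E) : E := .get .adj (.add (.sum .row e (.var .size)) e')

/-- conjunction -/
def andE (e e' : E) : E := .ite e e' (.lit 0)

/-- One branching step for the pair `(src, dst)`. -/
def branchStep : Cmd :=
  .ite (andE (adjE (.var .src) (.var .dst))
      (andE (.eq (.get .cov (.var .src)) (.lit 0)) (.eq (.get .cov (.var .dst)) (.lit 0))))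
    (.ite (.lt (.var .cnt) (.var .round))
      (.assign .pick (.ite (.eq (.get .rem (.var .guess)) (.lit 0)) (.var .src) (.var .dst)) ;;
        .store .cov (.var .pick) (.lit 1) ;;
        .store .pos (.var .pick) (.var .cnt) ;;
        .assign .cnt (.add (.var .cnt) (.lit 1)) ;;
        .assign .guess (.get .quot (.var .guess)))
      (.assign .fits (.lit 0)))
    .skip

/-- The search directed by `word`. -/
def branch : Cmd :=
  .loop .src (.var .size) (.store .cov (.var .src) (.lit 0)) ;;
  .assign .cnt (.lit 0) ;;
  .assign .fits (.lit 1) ;;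
  .assign .guess (.var .word) ;;
  .loop .src (.var .size) (.loop .dst (.var .size) branchStep)

theorem adjE_eval (e e' : E) (σ : Store) :
    (adjE e e').eval σ = σ.arr .adj (e.eval σ * σ.reg .size + e'.eval σ) := by
  simp [adjE, E.eval]

theorem andE_ne_zero (e e' : E) (σ : Store) :
    (andE e e').eval σ ≠ 0 ↔ e.eval σ ≠ 0 ∧ e'.eval σ ≠ 0 := by
  simp [andE, E.eval]

/-- The adjacency matrix is the one of `A`. -/
def AdjCells (A : ℕ → ℕ → Prop) (n : ℕ) (σ : Store) : Prop :=
  ∀ u v, u < n → v < n → (σ.arr .adj (u * n + v) ≠ 0 ↔ A u v)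

/-- The state of the search in the memory. -/
structure Branch.At (st : Branch) (σ : Store) : Prop where
  cov : σ.arr .cov = st.cov
  pos : σ.arr .pos = st.pos
  cnt : σ.reg .cnt = st.cnt
  guess : σ.reg .guess = st.guess
  fits : σ.reg .fits = st.fits

/-- The registers that the search changes. -/
abbrev branchRegs : List Var := [.src, .dst, .cnt, .fits, .guess, .pick]

theorem runs_branchStep {M L n j P : ℕ} {A : ℕ → ℕ → Prop} {σ : Store} {st : Branch}
    (hL : Clock M L) (hσ : Small M σ) (hM : n + 1 ≤ M) (hn : σ.reg .size = n)
    (hA : AdjCells A n σ) (hT : Tables P σ) (hg : st.guess < P) (hj : σ.reg .round = j)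
    (hjM : j ≤ n) (hst : st.At σ) {u v : ℕ} (hu : σ.reg .src = u) (hv : σ.reg .dst = v)
    (hun : u < n) (hvn : v < n) :
    Runs branchStep σ (10 * L) fun σ' =>
      Keep [.cnt, .fits, .guess, .pick] [.cov, .pos] σ σ' ∧ Small M σ' ∧
      (st.step A j (u, v)).At σ' ∧ (st.step A j (u, v)).guess < P := by
  have hbig := hL.big
  have hcond : (andE (adjE (.var .src) (.var .dst)) (andE (.eq (.get .cov (.var .src)) (.lit 0))
      (.eq (.get .cov (.var .dst)) (.lit 0)))).eval σ ≠ 0 ↔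
      A u v ∧ st.cov u = 0 ∧ st.cov v = 0 := by
    rw [andE_ne_zero, andE_ne_zero, adjE_eval]
    simp only [E.eval, hu, hv, hn, hst.cov]
    rw [hA u v hun hvn]
    simp
  refine (Runs.ite (T := 9 * L) hL hσ (by decide) (by decide) ?_ ?_).time (by omega)
  · intro hc
    have hc' := hcond.1 hc
    refine (Runs.ite (T := 7 * L) hL hσ (by decide) (by decide) ?_ ?_).time (by omega)
    · intro hlt
      have hlt' : st.cnt < j := by simpa [E.eval, hst.cnt, hj] using hlt
      rw [Branch.step, if_pos hc', if_pos hlt']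
      set x := if st.guess % 4 = 0 then u else v with hx
      have hxn : x < n := by rw [hx]; split_ifs <;> assumption
      refine (Runs.assign_seq hL hσ (by decide) (by decide) (m := x) ?_ ?_).time
        (show L + 6 * L ≤ _ by omega)
      · simp [E.eval, hst.guess, hT.rem _ hg, hu, hv, hx]
      have h1 : Small M (σ.set .pick x) := hσ.set (by intro; omega)
      refine (Runs.store_seq hL h1 (by decide) (by decide) (by decide) (by decide) (l := x) (m := 1)
        (by simp [E.eval]) (by simp [E.eval]) ?_).time (show 2 * L + 4 * L ≤ _ by omega)
      have h2 := h1.setCell (a := .cov) (i := x) (m := 1) (by simp [Arr.small])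
      refine (Runs.store_seq hL h2 (by decide) (by decide) (by decide) (by decide) (l := x)
        (m := st.cnt) (by simp [E.eval]) (by simp [E.eval, hst.cnt]) ?_).time
        (show 2 * L + 2 * L ≤ _ by omega)
      have h3 := h2.setCell (a := .pos) (i := x) (m := st.cnt) (by intro; omega)
      refine (Runs.assign_seq hL h3 (by decide) (by decide) (m := st.cnt + 1)
        (by simp [E.eval, hst.cnt]) ?_).time (show L + L ≤ _ by omega)
      have h4 := h3.set (x := .cnt) (m := st.cnt + 1) (by intro; omega)
      refine Runs.assign hL h4 (by decide) (by decide) ⟨?_, h4.set (by simp [Var.small]), ⟨?_, ?_,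
        ?_, ?_, ?_⟩, ?_⟩
      · exact (((((Keep.refl _ _ _).set (by decide) _).setCell (by decide) _ _).setCell
          (by decide) _ _).set (by decide) _).set (by decide) _
      · funext i
        simp [hst.cov, Function.update_apply]
      · funext i
        simp [hst.pos, Function.update_apply]
      · simp
      · simp [E.eval, hst.guess, hT.quot _ hg]
      · simp [hst.fits]
      · simp only; omega
    · intro hlt
      have hlt' : ¬ st.cnt < j := by simpa [E.eval, hst.cnt, hj] using hlt
      rw [Branch.step, if_pos hc', if_neg hlt']
      refine (Runs.assign hL hσ (by decide) (by decide) ⟨(Keep.refl _ _ _).set (by decide) _,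
        hσ.set (by simp [E.eval]), ⟨hst.cov, hst.pos, ?_, ?_, ?_⟩, hg⟩).time (by omega)
      · simp [hst.cnt]
      · simp [hst.guess]
      · simp [E.eval]
  · intro hc
    have hc' := mt hcond.2 (not_not.2 hc)
    rw [Branch.step, if_neg hc']
    exact (Runs.skip ⟨Keep.refl _ _ _, hσ, hst, hg⟩).time (by omega)

theorem Branch.At.set {st : Branch} {σ : Store} (h : st.At σ) {x : Var} (m : ℕ)
    (hx : x ∉ [Var.cnt, .guess, .fits]) : st.At (σ.set x m) := by
  simp only [List.mem_cons, List.not_mem_nil, or_false, not_or] at hx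
  refine ⟨h.cov, h.pos, ?_, ?_, ?_⟩ <;> rw [Store.set_reg, if_neg (by tauto)]
  exacts [h.cnt, h.guess, h.fits]

theorem runs_branch {M L n j P w : ℕ} {A : ℕ → ℕ → Prop} {σ : Store}
    (hL : Clock M L) (hσ : Small M σ) (hM : n + 1 ≤ M) (hn : σ.reg .size = n)
    (hA : AdjCells A n σ) (hT : Tables P σ) (hw : w < P) (hword : σ.reg .word = w)
    (hj : σ.reg .round = j) (hjM : j ≤ n) (hcov : ∀ i, n ≤ i → σ.arr .cov i = 0) :
    Runs branch σ (L ^ 4) fun σ' => Keep branchRegs [.cov, .pos] σ σ' ∧ Small M σ' ∧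
      (Branch.result A n j (σ.arr .pos) w).At σ' := by
  have hbig := hL.big
  have hML := hL.le
  set B := 10 * L + 3 with hB
  have hT' : (L + n * (2 * L + 3)) + (L + (L + (L + (L + n * ((L + n * B) + 3))))) ≤ L ^ 4 := by
    have h1 : 64 * L ≤ L * L := Nat.mul_le_mul_right _ hbig
    have h2 : 64 * (L * L) ≤ L * (L * L) := Nat.mul_le_mul_right _ hbig
    have h4 : 64 * (L * (L * L)) ≤ L * (L * (L * L)) := Nat.mul_le_mul_right _ hbig
    have h3 : L ^ 4 = L * (L * (L * L)) := by ring
    have h5 : n * (2 * L + 3) ≤ L * (3 * L) := Nat.mul_le_mul (by omega) (by omega)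
    have h6 : n * B ≤ L * (11 * L) := Nat.mul_le_mul (by omega) (by omega)
    have h7 : n * ((L + n * B) + 3) ≤ L * (12 * (L * L)) := by
      refine Nat.mul_le_mul (by omega) ?_
      have : L * (11 * L) = 11 * (L * L) := by ring
      omega
    have h8 : L * (12 * (L * L)) = 12 * (L * (L * L)) := by ring
    have h9 : L * (3 * L) = 3 * (L * L) := by ring
    omega
  refine (Runs.seq (Q' := fun σ' => Keep branchRegs [.cov, .pos] σ σ' ∧ Small M σ' ∧
      σ'.arr .pos = σ.arr .pos ∧ σ'.arr .cov = fun _ => 0)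
    (Runs.loop hL hσ (by decide) (by decide) (m := n) (T := 2 * L) (fun k σ' =>
      Keep branchRegs [.cov, .pos] σ σ' ∧ Small M σ' ∧ σ'.arr .pos = σ.arr .pos ∧
        ∀ i, i < k ∨ n ≤ i → σ'.arr .cov i = 0) (by simpa [E.eval] using hn)
      ⟨Keep.refl _ _ _, hσ, rfl, fun i hi => hcov i (by omega)⟩ ?_ ?_) ?_).time hT'
  · rintro k hk σ1 ⟨i1, i2, i3, i4⟩
    have h1 := i2.set (x := .src) (m := k) (by intro; omega)
    refine Runs.store hL h1 (by decide) (by decide) (by decide) (by decide)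
      ⟨(i1.set (by decide) _).setCell (by decide) _ _, h1.setCell (by simp [Arr.small]), ?_, ?_⟩
    · funext i; simp [i3]
    · intro i hi
      by_cases h : i = k
      · simp [h, E.eval]
      · simp [h, E.eval, i4 i (by omega)]
  · rintro σ1 ⟨i1, i2, i3, i4⟩
    exact ⟨i1, i2, i3, funext fun i => i4 i (by omega)⟩
  rintro σ1 ⟨i1, i2, i3, i4⟩
  refine Runs.assign_seq hL i2 (by decide) (by decide) (m := 0) rfl ?_
  have h1 := i2.set (x := .cnt) (m := 0) (by simp)
  refine Runs.assign_seq hL h1 (by decide) (by decide) (m := 1) rfl ?_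
  have h2 := h1.set (x := .fits) (m := 1) (by intro; omega)
  refine Runs.assign_seq hL h2 (by decide) (by decide) (m := w)
    (by simp [E.eval, i1.reg .word (by decide), hword]) ?_
  have h3 := h2.set (x := .guess) (m := w) (by simp [Var.small])
  set σ2 := ((σ1.set .cnt 0).set .fits 1).set .guess w with hσ2
  have hk2 : Keep branchRegs [.cov, .pos] σ σ2 :=
    ((i1.set (by decide) _).set (by decide) _).set (by decide) _
  set st0 : Branch := ⟨fun _ => 0, σ.arr .pos, 0, w, 1⟩ with hst0
  have hAt0 : st0.At σ2 := ⟨by simp [hσ2, i4, hst0], by simp [hσ2, i3, hst0], by simp [hσ2, hst0],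
    by simp [hσ2, hst0], by simp [hσ2, hst0]⟩
  set row : Branch → ℕ → Branch := fun st u =>
    (List.range n).foldl (fun st v => st.step A j (u, v)) st with hrow
  refine Runs.loop hL h3 (by decide) (by decide) (m := n) (fun k σ' =>
    Keep branchRegs [.cov, .pos] σ σ' ∧ Small M σ' ∧
      ((List.range k).foldl row st0).At σ' ∧ ((List.range k).foldl row st0).guess < P)
    (by simp [E.eval, hk2.reg .size (by decide), hn]) ⟨hk2, h3, hAt0, hw⟩ ?_ ?_
  · rintro u hu σ3 ⟨j1, j2, j3, j4⟩
    set st1 := (List.range u).foldl row st0 with hst1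
    have h4 := j2.set (x := .src) (m := u) (by intro; omega)
    refine Runs.loop hL h4 (by decide) (by decide) (m := n) (T := 10 * L) (fun k σ' =>
      Keep branchRegs [.cov, .pos] σ σ' ∧ Small M σ' ∧ σ'.reg .src = u ∧
        ((List.range k).foldl (fun st v => st.step A j (u, v)) st1).At σ' ∧
        ((List.range k).foldl (fun st v => st.step A j (u, v)) st1).guess < P)
      (by simp [E.eval, j1.reg .size (by decide), hn])
      ⟨j1.set (by decide) _, h4, by simp, j3.set _ (by decide), j4⟩ ?_ ?_
    · rintro v hv σ4 ⟨k1, k2, k3, k4, k5⟩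
      have hk := k1.set (x := .dst) (by decide) v
      have hq : (σ4.set .dst v).arr .quot = σ.arr .quot := hk.arr _ (by decide)
      have hr : (σ4.set .dst v).arr .rem = σ.arr .rem := hk.arr _ (by decide)
      have hqd : (σ4.set .dst v).arr .quad = σ.arr .quad := hk.arr _ (by decide)
      refine (runs_branchStep hL (k2.set (x := .dst) (m := v) (by intro; omega)) hM
        (by rw [hk.reg .size (by decide), hn])
        (by simpa [AdjCells, hk.arr .adj (by decide)] using hA)
        (P := P) ⟨by rw [hqd]; exact hT.quad, by rw [hq]; exact hT.quot, by rw [hr]; exact hT.rem⟩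
        k5 (by rw [hk.reg .round (by decide), hj]) hjM (k4.set _ (by decide)) (u := u) (v := v)
        (by simp [k3]) (by simp) hu hv).mono le_rfl ?_
      rintro σ5 ⟨l1, l2, l3, l4⟩
      refine ⟨hk.trans l1 (by decide) (by decide), l2, ?_, ?_, ?_⟩
      · rw [l1.reg .src (by decide)]; simp [k3]
      · rw [List.range_succ, List.foldl_append]; exact l3
      · rw [List.range_succ, List.foldl_append]; exact l4
    · rintro σ4 ⟨k1, k2, k3, k4, k5⟩
      rw [List.range_succ, List.foldl_append]
      exact ⟨k1, k2, k4, k5⟩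
  · rintro σ3 ⟨j1, j2, j3, j4⟩
    refine ⟨j1, j2, ?_⟩
    have : Branch.result A n j (σ.arr .pos) w = (List.range n).foldl row st0 := by
      simp only [Branch.result, pairs, List.foldl_flatMap, List.foldl_map, hrow, hst0]
    rwa [this]

/-- Find a vertex cover of minimum size: for each number `round` of vertices, as long as none has
been found, try all words of `round` digits. -/
def findCover : Cmd :=
  .assign .pow (.lit 1) ;;
  .assign .found (.lit 0) ;;
  .loop .round (.add (.var .size) (.lit 1))
    (.ite (.eq (.var .found) (.lit 0))
      (tables ;;
        .loop .word (.var .pow)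
          (.ite (.eq (.var .found) (.lit 0))
            (branch ;;
              .ite (.var .fits)
                (.assign .found (.lit 1) ;; .assign .len (.var .round)) .skip)
            .skip) ;;
        .ite (.eq (.var .found) (.lit 0)) (.assign .pow (.var .next)) .skip)
      .skip)

/-- The registers that `findCover` changes. -/
abbrev coverRegs : List Var :=
  [.src, .dst, .cnt, .fits, .guess, .pick, .next, .idx, .dgt, .pow, .found, .round, .word, .len]

/-- The arrays that `findCover` changes. -/
abbrev coverArrs : List Arr := [.cov, .pos, .quad, .quot, .rem]

/-- The memory holds a vertex cover, numbered by numbers below `c`, and tables for the numbers with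
`c` digits. -/
structure HasCover (A : ℕ → ℕ → Prop) (n c : ℕ) (σ : Store) : Prop where
  len : σ.reg .len = c
  pow : σ.reg .pow = 4 ^ c
  tables : Tables (4 ^ c) σ
  cover : IsCover A n c (σ.arr .cov) (σ.arr .pos)

theorem HasCover.set {A : ℕ → ℕ → Prop} {n c : ℕ} {σ : Store} (h : HasCover A n c σ) {x : Var}
    (m : ℕ) (h1 : x ≠ .len) (h2 : x ≠ .pow) : HasCover A n c (σ.set x m) :=
  ⟨by rw [Store.set_reg, if_neg h1.symm, h.len], by rw [Store.set_reg, if_neg h2.symm, h.pow],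
    ⟨h.tables.quad, h.tables.quot, h.tables.rem⟩, h.cover⟩

theorem Tables.keep {m : ℕ} {σ σ' : Store} (h : Tables m σ) {xs : List Var} {as : List Arr}
    (hk : Keep xs as σ σ') (h1 : Arr.quad ∉ as) (h2 : Arr.quot ∉ as) (h3 : Arr.rem ∉ as) :
    Tables m σ' :=
  ⟨by rw [hk.arr _ h1]; exact h.quad, by rw [hk.arr _ h2]; exact h.quot,
    by rw [hk.arr _ h3]; exact h.rem⟩

theorem AdjCells.keep {A : ℕ → ℕ → Prop} {n : ℕ} {σ σ' : Store} (h : AdjCells A n σ)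
    {xs : List Var} {as : List Arr} (hk : Keep xs as σ σ') (h1 : Arr.adj ∉ as) :
    AdjCells A n σ' := by
  simpa [AdjCells, hk.arr _ h1] using h

theorem Branch.result_cov {A : ℕ → ℕ → Prop} {n j w i : ℕ} {pos : ℕ → ℕ} (hi : n ≤ i) :
    (Branch.result A n j pos w).cov i = 0 := by
  have H := (Branch.valid_init A n j pos w).foldl (l' := pairs n) fun e he => mem_pairs.1 he
  by_contra h
  exact absurd (H.lt i h) (by omega)

/-- One round of `findCover`, as long as nothing has been found. -/
theorem runs_round {M L n j τ : ℕ} {A : ℕ → ℕ → Prop} {σ : Store} (hL : Clock M L)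
    (hσ : Small M σ) (hM : n + 4 ≤ M) (hn : σ.reg .size = n) (hA : AdjCells A n σ)
    (hj : σ.reg .round = j) (hjn : j ≤ n) (hjτ : j ≤ τ) (hcov : ∀ i, n ≤ i → σ.arr .cov i = 0)
    (hpow : σ.reg .pow = 4 ^ j) (hfound : σ.reg .found = 0) :
    Runs (tables ;;
        .loop .word (.var .pow)
          (.ite (.eq (.var .found) (.lit 0))
            (branch ;;
              .ite (.var .fits)
                (.assign .found (.lit 1) ;; .assign .len (.var .round)) .skip)
            .skip) ;;
        .ite (.eq (.var .found) (.lit 0)) (.assign .pow (.var .next)) .skip) σ (L ^ 5 * 4 ^ τ)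
      fun σ' => Keep coverRegs coverArrs σ σ' ∧ Small M σ' ∧
        (∀ i, n ≤ i → σ'.arr .cov i = 0) ∧
        ((σ'.reg .found = 0 ∧ σ'.reg .pow = 4 ^ (j + 1) ∧
          ∀ w < 4 ^ j, ∃ pos, (Branch.result A n j pos w).fits ≠ 1) ∨
          (σ'.reg .found = 1 ∧ HasCover A n j σ')) := by
  have hbig := hL.big
  have hML := hL.le
  have hT : L ^ 3 * (4 ^ j + 1) + ((L + 4 ^ j * ((L + (L ^ 4 + (L + (L + L)))) + 3)) + (L + L))
      ≤ L ^ 5 * 4 ^ τ := by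
    have h1 : 64 * L ≤ L * L := Nat.mul_le_mul_right _ hbig
    have h2 : 64 * (L * L) ≤ L * (L * L) := Nat.mul_le_mul_right _ hbig
    have h3 : 64 * (L * (L * L)) ≤ L * (L * (L * L)) := Nat.mul_le_mul_right _ hbig
    have h4 : 64 * (L * (L * (L * L))) ≤ L * (L * (L * (L * L))) := Nat.mul_le_mul_right _ hbig
    have e3 : L ^ 3 = L * (L * L) := by ring
    have e4 : L ^ 4 = L * (L * (L * L)) := by ring
    have e5 : L ^ 5 = L * (L * (L * (L * L))) := by ring
    have hQ : 4 ^ j ≤ 4 ^ τ := Nat.pow_le_pow_right (by omega) hjτ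
    have hQ1 : 1 ≤ 4 ^ τ := Nat.one_le_pow _ _ (by omega)
    calc _ ≤ L ^ 3 * (4 ^ τ + 4 ^ τ) + ((L * 4 ^ τ + 4 ^ τ * ((L + (L ^ 4 + (L + (L + L)))) + 3))
          + (L + L) * 4 ^ τ) := by
            gcongr
            · exact Nat.le_mul_of_pos_right _ hQ1
            · exact Nat.le_mul_of_pos_right _ hQ1
      _ = (2 * L ^ 3 + L ^ 4 + 7 * L + 3) * 4 ^ τ := by ring
      _ ≤ _ := by
        refine Nat.mul_le_mul_right _ ?_
        omega
  refine (Runs.seq (runs_tables hL (by omega) hσ hpow) ?_).time hT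
  rintro σ1 ⟨i1, i2, i3, i4⟩
  have k1 : Keep coverRegs coverArrs σ σ1 := (Keep.refl _ _ _).trans i1 (by decide) (by decide)
  refine Runs.seq (Q' := fun σ' => Keep coverRegs coverArrs σ σ' ∧ Small M σ' ∧
    Tables (4 ^ j) σ' ∧ σ'.reg .next = 4 * 4 ^ j ∧ σ'.reg .pow = 4 ^ j ∧
    (∀ i, n ≤ i → σ'.arr .cov i = 0) ∧
    ((σ'.reg .found = 0 ∧ ∀ w < 4 ^ j, ∃ pos, (Branch.result A n j pos w).fits ≠ 1) ∨
      (σ'.reg .found = 1 ∧ HasCover A n j σ'))) ?_ ?_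
  · refine Runs.loop hL i2 (by decide) (by decide) (m := 4 ^ j) (fun k σ' =>
      Keep coverRegs coverArrs σ σ' ∧ Small M σ' ∧ Tables (4 ^ j) σ' ∧
      σ'.reg .next = 4 * 4 ^ j ∧ σ'.reg .pow = 4 ^ j ∧ σ'.reg .round = j ∧
      (∀ i, n ≤ i → σ'.arr .cov i = 0) ∧
      ((σ'.reg .found = 0 ∧ ∀ w < k, ∃ pos, (Branch.result A n j pos w).fits ≠ 1) ∨
        (σ'.reg .found = 1 ∧ HasCover A n j σ')))
      (by simp [E.eval, i1.reg .pow (by decide), hpow])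
      ⟨k1, i2, i3, i4, by rw [i1.reg .pow (by decide), hpow], by rw [i1.reg .round (by decide), hj],
        fun i hi => by rw [i1.arr .cov (by decide), hcov i hi],
        .inl ⟨by rw [i1.reg .found (by decide), hfound], by simp⟩⟩ ?_ ?_
    · rintro w hw σ2 ⟨j1, j2, j3, j4, j5, j6, j7, j8⟩
      have hs := j2.set (x := .word) (m := w) (by simp [Var.small])
      have hk := j1.set (x := .word) (by decide) w
      refine Runs.ite hL hs (by decide) (by decide) ?_ ?_
      · intro hf
        have hf' : σ2.reg .found = 0 := by simpa [E.eval] using hf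
        have hall : ∀ w' < w, ∃ pos, (Branch.result A n j pos w').fits ≠ 1 := by
          rcases j8 with h | h
          · exact h.2
          · omega
        refine Runs.seq (runs_branch (P := 4 ^ j) (w := w) hL hs (by omega)
          (by rw [hk.reg .size (by decide), hn]) (hA.keep hk (by decide))
          ⟨j3.quad, j3.quot, j3.rem⟩ hw (by simp) (by simpa using j6) hjn (by simpa using j7)) ?_
        rintro σ3 ⟨l1, l2, l3⟩
        have hk3 := hk.trans l1 (by decide) (by decide)
        have hcov3 : ∀ i, n ≤ i → σ3.arr .cov i = 0 := fun i hi => by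
          rw [l3.cov, Branch.result_cov hi]
        have ht3 : Tables (4 ^ j) σ3 :=
          Tables.keep (σ := σ2.set .word w) ⟨j3.quad, j3.quot, j3.rem⟩ l1 (by decide) (by decide)
            (by decide)
        have hn3 : σ3.reg .next = 4 * 4 ^ j := by rw [l1.reg .next (by decide)]; simpa using j4
        have hp3 : σ3.reg .pow = 4 ^ j := by rw [l1.reg .pow (by decide)]; simpa using j5
        have hr3 : σ3.reg .round = j := by rw [l1.reg .round (by decide)]; simpa using j6
        have hf3 : σ3.reg .found = 0 := by rw [l1.reg .found (by decide)]; simpa using hf'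
        refine Runs.ite hL l2 (by decide) (by decide) ?_ ?_
        · intro hfit
          refine Runs.assign_seq hL l2 (by decide) (by decide) (m := 1) rfl ?_
          have hs4 := l2.set (x := .found) (m := 1) (by intro; omega)
          refine Runs.assign hL hs4 (by decide) (by decide) ⟨(hk3.set (by decide) _).set
            (by decide) _, hs4.set (by intro; simp [E.eval, hr3]; omega), ⟨ht3.quad, ht3.quot,
            ht3.rem⟩, by simpa using hn3, by simpa using hp3, by simpa using hr3, hcov3,
            .inr ⟨by simp, by simp [E.eval, hr3], by simpa using hp3, ⟨ht3.quad, ht3.quot,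
            ht3.rem⟩, ?_⟩⟩
          have := Branch.isCover_result (A := A) (n := n) (j := j) (w := w)
            (pos := (σ2.set .word w).arr .pos) (by rw [← l3.fits]; simpa [E.eval] using hfit)
          rw [← l3.cov, ← l3.pos] at this
          exact this
        · intro hfit
          refine (Runs.skip ⟨hk3, l2, ht3, hn3, hp3, hr3, hcov3, .inl ⟨hf3, fun w' hw' => ?_⟩⟩).time
            (by omega)
          rcases Nat.lt_succ_iff_lt_or_eq.1 hw' with h | rfl
          · exact hall w' h
          · exact ⟨_, by rw [← l3.fits]; simp only [E.eval] at hfit; omega⟩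
      · intro hf
        have hf' : σ2.reg .found ≠ 0 := by simpa [E.eval] using hf
        refine (Runs.skip ⟨hk, hs, ⟨j3.quad, j3.quot, j3.rem⟩, by simpa using j4, by simpa using j5,
          by simpa using j6, j7, .inr ?_⟩).time (by omega)
        rcases j8 with h | h
        · exact absurd h.1 hf'
        · exact ⟨by simpa using h.1, h.2.set _ (by decide) (by decide)⟩
    · rintro σ2 ⟨j1, j2, j3, j4, j5, j6, j7, j8⟩
      exact ⟨j1, j2, j3, j4, j5, j7, j8⟩
  · rintro σ2 ⟨j1, j2, j3, j4, j5, j7, j8⟩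
    refine Runs.ite hL j2 (by decide) (by decide) ?_ ?_
    · intro hf
      have hf' : σ2.reg .found = 0 := by by_contra h; simp [E.eval, h] at hf
      refine Runs.assign hL j2 (by decide) (by decide) ⟨j1.set (by decide) _, j2.set
        (by simp [Var.small]), j7, .inl ⟨by simpa using hf',
          by simp [E.eval, j4, pow_succ, mul_comm],
        ?_⟩⟩
      rcases j8 with h | h
      · exact h.2
      · omega
    · intro hf
      have hf' : σ2.reg .found ≠ 0 := fun h => by simp [E.eval, h] at hf
      refine (Runs.skip ⟨j1, j2, j7, .inr ?_⟩).time (by omega)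
      rcases j8 with h | h
      · exact absurd h.1 hf'
      · exact h

theorem runs_findCover {M L n : ℕ} {A : ℕ → ℕ → Prop} {σ : Store} (hL : Clock M L)
    (hσ : Small M σ) (hM : n + 4 ≤ M) (hn : σ.reg .size = n) (hA : AdjCells A n σ)
    (hcov : ∀ i, n ≤ i → σ.arr .cov i = 0) (K : Finset ℕ)
    (hK : ∀ u v, u < n → v < n → A u v → u ∈ K ∨ v ∈ K) (hKn : K.card ≤ n) :
    Runs findCover σ (L ^ 7 * 4 ^ K.card) fun σ' => Keep coverRegs coverArrs σ σ' ∧ Small M σ' ∧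
      ∃ c ≤ K.card, HasCover A n c σ' := by
  have hbig := hL.big
  have hML := hL.le
  set τ := K.card
  have hQ1 : 1 ≤ 4 ^ τ := Nat.one_le_pow _ _ (by omega)
  have hT : L + (L + (L + (n + 1) * ((L + L ^ 5 * 4 ^ τ) + 3))) ≤ L ^ 7 * 4 ^ τ := by
    have h1 : 64 * L ≤ L * L := Nat.mul_le_mul_right _ hbig
    have h2 : 64 * L ^ 5 ≤ L * L ^ 5 := Nat.mul_le_mul_right _ hbig
    have h3 : L ≤ L ^ 5 := Nat.le_self_pow (by omega) _
    calc _ ≤ L * 4 ^ τ + (L * 4 ^ τ + (L * 4 ^ τ + L * ((L * 4 ^ τ + L ^ 5 * 4 ^ τ) + 3 * 4 ^ τ)))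
          := by
            gcongr
            any_goals exact Nat.le_mul_of_pos_right _ hQ1
            omega
      _ = (3 * L + L * (L + L ^ 5 + 3)) * 4 ^ τ := by ring
      _ ≤ _ := by
        refine Nat.mul_le_mul_right _ ?_
        calc 3 * L + L * (L + L ^ 5 + 3) = L * (L + L ^ 5 + 6) := by ring
          _ ≤ L * (L * L ^ 5) := Nat.mul_le_mul_left _ (by omega)
          _ = L ^ 7 := by ring
  refine (Runs.assign_seq hL hσ (by decide) (by decide) (m := 1) rfl ?_).time hT
  have h1 := hσ.set (x := .pow) (m := 1) (by simp [Var.small])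
  refine Runs.assign_seq hL h1 (by decide) (by decide) (m := 0) rfl ?_
  have h2 := h1.set (x := .found) (m := 0) (by simp)
  refine Runs.loop hL h2 (by decide) (by decide) (m := n + 1) (fun j σ' =>
    Keep coverRegs coverArrs σ σ' ∧ Small M σ' ∧ (∀ i, n ≤ i → σ'.arr .cov i = 0) ∧
    ((σ'.reg .found = 0 ∧ σ'.reg .pow = 4 ^ j ∧ j ≤ τ) ∨
      (σ'.reg .found = 1 ∧ ∃ c ≤ τ, HasCover A n c σ'))) (by simp [E.eval, hn])
    ⟨((Keep.refl _ _ _).set (by decide) _).set (by decide) _, h2, hcov, .inl ⟨by simp, by simp,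
      by omega⟩⟩ ?_ ?_
  · rintro j hj σ1 ⟨i1, i2, i3, i4⟩
    have h3 := i2.set (x := .round) (m := j) (by intro; omega)
    have hk := i1.set (x := .round) (by decide) j
    refine Runs.ite hL h3 (by decide) (by decide) ?_ ?_
    · intro hf
      have hf' : σ1.reg .found = 0 := by simpa [E.eval] using hf
      obtain ⟨-, h5, h6⟩ := i4.resolve_right (by omega)
      refine (runs_round (τ := τ) hL h3 hM (by rw [hk.reg .size (by decide), hn])
        (hA.keep hk (by decide)) (by simp) (by omega) h6 i3 (by simpa using h5)
        (by simpa using hf')).mono le_rfl ?_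
      rintro σ2 ⟨j1, j2, j3, j4⟩
      refine ⟨hk.trans j1 (by decide) (by decide), j2, j3, ?_⟩
      rcases j4 with ⟨j4, j5, j6⟩ | ⟨j4, j5⟩
      · refine .inl ⟨j4, j5, ?_⟩
        by_contra hlt
        obtain ⟨w, hw, H⟩ := Branch.exists_fits K hK (j := j) (by omega)
        obtain ⟨pos, hp⟩ := j6 w hw
        exact hp (H pos)
      · exact .inr ⟨j4, j, h6, j5⟩
    · intro hf
      have hf' : σ1.reg .found ≠ 0 := by simpa [E.eval] using hf
      obtain ⟨h5, c, h6, h7⟩ := i4.resolve_left (by tauto)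
      refine (Runs.skip ⟨hk, h3, i3, .inr ⟨by simpa using h5, c, h6, h7.set _ (by decide)
        (by decide)⟩⟩).time ?_
      have : 0 < L ^ 5 := Nat.pow_pos (by omega)
      exact Nat.mul_pos this hQ1
  · rintro σ1 ⟨i1, i2, i3, i4⟩
    rcases i4 with ⟨-, -, h⟩ | ⟨-, h⟩
    · omega
    · exact ⟨i1, i2, h⟩

/-! ### Words in base four -/

/-- the number with the base-four digits `d 0, …, d (c - 1)` -/
def code (c : ℕ) (d : ℕ → ℕ) : ℕ := ∑ i ∈ Finset.range c, d i * 4 ^ i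

theorem code_succ (c : ℕ) (d : ℕ → ℕ) : code (c + 1) d = d 0 + 4 * code c fun i => d (i + 1) := by
  rw [code, Finset.sum_range_succ', code, Finset.mul_sum, add_comm]
  congr 1
  · simp
  · exact Finset.sum_congr rfl fun i _ => by ring

theorem code_lt (c : ℕ) {d : ℕ → ℕ} (hd : ∀ i, d i < 4) : code c d < 4 ^ c := by
  induction c generalizing d with
  | zero => simp [code]
  | succ c ih =>
    have := ih fun i => hd (i + 1)
    have := hd 0
    rw [code_succ, pow_succ]; omega

theorem code_digit {c p : ℕ} {d : ℕ → ℕ} (hd : ∀ i, d i < 4) (hp : p < c) :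
    code c d / 4 ^ p % 4 = d p := by
  induction p generalizing c d with
  | zero =>
    obtain ⟨c, rfl⟩ : ∃ c', c = c' + 1 := ⟨c - 1, by omega⟩
    have := hd 0
    rw [code_succ]; simp; omega
  | succ p ih =>
    obtain ⟨c, rfl⟩ : ∃ c', c = c' + 1 := ⟨c - 1, by omega⟩
    have := hd 0
    rw [code_succ, pow_succ, mul_comm (4 ^ p), ← Nat.div_div_eq_div_mul,
      show (d 0 + 4 * code c fun i => d (i + 1)) / 4 = code c fun i => d (i + 1) by omega]
    exact ih (fun i => hd (i + 1)) (by omega)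

theorem code_le_code {c : ℕ} {d d' : ℕ → ℕ} (h : ∀ i < c, d i ≤ d' i) : code c d ≤ code c d' :=
  Finset.sum_le_sum fun i hi => Nat.mul_le_mul_right _ (h i (Finset.mem_range.1 hi))

theorem code_congr {c : ℕ} {d d' : ℕ → ℕ} (h : ∀ i < c, d i = d' i) : code c d = code c d' :=
  Finset.sum_congr rfl fun i hi => by rw [h i (Finset.mem_range.1 hi)]

/-- Apply `h` to each of the first `c` digits of `w`. -/
def recode (c : ℕ) (h : ℕ → ℕ) (w : ℕ) : ℕ := code c fun i => h (w / 4 ^ i % 4)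

/-! ### The dynamic program -/

/-- A graph on the numbers below `n`, with a numbered vertex cover. -/
structure Inst where
  A : ℕ → ℕ → Prop
  n : ℕ
  c : ℕ
  cov : ℕ → ℕ
  pos : ℕ → ℕ
  symm : ∀ u v, A u v → A v u
  cover : IsCover A n c cov pos

/-- The effect on digits of forgetting the current block. -/
def srcDigit (d : ℕ) : ℕ := if d = 2 then 2 else if d = 3 then 3 else 0

/-- The effect on digits of adding the current block to the finished ones. -/
def tgtDigit (d : ℕ) : ℕ := if d = 0 then 0 else if d = 3 then 3 else 2

/-- `n + l ≤ k + |K|` for some set `K` of vertices that falls into blocks, the fibres of `col`, with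
at most `l` vertices each and without edges between them. -/
def Splits (A : ℕ → ℕ → Prop) (n l k : ℕ) : Prop :=
  ∃ K ⊆ Finset.range n, ∃ col : ℕ → ℕ, (∀ u ∈ K, ∀ v ∈ K, A u v → col u = col v) ∧
    (∀ x, (K.filter (col · = x)).card ≤ l) ∧ n + l ≤ k + K.card

namespace Inst

variable (I : Inst) (l : ℕ)

/-- The label of the vertex `u` in the word `w`. A vertex of the cover has label `1` if it belongs
to the current block, `2` if it belongs to a finished block, `3` if it is deleted, and `0` if it
belongs to a later block. All other vertices have label `4`. -/
def lab (w u : ℕ) : ℕ := if I.cov u ≠ 0 then w / 4 ^ I.pos u % 4 else 4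

/-- The word in which only the finished blocks of `w` remain, and the current block is among the
later ones. The vertices kept so far are recorded at this word. -/
def src (w : ℕ) : ℕ := recode I.c srcDigit w

/-- The word in which the current block of `w` has been added to the finished ones. -/
def tgt (w : ℕ) : ℕ := recode I.c tgtDigit w

open scoped Classical in
/-- the vertices with label `d` -/
noncomputable def cls (w d : ℕ) : Finset ℕ := (Finset.range I.n).filter (I.lab w · = d)

open scoped Classical in
/-- The vertices outside the cover that can be kept only in the current block: they have a neighbour
in it, and all other neighbours are deleted. -/
noncomputable def inner (w : ℕ) : Finset ℕ := (Finset.range I.n).filter fun v =>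
  I.lab w v = 4 ∧ (∀ u < I.n, I.A v u → I.lab w u = 1 ∨ I.lab w u = 3) ∧
    ∃ u < I.n, I.A v u ∧ I.lab w u = 1

open scoped Classical in
/-- The vertices outside the cover all of whose neighbours are deleted. -/
noncomputable def iso (w : ℕ) : Finset ℕ := (Finset.range I.n).filter fun v =>
  I.lab w v = 4 ∧ ∀ u < I.n, I.A v u → I.lab w u = 3

/-- The current block has no edges to finished blocks, and is not too large. -/
def Adm (w : ℕ) : Prop :=
  (∀ u < I.n, ∀ v < I.n, I.A u v → I.lab w u = 1 → I.lab w v ≠ 2) ∧ (I.cls w 1).card ≤ l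

/-- The number of vertices that are kept in the current block. Vertices of `inner` are deleted as
long as the block is larger than `l`; which ones does not matter to any other block. -/
noncomputable def gain (w : ℕ) : ℕ := min ((I.cls w 1).card + (I.inner w).card) l

open scoped Classical in
/-- One more than the number of vertices kept in finished blocks, as recorded in the table `f`; `0`
if there is no record. -/
noncomputable def old (f : ℕ → ℕ) (w : ℕ) : ℕ := if I.cls w 2 = ∅ then 1 else f (I.src w)

open scoped Classical in
/-- The table after all words below a given one have been processed. One pass in increasing order is
enough, since a vertex only ever passes from a smaller label to a larger one. -/
noncomputable def tab : ℕ → ℕ → ℕ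
  | 0 => fun _ => 0
  | w + 1 =>
    if I.Adm l w ∧ I.old (tab w) w ≠ 0 ∧ tab w (I.tgt w) < I.old (tab w) w + I.gain l w then
      Function.update (tab w) (I.tgt w) (I.old (tab w) w + I.gain l w)
    else tab w

/-- The word `w` completes a partition into blocks that witnesses `Splits`. -/
def Success (k w : ℕ) : Prop :=
  I.Adm l w ∧ I.old (I.tab l w) w ≠ 0 ∧ I.cls w 0 = ∅ ∧
    I.n + l + 1 ≤ I.old (I.tab l w) w + I.gain l w + (I.iso w).card + k

variable {I l}

theorem mem_cls {w d u : ℕ} : u ∈ I.cls w d ↔ u < I.n ∧ I.lab w u = d := by simp [cls]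

theorem lab_of_cov {w u : ℕ} (h : I.cov u ≠ 0) : I.lab w u = w / 4 ^ I.pos u % 4 := if_pos h

theorem lab_eq_four {w u : ℕ} : I.lab w u = 4 ↔ I.cov u = 0 := by
  unfold lab
  split_ifs with h
  · have : w / 4 ^ I.pos u % 4 < 4 := Nat.mod_lt _ (by omega)
    simp only [h, iff_false]; omega
  · simpa using h

theorem srcDigit_lt (d : ℕ) : srcDigit d < 4 := by unfold srcDigit; split_ifs <;> omega

theorem srcDigit_eq_two {d : ℕ} : srcDigit d = 2 ↔ d = 2 := by
  unfold srcDigit; split_ifs <;> simp_all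

theorem srcDigit_eq_three {d : ℕ} : srcDigit d = 3 ↔ d = 3 := by
  unfold srcDigit; split_ifs <;> simp_all

theorem tgtDigit_lt (d : ℕ) : tgtDigit d < 4 := by unfold tgtDigit; split_ifs <;> omega

theorem src_lt (w : ℕ) : I.src w < 4 ^ I.c := code_lt _ fun _ => srcDigit_lt _

theorem tgt_lt (w : ℕ) : I.tgt w < 4 ^ I.c := code_lt _ fun _ => tgtDigit_lt _

theorem lab_src {w u : ℕ} (h : I.cov u ≠ 0) : I.lab (I.src w) u = srcDigit (I.lab w u) := by
  rw [lab_of_cov h, lab_of_cov h]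
  exact code_digit (fun _ => srcDigit_lt _) (I.cover.pos_lt u h)

theorem lab_tgt {w u : ℕ} (h : I.cov u ≠ 0) : I.lab (I.tgt w) u = tgtDigit (I.lab w u) := by
  rw [lab_of_cov h, lab_of_cov h]
  exact code_digit (fun _ => tgtDigit_lt _) (I.cover.pos_lt u h)

/-! ### Soundness of the dynamic program -/

variable (I l)

/-- There is a set of at least `m` vertices that falls into blocks of at most `l` vertices, consists
of the vertices with label `2` and of vertices outside the cover, and all of the latter have a
neighbour with label `2` and only neighbours with label `2` or `3`. -/
def Kept (w m : ℕ) : Prop :=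
  ∃ K ⊆ Finset.range I.n, ∃ col : ℕ → ℕ, m ≤ K.card ∧
    (∀ u ∈ K, ∀ v ∈ K, I.A u v → col u = col v) ∧ (∀ x, (K.filter (col · = x)).card ≤ l) ∧
    (∀ u < I.n, I.cov u ≠ 0 → (u ∈ K ↔ I.lab w u = 2)) ∧
    ∀ v ∈ K, I.cov v = 0 → (∀ u < I.n, I.A v u → I.lab w u = 2 ∨ I.lab w u = 3) ∧
      ∃ u < I.n, I.A v u ∧ I.lab w u = 2

variable {I l}

theorem kept_zero {w : ℕ} (h : ∀ u < I.n, I.cov u ≠ 0 → I.lab w u ≠ 2) : I.Kept l w 0 :=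
  ⟨∅, by simp, fun _ => 0, by simp, by simp, by simp, fun u hu hc => by simp [h u hu hc], by simp⟩

/-- Adding the current block. -/
theorem Kept.step {w m : ℕ} (h : I.Kept l (I.src w) m) (hw : I.Adm l w) :
    I.Kept l (I.tgt w) (m + I.gain l w) := by
  classical
  obtain ⟨K, hKn, col, hm, hcol, hsz, hcov, hout⟩ := h
  -- the vertices of `inner` that still have room in the current block
  obtain ⟨J, hJ, hJc⟩ : ∃ J ⊆ I.inner w, (I.cls w 1).card + J.card = I.gain l w := by
    obtain ⟨J, h1, h2⟩ := Finset.exists_subset_card_eq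
      (s := I.inner w) (n := I.gain l w - (I.cls w 1).card) (by unfold gain; omega)
    refine ⟨J, h1, ?_⟩
    have := hw.2
    rw [h2]; unfold gain; omega
  have hJm : ∀ v ∈ J, v < I.n ∧ I.cov v = 0 ∧
      (∀ u < I.n, I.A v u → I.lab w u = 1 ∨ I.lab w u = 3) ∧
        ∃ u < I.n, I.A v u ∧ I.lab w u = 1 := by
    intro v hv
    have := hJ hv
    simp only [inner, Finset.mem_filter, Finset.mem_range, lab_eq_four] at this
    exact this
  have hZm : ∀ u ∈ I.cls w 1, u < I.n ∧ I.cov u ≠ 0 ∧ I.lab w u = 1 := by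
    intro u hu
    rw [mem_cls] at hu
    exact ⟨hu.1, fun h => by rw [lab_eq_four.2 h] at hu; omega, hu.2⟩
  -- the vertices of the cover in `K` have label `2` in `w` as well
  have hK2 : ∀ u ∈ K, I.cov u ≠ 0 → I.lab w u = 2 := by
    intro u hu hc
    have := (hcov u (Finset.mem_range.1 (hKn hu)) hc).1 hu
    rwa [lab_src hc, srcDigit_eq_two] at this
  have hKout : ∀ v ∈ K, I.cov v = 0 → (∀ u < I.n, I.A v u → I.lab w u = 2 ∨ I.lab w u = 3) ∧
      ∃ u < I.n, I.A v u ∧ I.lab w u = 2 := by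
    intro v hv hc
    have hnb : ∀ u < I.n, I.A v u → I.cov u ≠ 0 := fun u hu hA =>
      (I.cover.cover v u (Finset.mem_range.1 (hKn hv)) hu hA).resolve_left (by simpa using hc)
    obtain ⟨h1, u, hu, hA, h2⟩ := hout v hv hc
    refine ⟨fun u hu hA => ?_, u, hu, hA, ?_⟩
    · have := h1 u hu hA
      rwa [lab_src (hnb u hu hA), srcDigit_eq_two, srcDigit_eq_three] at this
    · rwa [lab_src (hnb u hu hA), srcDigit_eq_two] at h2
  have hdisj1 : Disjoint (I.cls w 1) J := by
    rw [Finset.disjoint_left]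
    intro u hu hu'
    exact (hZm u hu).2.1 (hJm u hu').2.1
  have hdisj2 : Disjoint K (I.cls w 1 ∪ J) := by
    rw [Finset.disjoint_left]
    intro u hu hu'
    rcases Finset.mem_union.1 hu' with h | h
    · have := hK2 u hu (hZm u h).2.1
      have := (hZm u h).2.2
      omega
    · obtain ⟨-, t, ht, hA, h2⟩ := hKout u hu (hJm u h).2.1
      have := (hJm u h).2.2.1 t ht hA
      omega
  -- no edges between the finished blocks and the current one
  have hnoedge : ∀ u ∈ K, ∀ v ∈ I.cls w 1 ∪ J, ¬ I.A u v := by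
    intro u hu v hv hA
    have hun := Finset.mem_range.1 (hKn hu)
    rcases Finset.mem_union.1 hv with h | h
    · by_cases hc : I.cov u = 0
      · have := (hKout u hu hc).1 v (hZm v h).1 hA
        have := (hZm v h).2.2
        omega
      · exact hw.1 v (hZm v h).1 u hun (I.symm _ _ hA) (hZm v h).2.2 (hK2 u hu hc)
    · have h3 := (hJm v h).2.2.1 u hun (I.symm _ _ hA)
      by_cases hc : I.cov u = 0
      · rw [lab_eq_four.2 hc] at h3; omega
      · rw [hK2 u hu hc] at h3; omega
  -- colour `0` is free for the current block after a shift of the colours of the finished ones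
  refine ⟨K ∪ (I.cls w 1 ∪ J), ?_, fun u => if u ∈ K then col u + 1 else 0, ?_, ?_, ?_, ?_, ?_⟩
  · intro u hu
    rcases Finset.mem_union.1 hu with h | h
    · exact hKn h
    · rcases Finset.mem_union.1 h with h | h
      · exact Finset.mem_range.2 (hZm u h).1
      · exact Finset.mem_range.2 (hJm u h).1
  · rw [Finset.card_union_of_disjoint hdisj2, Finset.card_union_of_disjoint hdisj1]; omega
  · intro u hu v hv hA
    by_cases h1 : u ∈ K <;> by_cases h2 : v ∈ K
    · simp [h1, h2, hcol u h1 v h2 hA]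
    · exact absurd hA (hnoedge u h1 v ((Finset.mem_union.1 hv).resolve_left h2))
    · exact absurd (I.symm _ _ hA) (hnoedge v h2 u ((Finset.mem_union.1 hu).resolve_left h1))
    · simp [h1, h2]
  · intro x
    rcases Nat.eq_zero_or_pos x with rfl | hx
    · calc _ ≤ (I.cls w 1 ∪ J).card := by
            refine Finset.card_le_card fun u hu => ?_
            simp only [Finset.mem_filter] at hu
            refine (Finset.mem_union.1 hu.1).resolve_left fun h => ?_
            simp [h] at hu
        _ ≤ l := by
          rw [Finset.card_union_of_disjoint hdisj1, hJc]; unfold gain; omega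
    · refine le_trans (Finset.card_le_card fun u hu => ?_) (hsz (x - 1))
      simp only [Finset.mem_filter] at hu ⊢
      by_cases h : u ∈ K
      · simp only [h, if_true] at hu
        exact ⟨h, by omega⟩
      · simp only [h, if_false] at hu
        omega
  · intro u hu hc
    rw [lab_tgt hc, Finset.mem_union, Finset.mem_union, hcov u hu hc, lab_src hc, mem_cls]
    have h5 : u ∉ J := fun h => hc (hJm u h).2.1
    unfold srcDigit tgtDigit
    have : I.lab w u < 4 := by rw [lab_of_cov hc]; exact Nat.mod_lt _ (by omega)
    interval_cases I.lab w u <;> simp [h5, hu]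
  · intro v hv hc
    have hvn : v < I.n := by
      rcases Finset.mem_union.1 hv with h | h
      · exact Finset.mem_range.1 (hKn h)
      · rcases Finset.mem_union.1 h with h | h
        · exact (hZm v h).1
        · exact (hJm v h).1
    have hnb : ∀ u < I.n, I.A v u → I.cov u ≠ 0 := fun u hu hA =>
      (I.cover.cover v u hvn hu hA).resolve_left (by simpa using hc)
    rcases Finset.mem_union.1 hv with h | h
    · obtain ⟨h1, u, hu, hA, h2⟩ := hKout v h hc
      refine ⟨fun u hu hA => ?_, u, hu, hA, by rw [lab_tgt (hnb u hu hA), h2]; rfl⟩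
      rw [lab_tgt (hnb u hu hA)]
      rcases h1 u hu hA with h | h <;> simp [h, tgtDigit]
    · rcases Finset.mem_union.1 h with h | h
      · exact absurd hc (hZm v h).2.1
      · obtain ⟨-, -, h1, u, hu, hA, h2⟩ := hJm v h
        refine ⟨fun u hu hA => ?_, u, hu, hA, by rw [lab_tgt (hnb u hu hA), h2]; rfl⟩
        rw [lab_tgt (hnb u hu hA)]
        rcases h1 u hu hA with h | h <;> simp [h, tgtDigit]

theorem kept_old {f : ℕ → ℕ} (hf : ∀ T, f T ≠ 0 → I.Kept l T (f T - 1)) {w : ℕ}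
    (h : I.old f w ≠ 0) : I.Kept l (I.src w) (I.old f w - 1) := by
  unfold old at h ⊢
  split_ifs at h ⊢ with h0
  · refine kept_zero fun u hu hc h2 => ?_
    rw [lab_src hc, srcDigit_eq_two] at h2
    have := mem_cls.2 ⟨hu, h2⟩
    simp [h0] at this
  · exact hf _ h

/-- Every entry of the table is justified by an actual set of vertices. -/
theorem kept_tab (w T : ℕ) (h : I.tab l w T ≠ 0) : I.Kept l T (I.tab l w T - 1) := by
  induction w generalizing T with
  | zero => simp [tab] at h
  | succ w ih =>
    rw [tab] at h ⊢
    split_ifs at h ⊢ with h1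
    · by_cases hT : T = I.tgt w
      · rw [hT, Function.update_self]
        have := (kept_old ih h1.2.1).step h1.1
        rwa [← Nat.sub_add_comm (by omega)] at this
      · rw [Function.update_of_ne hT] at h ⊢
        exact ih T h
    · exact ih T h

/-- Soundness: a successful word comes from a set of vertices that can be kept. -/
theorem Success.splits {k w : ℕ} (hl : 1 ≤ l) (h : I.Success l k w) : Splits I.A I.n l k := by
  classical
  obtain ⟨h1, h2, h3, h4⟩ := h
  obtain ⟨K, hKn, col, hm, hcol, hsz, hcov, hout⟩ := (kept_old (kept_tab w) h2).step h1
  have hno : ∀ u < I.n, I.cov u ≠ 0 → I.lab w u = 3 → u ∉ K := by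
    intro u hu hc h3 hK
    have := (hcov u hu hc).1 hK
    rw [lab_tgt hc, h3] at this
    simp [tgtDigit] at this
  have hiso : ∀ v ∈ I.iso w, v < I.n ∧ I.cov v = 0 ∧ ∀ u < I.n, I.A v u → I.lab w u = 3 := by
    intro v hv
    simpa [iso, lab_eq_four] using hv
  have hnb : ∀ v ∈ I.iso w, ∀ u < I.n, I.A v u → u ∉ K ∧ u ∉ I.iso w := by
    intro v hv u hu hA
    have h5 := (hiso v hv).2.2 u hu hA
    have hc : I.cov u ≠ 0 := fun h => by rw [lab_eq_four.2 h] at h5; omega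
    exact ⟨hno u hu hc h5, fun h => hc (hiso u h).2.1⟩
  have hdisj : Disjoint K (I.iso w) := by
    rw [Finset.disjoint_left]
    intro v hv hv'
    obtain ⟨hvn, hc, h5⟩ := hiso v hv'
    obtain ⟨-, u, hu, hA, h6⟩ := hout v hv hc
    have h7 := h5 u hu hA
    have hcu : I.cov u ≠ 0 := fun h => by rw [lab_eq_four.2 h] at h7; omega
    exact hno u hu hcu h7 ((hcov u hu hcu).2 h6)
  have hr : ∀ v ∈ K ∪ I.iso w, v < I.n := fun v hv => by
    rcases Finset.mem_union.1 hv with h | h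
    · exact Finset.mem_range.1 (hKn h)
    · exact (hiso v h).1
  -- each vertex that has lost all its neighbours is a block of its own; these blocks get the odd
  -- colours
  refine ⟨K ∪ I.iso w, fun v hv => Finset.mem_range.2 (hr v hv),
    fun v => if v ∈ K then 2 * col v else 2 * v + 1, ?_, ?_, ?_⟩
  · intro u hu v hv hA
    by_cases h5 : u ∈ K <;> by_cases h6 : v ∈ K
    · simp [h5, h6, hcol u h5 v h6 hA]
    · have := hnb v ((Finset.mem_union.1 hv).resolve_left h6) u (hr u hu) (I.symm _ _ hA)
      exact absurd h5 this.1
    · have := hnb u ((Finset.mem_union.1 hu).resolve_left h5) v (hr v hv) hA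
      exact absurd h6 this.1
    · have := hnb u ((Finset.mem_union.1 hu).resolve_left h5) v (hr v hv) hA
      exact absurd ((Finset.mem_union.1 hv).resolve_left h6) this.2
  · intro x
    rcases Nat.even_or_odd' x with ⟨y, rfl | rfl⟩
    · refine le_trans (Finset.card_le_card fun u hu => ?_) (hsz y)
      simp only [Finset.mem_filter] at hu ⊢
      by_cases h : u ∈ K
      · simp only [h, if_true] at hu
        exact ⟨h, by omega⟩
      · simp only [h, if_false] at hu
        omega
    · refine le_trans (Finset.card_le_card (t := {y}) fun u hu => ?_) (by simpa using hl)
      simp only [Finset.mem_filter, Finset.mem_singleton] at hu ⊢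
      by_cases h : u ∈ K
      · simp only [h, if_true] at hu
        omega
      · simp only [h, if_false] at hu
        omega
  · rw [Finset.card_union_of_disjoint hdisj]; omega

/-! ### Completeness of the dynamic program -/

/-- The entries never decrease, so that what is recorded once remains available. -/
theorem tab_mono {w w' : ℕ} (h : w ≤ w') (T : ℕ) : I.tab l w T ≤ I.tab l w' T := by
  induction w', h using Nat.le_induction with
  | base => exact le_rfl
  | succ w' _ ih =>
    refine ih.trans ?_
    rw [tab]
    split_ifs with h1
    · by_cases hT : T = I.tgt w'
      · rw [hT, Function.update_self]; omega
      · rw [Function.update_of_ne hT]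
    · exact le_rfl

theorem le_tab_succ {w : ℕ} (h : I.Adm l w) (h' : I.old (I.tab l w) w ≠ 0) :
    I.old (I.tab l w) w + I.gain l w ≤ I.tab l (w + 1) (I.tgt w) := by
  rw [tab]
  split_ifs with h1
  · rw [Function.update_self]
  · by_contra h2
    exact h1 ⟨h, h', by omega⟩

variable (I)

open scoped Classical in
/-- The word in which the vertices `u` of the cover have the labels `φ u`, and unused digits are
`0`. -/
noncomputable def word (φ : ℕ → ℕ) : ℕ :=
  code I.c fun p => if h : ∃ u, I.cov u ≠ 0 ∧ I.pos u = p then φ h.choose else 0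

variable {I}

theorem word_digit_lt {φ : ℕ → ℕ} (hφ : ∀ u, φ u < 4) (p : ℕ)
    [Decidable (∃ u, I.cov u ≠ 0 ∧ I.pos u = p)] :
    (if h : ∃ u, I.cov u ≠ 0 ∧ I.pos u = p then φ h.choose else 0) < 4 := by
  split_ifs
  · exact hφ _
  · omega

theorem lab_word {φ : ℕ → ℕ} (hφ : ∀ u, φ u < 4) {u : ℕ} (hu : I.cov u ≠ 0) :
    I.lab (I.word φ) u = φ u := by
  classical
  rw [lab_of_cov hu, word, code_digit (fun p => word_digit_lt hφ p) (I.cover.pos_lt u hu)]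
  have h : ∃ u', I.cov u' ≠ 0 ∧ I.pos u' = I.pos u := ⟨u, hu, rfl⟩
  rw [dif_pos h]
  exact congrArg φ (I.cover.inj _ _ h.choose_spec.1 hu h.choose_spec.2)

theorem word_lt {φ : ℕ → ℕ} (hφ : ∀ u, φ u < 4) : I.word φ < 4 ^ I.c :=
  by classical exact code_lt _ fun p => word_digit_lt hφ p

theorem recode_word {φ h : ℕ → ℕ} (hφ : ∀ u, φ u < 4) (h0 : h 0 = 0) :
    recode I.c h (I.word φ) = I.word fun u => h (φ u) := by
  classical
  refine code_congr fun p hp => ?_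
  rw [word, code_digit (fun p => word_digit_lt hφ p) hp]
  split_ifs <;> simp [h0]

theorem word_congr {φ ψ : ℕ → ℕ} (h : ∀ u, I.cov u ≠ 0 → φ u = ψ u) : I.word φ = I.word ψ := by
  refine code_congr fun p _ => ?_
  split_ifs with hp
  · exact h _ hp.choose_spec.1
  · rfl

theorem word_le_word {φ ψ : ℕ → ℕ} (h : ∀ u, I.cov u ≠ 0 → φ u ≤ ψ u) :
    I.word φ ≤ I.word ψ := by
  refine code_le_code fun p _ => ?_
  split_ifs with hp
  · exact h _ hp.choose_spec.1
  · rfl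

/-- The labels for the current block `Z` and the finished blocks `Y`, if `K` is kept. -/
def labels (K Z Y : Finset ℕ) (u : ℕ) : ℕ :=
  if u ∈ Z then 1 else if u ∈ Y then 2 else if u ∈ K then 0 else 3

theorem labels_lt (K Z Y : Finset ℕ) (u : ℕ) : labels K Z Y u < 4 := by
  unfold labels; split_ifs <;> omega

theorem src_word {K Z Y : Finset ℕ} (hZ : Z ⊆ K) (hZY : Disjoint Z Y) :
    I.src (I.word (labels K Z Y)) = I.word (labels K ∅ Y) := by
  rw [src, recode_word (labels_lt K Z Y) rfl]
  refine word_congr fun u _ => ?_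
  unfold labels srcDigit
  by_cases h1 : u ∈ Z
  · simp [h1, hZ h1, Finset.disjoint_left.1 hZY h1]
  · by_cases h2 : u ∈ Y
    · simp [h1, h2]
    · by_cases h3 : u ∈ K <;> simp [h1, h2, h3]

theorem tgt_word {K Z Y : Finset ℕ} (hZ : Z ⊆ Y) :
    I.tgt (I.word (labels K Z (Y \ Z))) = I.word (labels K ∅ Y) := by
  rw [tgt, recode_word (labels_lt K Z _) rfl]
  refine word_congr fun u _ => ?_
  unfold labels tgtDigit
  by_cases h1 : u ∈ Z
  · simp [h1, hZ h1]
  · by_cases h2 : u ∈ Y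
    · simp [h1, h2]
    · by_cases h3 : u ∈ K <;> simp [h1, h2, h3]

variable (I) in
open scoped Classical in
/-- The vertices of `K` that lie in `Y`, or outside the cover with a neighbour in `Y`. -/
noncomputable def around (K Y : Finset ℕ) : Finset ℕ :=
  K.filter fun v => v ∈ Y ∨ I.cov v = 0 ∧ ∃ u ∈ Y, I.A v u

/-- Completeness for a union of blocks: if `Y` consists of all the vertices of the cover in some
blocks of `K`, then some word whose current and finished blocks make up `Y` is processed
successfully, and the number it finds is at least the number of vertices of `K` around `Y`. -/
theorem exists_word {K : Finset ℕ} {col : ℕ → ℕ} (hKn : K ⊆ Finset.range I.n)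
    (hcol : ∀ u ∈ K, ∀ v ∈ K, I.A u v → col u = col v)
    (hsz : ∀ x, (K.filter (col · = x)).card ≤ l) (Y : Finset ℕ) (hYK : Y ⊆ K)
    (hYc : ∀ u ∈ Y, I.cov u ≠ 0) (hY : ∀ u ∈ Y, ∀ v ∈ K, I.cov v ≠ 0 → col u = col v → v ∈ Y) :
    ∃ Z ⊆ Y, ∃ w, w = I.word (labels K Z (Y \ Z)) ∧ I.Adm l w ∧ I.old (I.tab l w) w ≠ 0 ∧
      (I.around K Y).card + 1 ≤ I.old (I.tab l w) w + I.gain l w := by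
  classical
  induction hc : Y.card using Nat.strong_induction_on generalizing Y with
  | _ m ih =>
  have hlabel : ∀ {Z Y' : Finset ℕ} {u : ℕ}, I.cov u ≠ 0 →
      I.lab (I.word (labels K Z Y')) u = labels K Z Y' u := fun h => lab_word (labels_lt K _ _) h
  rcases Y.eq_empty_or_nonempty with rfl | ⟨y, hy⟩
  · obtain ⟨w, hw⟩ : ∃ w, w = I.word (labels K ∅ (∅ \ ∅)) := ⟨_, rfl⟩
    have hno : ∀ d, d = 1 ∨ d = 2 → I.cls w d = ∅ := fun d hd => by
      refine Finset.eq_empty_of_forall_notMem fun u hu => ?_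
      obtain ⟨_, hu⟩ := mem_cls.1 hu
      have hcu : I.cov u ≠ 0 := fun h => by rw [lab_eq_four.2 h] at hu; omega
      rw [hw, hlabel hcu, labels] at hu
      by_cases h : u ∈ K <;> simp [h] at hu <;> omega
    have h1 := hno 1 (by simp)
    have h2 := hno 2 (by simp)
    refine ⟨∅, le_rfl, w, hw, ⟨fun u hu v hv _ hu1 => ?_, by simp [h1]⟩, by simp [old, h2], ?_⟩
    · have := mem_cls.2 ⟨hu, hu1⟩
      simp [h1] at this
    · have : I.around K ∅ = ∅ := by simp [around]
      simp [this, old, h2]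
  · -- the current block is the one of `y`
    set Z := Y.filter (col · = col y) with hZ
    have hZY : Z ⊆ Y := Finset.filter_subset _ _
    have hyZ : y ∈ Z := by simp [hZ, hy]
    have hdisj : Disjoint Z (Y \ Z) := Finset.disjoint_sdiff
    have hclosed : ∀ u ∈ Y \ Z, ∀ v ∈ K, I.cov v ≠ 0 → col u = col v → v ∈ Y \ Z := by
      intro u hu v hv hcv huv
      rw [Finset.mem_sdiff] at hu ⊢
      refine ⟨hY u hu.1 v hv hcv huv, fun h => hu.2 ?_⟩
      simp only [hZ, Finset.mem_filter] at h ⊢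
      exact ⟨hu.1, huv.trans h.2⟩
    obtain ⟨Z', hZ', w', hw', hA', ho', hg'⟩ := ih (Y \ Z).card
      (by rw [← hc]; exact Finset.card_lt_card (Finset.ssubset_iff_of_subset
            Finset.sdiff_subset |>.2 ⟨y, hy, by simp [hyZ]⟩))
      (Y \ Z) (Finset.sdiff_subset.trans hYK) (fun u hu => hYc u (Finset.sdiff_subset hu))
      hclosed rfl
    set w := I.word (labels K Z (Y \ Z)) with hw
    have hsrc : I.src w = I.word (labels K ∅ (Y \ Z)) := src_word (hZY.trans hYK) hdisj
    have htgt : I.tgt w' = I.src w := by rw [hw', hsrc, tgt_word hZ']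
    -- the finished blocks have been recorded before `w` is processed
    have hlt : w' < w := by
      have h1 : w' ≤ I.src w := by
        rw [hw', hsrc]
        refine word_le_word fun u _ => ?_
        unfold labels
        by_cases h1 : u ∈ Z'
        · have := Finset.mem_sdiff.1 (hZ' h1)
          simp [h1, this]
        · by_cases h2 : u ∈ Y \ Z
          · simp [h1, Finset.mem_sdiff.1 h2]
          · by_cases h3 : u ∈ K <;> simp [h1, h2, h3]
      have h2 : I.src w ≤ w := by
        rw [hsrc, hw]
        refine word_le_word fun u _ => ?_
        unfold labels
        by_cases h1 : u ∈ Z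
        · simp [h1, hYK (hZY h1)]
        · simp [h1]
      refine h1.trans_lt (lt_of_le_of_ne h2 fun h => ?_)
      -- the two words are different, as `y` has different labels
      have h3 := congrArg (fun w => I.lab w y) h
      rw [hsrc, hw] at h3
      simp only [hlabel (hYc y hy), labels, if_pos hyZ] at h3
      simp [hyZ, hYK hy] at h3
    have hold : (I.around K (Y \ Z)).card + 1 ≤ I.old (I.tab l w) w := by
      unfold old
      split_ifs with h0
      · have h1 : Y \ Z = ∅ := by
          refine Finset.eq_empty_of_forall_notMem fun u hu => ?_
          have h2 : u ∈ I.cls w 2 := by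
            have h3 := Finset.mem_sdiff.1 hu
            refine mem_cls.2 ⟨Finset.mem_range.1 (hKn (hYK h3.1)), ?_⟩
            rw [hlabel (hYc u h3.1), labels, if_neg h3.2, if_pos hu]
          simp [h0] at h2
        simp [h1, around]
      · refine hg'.trans ((le_tab_succ hA' ho').trans ?_)
        rw [htgt]
        exact tab_mono hlt _
    have hcls : I.cls w 1 = Z := by
      ext u
      rw [mem_cls]
      constructor
      · rintro ⟨_, hu⟩
        have hcu : I.cov u ≠ 0 := fun h => by rw [lab_eq_four.2 h] at hu; omega
        rw [hlabel hcu, labels] at hu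
        by_contra h
        rw [if_neg h] at hu
        split_ifs at hu <;> omega
      · intro hu
        refine ⟨Finset.mem_range.1 (hKn (hYK (hZY hu))), ?_⟩
        rw [hlabel (hYc u (hZY hu)), labels, if_pos hu]
    have hZcard : Z.card ≤ l := by
      refine (Finset.card_le_card fun u hu => ?_).trans (hsz (col y))
      simp only [hZ, Finset.mem_filter] at hu ⊢
      exact ⟨hYK hu.1, hu.2⟩
    refine ⟨Z, hZY, w, rfl, ⟨fun u hu v hv hA h1 h2 => ?_, by rwa [hcls]⟩, by omega, ?_⟩
    · have h3 : u ∈ Z := by rw [← hcls]; exact mem_cls.2 ⟨hu, h1⟩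
      have hcv : I.cov v ≠ 0 := fun h => by rw [lab_eq_four.2 h] at h2; omega
      rw [hlabel hcv, labels] at h2
      have h5 : v ∈ Y \ Z := by
        by_contra h5
        rw [if_neg h5] at h2
        split_ifs at h2 <;> omega
      rw [Finset.mem_sdiff] at h5
      apply h5.2
      simp only [hZ, Finset.mem_filter] at h3 ⊢
      exact ⟨h5.1, (hcol u (hYK h3.1) v (hYK h5.1) hA).symm.trans h3.2⟩
    · -- the vertices around `Y` but not around the finished blocks belong to the block of `y`
      set D := (I.around K Y).filter (· ∉ I.around K (Y \ Z)) with hD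
      have hDm : ∀ v ∈ D, v ∈ K ∧ (v ∈ Z ∨ I.cov v = 0 ∧ ∃ u ∈ Z, I.A v u) := by
        intro v hv
        simp only [hD, around, Finset.mem_filter, not_and, not_or, not_exists] at hv
        obtain ⟨⟨hvK, hv1⟩, hv2⟩ := hv
        refine ⟨hvK, ?_⟩
        rcases hv1 with h | ⟨h, u, hu, hA⟩
        · have := (hv2 hvK).1
          left
          by_contra h'
          exact this (Finset.mem_sdiff.2 ⟨h, h'⟩)
        · refine .inr ⟨h, u, ?_, hA⟩
          by_contra h'
          exact (hv2 hvK).2 h u (Finset.mem_sdiff.2 ⟨hu, h'⟩) hA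
      have hZcol : ∀ u ∈ Z, col u = col y := fun u hu => by
        simp only [hZ, Finset.mem_filter] at hu; exact hu.2
      have hDcol : ∀ v ∈ D, col v = col y := by
        intro v hv
        obtain ⟨hvK, h | ⟨_, u, hu, hA⟩⟩ := hDm v hv
        · exact hZcol v h
        · exact (hcol v hvK u (hYK (hZY hu)) hA).trans (hZcol u hu)
      have hDl : D.card ≤ l := by
        refine (Finset.card_le_card fun v hv => ?_).trans (hsz (col y))
        exact Finset.mem_filter.2 ⟨(hDm v hv).1, hDcol v hv⟩
      have hDsub : D ⊆ Z ∪ I.inner w := by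
        intro v hv
        obtain ⟨hvK, h | ⟨hcv, u, hu, hA⟩⟩ := hDm v hv
        · exact Finset.mem_union_left _ h
        · refine Finset.mem_union_right _ ?_
          have hvn := Finset.mem_range.1 (hKn hvK)
          simp only [inner, Finset.mem_filter, Finset.mem_range, lab_eq_four]
          refine ⟨hvn, hcv, fun t ht hAt => ?_, u, Finset.mem_range.1 (hKn (hYK (hZY hu))), hA, ?_⟩
          · have hct : I.cov t ≠ 0 :=
              (I.cover.cover v t hvn ht hAt).resolve_left (by simpa using hcv)
            rw [hlabel hct, labels]
            by_cases htK : t ∈ K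
            · have h1 : col t = col y := (hcol v hvK t htK hAt).symm.trans (hDcol v hv)
              have : t ∈ Z := Finset.mem_filter.2 ⟨hY y hy t htK hct h1.symm, h1⟩
              simp [this]
            · have h1 : t ∉ Y := fun h => htK (hYK h)
              have h2 : t ∉ Z := fun h => h1 (hZY h)
              simp [htK, h1, h2]
          · rw [hlabel (hYc u (hZY hu)), labels, if_pos hu]
      have h1 : D.card ≤ I.gain l w := by
        unfold gain
        rw [hcls]
        exact le_min ((Finset.card_le_card hDsub).trans (Finset.card_union_le _ _)) hDl
      have h2 : (I.around K Y).card ≤ (I.around K (Y \ Z)).card + D.card := by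
        refine (Finset.card_le_card fun v hv => ?_).trans (Finset.card_union_le _ _)
        by_cases h : v ∈ I.around K (Y \ Z)
        · exact Finset.mem_union_left _ h
        · exact Finset.mem_union_right _ (Finset.mem_filter.2 ⟨hv, h⟩)
      omega

/-- Completeness: `exists_word` for the set `X` of all vertices of the cover that are kept. The
vertices of `K` that are not around `X` have lost all their neighbours. -/
theorem splits_success {k : ℕ} (h : Splits I.A I.n l k) : ∃ w < 4 ^ I.c, I.Success l k w := by
  classical
  obtain ⟨K, hKn, col, hcol, hsz, hk⟩ := h
  set X := K.filter (I.cov · ≠ 0) with hX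
  obtain ⟨Z, hZ, w, hw, h1, h2, h3⟩ := exists_word hKn hcol hsz X (Finset.filter_subset _ _)
    (fun u hu => (Finset.mem_filter.1 hu).2)
    (fun u _ v hv hc _ => Finset.mem_filter.2 ⟨hv, hc⟩)
  have hlabel : ∀ {u : ℕ}, I.cov u ≠ 0 → I.lab w u = labels K Z (X \ Z) u :=
    fun h => by rw [hw]; exact lab_word (labels_lt K _ _) h
  refine ⟨w, by rw [hw]; exact word_lt (labels_lt K _ _), h1, h2, ?_, ?_⟩
  · refine Finset.eq_empty_of_forall_notMem fun u hu => ?_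
    obtain ⟨_, hu⟩ := mem_cls.1 hu
    have hcu : I.cov u ≠ 0 := fun h => by rw [lab_eq_four.2 h] at hu; omega
    rw [hlabel hcu, labels] at hu
    by_cases hK : u ∈ K
    · have : u ∈ X := Finset.mem_filter.2 ⟨hK, hcu⟩
      by_cases hZ : u ∈ Z <;> simp [hZ, this] at hu
    · have h5 : u ∉ X := fun h => hK (Finset.mem_filter.1 h).1
      have h6 : u ∉ Z := fun h => h5 (hZ h)
      simp [hK, h5, h6] at hu
  · have : K.card ≤ (I.around K X).card + (I.iso w).card := by
      refine (Finset.card_le_card fun v hv => ?_).trans (Finset.card_union_le _ _)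
      by_cases h : v ∈ I.around K X
      · exact Finset.mem_union_left _ h
      · refine Finset.mem_union_right _ ?_
        simp only [around, Finset.mem_filter, not_and, not_or, not_exists] at h
        have hvn := Finset.mem_range.1 (hKn hv)
        have hcv : I.cov v = 0 := by
          by_contra hc
          exact (h hv).1 (Finset.mem_filter.2 ⟨hv, hc⟩)
        simp only [iso, Finset.mem_filter, Finset.mem_range, lab_eq_four]
        refine ⟨hvn, hcv, fun t ht hA => ?_⟩
        have hct : I.cov t ≠ 0 := (I.cover.cover v t hvn ht hA).resolve_left (by simpa using hcv)
        have h5 : t ∉ X := fun h' => (h hv).2 hcv t h' hA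
        have h6 : t ∉ Z := fun h => h5 (hZ h)
        have h7 : t ∉ K := fun h' => h5 (Finset.mem_filter.2 ⟨h', hct⟩)
        rw [hlabel hct, labels]
        simp [h5, h6, h7]
    omega

end Inst

/-! ### The program for the dynamic program -/

/-- negation -/
def notE (e : E) : E := .eq e (.lit 0)

/-- the digit of `word` at the position `e` -/
def digitE (e : E) : E :=
  .get .rem (.fold .stp .val e (.var .word) (.get .quot (.var .val)))

/-- the number that results from `word` if `h` is applied to its digits, by Horner's rule -/
def recodeE (h : E → E) : E :=
  .fold .pos .acc (.var .len) (.lit 0) (.add (.get .quad (.var .acc))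
    (h (digitE (.sub (.var .len) (.add (.var .pos) (.lit 1))))))

/-- the value of `srcDigit` -/
def srcDigitE (e : E) : E :=
  .ite (.eq e (.lit 2)) (.lit 2) (.ite (.eq e (.lit 3)) (.lit 3) (.lit 0))

/-- the value of `tgtDigit` -/
def tgtDigitE (e : E) : E :=
  .ite (.eq e (.lit 0)) (.lit 0) (.ite (.eq e (.lit 3)) (.lit 3) (.lit 2))

/-- the label of the vertex in the register `x` is `d` -/
def labE (x : Var) (d : ℕ) : E := .eq (.get .lab (.var x)) (.lit d)

/-- the number of vertices with label `d` -/
def clsE (d : ℕ) : E := .sum .vtx (.var .size) (labE .vtx d)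

/-- the number of neighbours `nbr` of `vtx` with the property `e`, which must have value `0` or `1`
-/
def nbrE (e : E) : E := .sum .nbr (.var .size) (andE (adjE (.var .vtx) (.var .nbr)) e)

/-- the number of edges from the current block to finished blocks -/
def crossE : E := .sum .vtx (.var .size) (andE (labE .vtx 1) (nbrE (labE .nbr 2)))

/-- the number of elements of `Inst.inner` -/
def innerE : E := .sum .vtx (.var .size) (andE (labE .vtx 4)
  (andE (notE (nbrE (andE (notE (labE .nbr 1)) (notE (labE .nbr 3)))))
    (notE (notE (nbrE (labE .nbr 1))))))

/-- the number of elements of `Inst.iso` -/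
def isoE : E := .sum .vtx (.var .size) (andE (labE .vtx 4) (notE (nbrE (notE (labE .nbr 3)))))

/-- the value of `Inst.gain` for blocks of at most `lim + 1` vertices -/
def gainE : E :=
  .ite (.lt (.add (clsE 1) innerE) (.add (.var .lim) (.lit 1))) (.add (clsE 1) innerE)
    (.add (.var .lim) (.lit 1))

/-- Process `word` for blocks of at most `lim + 1` vertices. -/
def dpStep : Cmd :=
  .loop .src (.var .size) (.store .lab (.var .src)
    (.ite (.get .cov (.var .src)) (digitE (.get .pos (.var .src))) (.lit 4))) ;;
  .assign .old (.ite (clsE 2) (.get .f (recodeE srcDigitE)) (.lit 1)) ;;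
  .ite (andE (.var .old) (andE (notE crossE) (.lt (clsE 1) (.add (.var .lim) (.lit 2)))))
    (.assign .new (.add (.var .old) gainE) ;;
      .ite (.lt (.get .f (recodeE tgtDigitE)) (.var .new))
        (.store .f (recodeE tgtDigitE) (.var .new)) .skip ;;
      .ite (andE (notE (clsE 0)) (.lt (.add (.add (.var .size) (.var .lim)) (.lit 1))
          (.add (.add (.var .new) isoE) (.var .bound))))
        (.assign .ans (.lit 1)) .skip)
    .skip

/-- Process all words in increasing order, for each size `lim + 1` of blocks from `1` to `n`. -/
def dp : Cmd :=
  .loop .lim (.var .size)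
    (.loop .word (.var .pow) (.store .f (.var .word) (.lit 0)) ;;
      .loop .word (.var .pow) dpStep)

theorem notE_eval (e : E) (σ : Store) : (notE e).eval σ = if e.eval σ = 0 then 1 else 0 := rfl

theorem andE_eval (e e' : E) (σ : Store) :
    (andE e e').eval σ = if e.eval σ ≠ 0 then e'.eval σ else 0 := rfl

theorem sum_eval_eq_zero {x : Var} {e : E} {σ : Store} :
    (E.sum x (.var .size) e).eval σ = 0 ↔ ∀ u < σ.reg .size, e.eval (σ.set x u) = 0 := by
  simp [E.eval]

theorem sum_eval_eq_card {x : Var} {e : E} {σ : Store} {n : ℕ} {p : ℕ → Prop} {_ : DecidablePred p}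
    (hn : σ.reg .size = n) (h : ∀ u < n, e.eval (σ.set x u) = if p u then 1 else 0) :
    (E.sum x (.var .size) e).eval σ = ((Finset.range n).filter p).card := by
  subst hn
  rw [Finset.card_filter]
  exact Finset.sum_congr rfl fun u hu => h u (Finset.mem_range.1 hu)

theorem digitE_eval {m w : ℕ} {σ : Store} (hT : Tables m σ) (hw : σ.reg .word = w) (hwm : w < m)
    (e : E) : (digitE e).eval σ = w / 4 ^ e.eval σ % 4 := by
  have H : ∀ p, (Nat.rec (σ.reg .word) (fun _ v => σ.arr .quot v) p : ℕ) = w / 4 ^ p := by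
    intro p
    induction p with
    | zero => simp [hw]
    | succ p ih =>
      change σ.arr .quot (Nat.rec (σ.reg .word) (fun _ v => σ.arr .quot v) p) = _
      rw [ih, hT.quot _ ((Nat.div_le_self _ _).trans_lt hwm), Nat.div_div_eq_div_mul, pow_succ]
  have h2 := H (e.eval σ)
  simp only [digitE, E.eval, Store.set_reg, Store.set_arr, if_true] at h2 ⊢
  rw [h2, hT.rem _ ((Nat.div_le_self _ _).trans_lt hwm)]

theorem recodeE_eval {c w : ℕ} {σ : Store} (hT : Tables (4 ^ c) σ) (hw : σ.reg .word = w)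
    (hwm : w < 4 ^ c) (hc : σ.reg .len = c) {h : E → E} {H : ℕ → ℕ} (hH : ∀ d, H d < 4)
    (hh : ∀ e σ', (h e).eval σ' = H (e.eval σ')) :
    (recodeE h).eval σ = recode c H w := by
  set d : ℕ → ℕ := fun i => H (w / 4 ^ i % 4) with hd
  have key : ∀ m ≤ c, (Nat.rec 0 (fun i a => (E.add (.get .quad (.var .acc))
      (h (digitE (.sub (.var .len) (.add (.var .pos) (.lit 1)))))).eval
        ((σ.set .pos i).set .acc a)) m : ℕ) = code m fun i => d (c - m + i) := by
    intro m
    induction m with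
    | zero => intro _; simp [code]
    | succ m ih =>
      intro hm
      change (E.add (.get .quad (.var .acc)) _).eval ((σ.set .pos m).set .acc (Nat.rec _ _ m)) = _
      rw [ih (by omega)]
      have hlt : (code m fun i => d (c - m + i)) < 4 ^ c :=
        (code_lt m fun _ => hH _).trans_le (Nat.pow_le_pow_right (by omega) (by omega))
      have hT' : Tables (4 ^ c) ((σ.set .pos m).set .acc (code m fun i => d (c - m + i))) :=
        ⟨hT.quad, hT.quot, hT.rem⟩
      rw [E.eval, hh, digitE_eval hT' (by simpa using hw) hwm, code_succ]
      simp only [E.eval, Store.set_reg, Store.set_arr, if_true, reduceCtorEq, if_false, hc]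
      rw [hT.quad _ hlt, add_comm]
      congr 2
      refine congrArg (code m) (funext fun i => ?_)
      congr 1
      omega
  have := key c le_rfl
  simp only [recodeE, E.eval, hc] at this ⊢
  rw [this]
  exact code_congr fun i _ => by simp [hd]

theorem srcDigitE_eval (e : E) (σ : Store) : (srcDigitE e).eval σ = srcDigit (e.eval σ) := by
  by_cases h2 : e.eval σ = 2 <;> by_cases h3 : e.eval σ = 3 <;>
    simp [srcDigitE, E.eval, srcDigit, h2, h3]

theorem tgtDigitE_eval (e : E) (σ : Store) : (tgtDigitE e).eval σ = tgtDigit (e.eval σ) := by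
  by_cases h2 : e.eval σ = 0 <;> by_cases h3 : e.eval σ = 3 <;>
    simp [tgtDigitE, E.eval, tgtDigit, h2, h3]

/-- The memory holds the instance `I`. -/
structure Inst.At (I : Inst) (σ : Store) : Prop where
  size : σ.reg .size = I.n
  adj : AdjCells I.A I.n σ
  cov : σ.arr .cov = I.cov
  pos : σ.arr .pos = I.pos
  len : σ.reg .len = I.c
  pow : σ.reg .pow = 4 ^ I.c
  tables : Tables (4 ^ I.c) σ

/-- The array `lab` holds the labels for the word `w`. -/
def Inst.LabAt (I : Inst) (w : ℕ) (σ : Store) : Prop := ∀ u < I.n, σ.arr .lab u = I.lab w u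

namespace Inst

variable {I : Inst} {w : ℕ} {σ : Store}

theorem At.keep {σ' : Store} (h : I.At σ) {xs : List Var} {as : List Arr} (hk : Keep xs as σ σ')
    (hx : ∀ x ∈ [Var.size, .len, .pow], x ∉ xs)
    (ha : ∀ a ∈ [Arr.adj, .cov, .pos, .quad, .quot, .rem], a ∉ as) : I.At σ' := by
  refine ⟨?_, h.adj.keep hk (ha _ (by decide)), ?_, ?_, ?_, ?_, h.tables.keep hk (ha _ (by decide))
    (ha _ (by decide)) (ha _ (by decide))⟩
  · rw [hk.reg _ (hx _ (by decide)), h.size]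
  · rw [hk.arr _ (ha _ (by decide)), h.cov]
  · rw [hk.arr _ (ha _ (by decide)), h.pos]
  · rw [hk.reg _ (hx _ (by decide)), h.len]
  · rw [hk.reg _ (hx _ (by decide)), h.pow]

theorem At.set (h : I.At σ) {x : Var} (m : ℕ) (hx : x ∉ [Var.size, .len, .pow]) :
    I.At (σ.set x m) :=
  h.keep (xs := [x]) (as := []) ((Keep.refl _ _ _).set (by simp) m)
    (fun y hy hxy => hx (by rwa [← List.mem_singleton.1 hxy])) (by simp)

theorem labE_vtx {d v : ℕ} (hl : I.LabAt w σ) (hv : v < I.n) :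
    (labE .vtx d).eval (σ.set .vtx v) = if I.lab w v = d then 1 else 0 := by
  simp [labE, E.eval, hl v hv]

theorem labE_nbr {d u v : ℕ} (hl : I.LabAt w σ) (hu : u < I.n) :
    (labE .nbr d).eval ((σ.set .vtx v).set .nbr u) = if I.lab w u = d then 1 else 0 := by
  simp [labE, E.eval, hl u hu]

theorem clsE_eval (h : I.At σ) (hl : I.LabAt w σ) (d : ℕ) :
    (clsE d).eval σ = (I.cls w d).card := by
  rw [clsE, cls]
  exact sum_eval_eq_card h.size fun _ hu => labE_vtx hl hu

theorem nbrE_eq_zero (h : I.At σ) {v : ℕ} (hv : v < I.n) {e : E} :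
    (nbrE e).eval (σ.set .vtx v) = 0 ↔
      ∀ u < I.n, I.A v u → e.eval ((σ.set .vtx v).set .nbr u) = 0 := by
  rw [nbrE, sum_eval_eq_zero]
  simp only [Store.set_reg, reduceCtorEq, if_false, h.size, andE_eval, adjE_eval]
  refine forall₂_congr fun u hu => ?_
  have := h.adj v u hv hu
  simp only [E.eval, Store.set_reg, Store.set_arr, reduceCtorEq, if_false, if_true, ← this]
  split_ifs with h1
  · simp [h1]
  · simp only [ne_eq, not_not] at h1
    simp [h1]

theorem crossE_eq_zero (h : I.At σ) (hl : I.LabAt w σ) :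
    crossE.eval σ = 0 ↔ ∀ u < I.n, ∀ v < I.n, I.A u v → I.lab w u = 1 → I.lab w v ≠ 2 := by
  rw [crossE, sum_eval_eq_zero, h.size]
  refine forall₂_congr fun u hu => ?_
  rw [andE_eval, labE_vtx hl hu]
  by_cases h1 : I.lab w u = 1
  · simp only [h1, if_true, ne_eq, one_ne_zero, not_false_eq_true, nbrE_eq_zero h hu]
    refine forall₂_congr fun v hv => ?_
    rw [labE_nbr hl hv]
    simp
  · simp [h1]

theorem innerE_eval (h : I.At σ) (hl : I.LabAt w σ) : innerE.eval σ = (I.inner w).card := by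
  rw [innerE, inner]
  refine sum_eval_eq_card h.size fun v hv => ?_
  have h1 : (nbrE (andE (notE (labE .nbr 1)) (notE (labE .nbr 3)))).eval (σ.set .vtx v) = 0 ↔
      ∀ u < I.n, I.A v u → I.lab w u = 1 ∨ I.lab w u = 3 := by
    rw [nbrE_eq_zero h hv]
    refine forall₂_congr fun u hu => imp_congr_right fun _ => ?_
    rw [andE_eval, notE_eval, notE_eval,
      labE_nbr hl hu, labE_nbr hl hu]
    by_cases h1 : I.lab w u = 1 <;> by_cases h3 : I.lab w u = 3 <;> simp [h1, h3]
  have h2 : (nbrE (labE .nbr 1)).eval (σ.set .vtx v) = 0 ↔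
      ¬ ∃ u < I.n, I.A v u ∧ I.lab w u = 1 := by
    rw [nbrE_eq_zero h hv]
    push Not
    refine forall₂_congr fun u hu => imp_congr_right fun _ => ?_
    rw [labE_nbr hl hu]
    simp
  rw [andE_eval, andE_eval, notE_eval, notE_eval, notE_eval, labE_vtx hl hv]
  have key := and_congr (Iff.refl (I.lab w v = 4)) (and_congr h1 (not_iff_comm.1 h2.symm))
  by_cases hp : I.lab w v = 4 ∧ (∀ u < I.n, I.A v u → I.lab w u = 1 ∨ I.lab w u = 3) ∧
      ∃ u < I.n, I.A v u ∧ I.lab w u = 1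
  · obtain ⟨k1, k2, k3⟩ := key.2 hp
    rw [if_pos hp]
    simp [k1, k2, k3]
  · rw [if_neg hp]
    have := mt key.1 hp
    split_ifs <;> simp_all

theorem isoE_eval (h : I.At σ) (hl : I.LabAt w σ) : isoE.eval σ = (I.iso w).card := by
  rw [isoE, iso]
  refine sum_eval_eq_card h.size fun v hv => ?_
  have h1 : (nbrE (notE (labE .nbr 3))).eval (σ.set .vtx v) = 0 ↔
      ∀ u < I.n, I.A v u → I.lab w u = 3 := by
    rw [nbrE_eq_zero h hv]
    refine forall₂_congr fun u hu => imp_congr_right fun _ => ?_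
    rw [notE_eval, labE_nbr hl hu]
    simp
  rw [andE_eval, notE_eval, labE_vtx hl hv]
  have key := and_congr (Iff.refl (I.lab w v = 4)) h1
  by_cases hp : I.lab w v = 4 ∧ ∀ u < I.n, I.A v u → I.lab w u = 3
  · obtain ⟨k1, k2⟩ := key.2 hp
    rw [if_pos hp]
    simp [k1, k2]
  · rw [if_neg hp]
    have := mt key.1 hp
    split_ifs <;> simp_all

theorem gainE_eval {l : ℕ} (h : I.At σ) (hl : I.LabAt w σ) (hlim : σ.reg .lim = l) :
    gainE.eval σ = I.gain (l + 1) w := by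
  simp only [gainE, E.eval, clsE_eval h hl, innerE_eval h hl, hlim, gain]
  split_ifs with h1 <;> simp at h1 <;> omega

end Inst

/-- The labels for `word` are computed. -/
theorem runs_labels {M L : ℕ} {I : Inst} {w : ℕ} {σ : Store} (hL : Clock M L) (hσ : Small M σ)
    (hM : I.n ≤ M) (h : I.At σ) (hword : σ.reg .word = w) (hw : w < 4 ^ I.c) :
    Runs (.loop .src (.var .size) (.store .lab (.var .src)
      (.ite (.get .cov (.var .src)) (digitE (.get .pos (.var .src))) (.lit 4)))) σ (L ^ 3)
      fun σ' => Keep [.src] [.lab] σ σ' ∧ Small M σ' ∧ I.LabAt w σ' := by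
  have hbig := hL.big
  have hML := hL.le
  have hT : L + I.n * (2 * L + 3) ≤ L ^ 3 := by
    have h1 : 64 * L ≤ L * L := Nat.mul_le_mul_right _ hbig
    have h2 : 64 * (L * L) ≤ L * (L * L) := Nat.mul_le_mul_right _ hbig
    have h3 : I.n * (2 * L + 3) ≤ L * (3 * L) := Nat.mul_le_mul (by omega) (by omega)
    have h4 : L * (3 * L) = 3 * (L * L) := by ring
    have h5 : L ^ 3 = L * (L * L) := by ring
    omega
  refine (Runs.loop hL hσ (by decide) (by decide) (m := I.n) (fun k σ' =>
    Keep [.src] [.lab] σ σ' ∧ Small M σ' ∧ ∀ u < k, σ'.arr .lab u = I.lab w u)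
    (by simpa [E.eval] using h.size) ⟨Keep.refl _ _ _, hσ, by simp⟩ ?_ fun σ' h => h).time hT
  rintro k hk σ1 ⟨i1, i2, i3⟩
  have hs := i2.set (x := .src) (m := k) (by intro; omega)
  have hk1 := i1.set (x := .src) (by decide) k
  have hI := h.keep hk1 (by decide) (by decide)
  have hval : (E.ite (.get .cov (.var .src)) (digitE (.get .pos (.var .src))) (.lit 4)).eval
      (σ1.set .src k) = I.lab w k := by
    rw [E.eval, digitE_eval hI.tables (by rw [hk1.reg .word (by decide), hword]) hw]
    simp only [E.eval, hI.cov, hI.pos, Store.set_reg, if_true, Inst.lab]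
  refine Runs.store hL hs (by decide) (by decide) (by decide) (by decide)
    ⟨hk1.setCell (by decide) _ _, hs.setCell (by simp [Arr.small]), fun u hu => ?_⟩
  rw [hval]
  by_cases huk : u = k
  · simp [huk, E.eval]
  · simp [huk, E.eval, i3 u (by omega)]

open scoped Classical in
theorem runs_dpStep {M L k l : ℕ} {I : Inst} {w : ℕ} {σ : Store} (hL : Clock M L) (hσ : Small M σ)
    (hM : I.n + 1 ≤ M) (h : I.At σ) (hword : σ.reg .word = w) (hw : w < 4 ^ I.c)
    (hlim : σ.reg .lim = l) (hbound : σ.reg .bound = k)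
    (hf : ∀ T < 4 ^ I.c, σ.arr .f T = I.tab (l + 1) w T) :
    Runs dpStep σ (L ^ 4) fun σ' => Keep [.src, .old, .new, .ans] [.lab, .f] σ σ' ∧ Small M σ' ∧
      (∀ T < 4 ^ I.c, σ'.arr .f T = I.tab (l + 1) (w + 1) T) ∧
      σ'.reg .ans = if I.Success (l + 1) k w then 1 else σ.reg .ans := by
  have hbig := hL.big
  have hT : L ^ 3 + (L + (L + (L + ((L + 2 * L) + (L + L))))) ≤ L ^ 4 := by
    have h1 : 64 * L ≤ L * L := Nat.mul_le_mul_right _ hbig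
    have h2 : 64 * (L * L) ≤ L * (L * L) := Nat.mul_le_mul_right _ hbig
    have h4 : 64 * (L * (L * L)) ≤ L * (L * (L * L)) := Nat.mul_le_mul_right _ hbig
    have e3 : L ^ 3 = L * (L * L) := by ring
    have e4 : L ^ 4 = L * (L * (L * L)) := by ring
    omega
  have hword' : ∀ {σ' : Store} {xs : List Var} {as : List Arr}, Keep xs as σ σ' → Var.word ∉ xs →
      σ'.reg .word = w := fun hk hx => by rw [hk.reg _ hx, hword]
  refine (Runs.seq (runs_labels hL hσ (by omega) h hword hw) ?_).time hT
  rintro σ1 ⟨k1, s1, l1⟩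
  have h1 := h.keep k1 (by decide) (by decide)
  set old := I.old (I.tab (l + 1) w) w with hold
  have hsrc : (recodeE srcDigitE).eval σ1 = I.src w :=
    recodeE_eval h1.tables (hword' k1 (by decide)) hw h1.len Inst.srcDigit_lt srcDigitE_eval
  refine Runs.assign_seq hL s1 (by decide) (by decide) (m := old) ?_ ?_
  · simp only [E.eval, Inst.clsE_eval h1 l1, hsrc, hold, Inst.old, k1.arr .f (by decide),
      hf _ (Inst.src_lt w), ne_eq, Finset.card_eq_zero, ite_not]
  set σ2 := σ1.set .old old with hσ2
  have s2 : Small M σ2 := s1.set (by simp [Var.small])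
  have h2 : I.At σ2 := h1.set _ (by decide)
  have l2 : I.LabAt w σ2 := l1
  have k2 : Keep [.src, .old, .new, .ans] [.lab, .f] σ σ2 :=
    ((Keep.refl _ _ _).trans k1 (by decide) (by decide)).set (by decide) _
  have f2 : ∀ T < 4 ^ I.c, σ2.arr .f T = I.tab (l + 1) w T := fun T hT => by
    rw [hσ2, Store.set_arr, k1.arr .f (by decide), hf T hT]
  have a2 : σ2.reg .ans = σ.reg .ans := by rw [hσ2]; simp [k1.reg .ans (by decide)]
  have lim2 : σ2.reg .lim = l := by rw [k2.reg .lim (by decide), hlim]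
  have hcond : (andE (.var .old) (andE (notE crossE)
      (.lt (clsE 1) (.add (.var .lim) (.lit 2))))).eval σ2 ≠ 0 ↔ old ≠ 0 ∧ I.Adm (l + 1) w := by
    rw [andE_ne_zero, andE_ne_zero, notE_eval, Inst.Adm, ← Inst.crossE_eq_zero h2 l2]
    simp only [E.eval, Inst.clsE_eval h2 l2, lim2]
    simp [hσ2]
    omega
  refine Runs.ite hL s2 (by decide) (by decide) ?_ ?_
  · intro hc
    obtain ⟨hold0, hadm⟩ := hcond.1 hc
    set new := old + I.gain (l + 1) w with hnew
    refine Runs.assign_seq hL s2 (by decide) (by decide) (m := new) ?_ ?_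
    · simp only [E.eval, Inst.gainE_eval h2 l2 lim2]
      simp [hσ2, hnew]
    set σ3 := σ2.set .new new with hσ3
    have s3 : Small M σ3 := s2.set (by simp [Var.small])
    have h3 : I.At σ3 := h2.set _ (by decide)
    have k3 : Keep [.src, .old, .new, .ans] [.lab, .f] σ σ3 := k2.set (by decide) _
    have f3 : ∀ T < 4 ^ I.c, σ3.arr .f T = I.tab (l + 1) w T := f2
    have htgt : (recodeE tgtDigitE).eval σ3 = I.tgt w :=
      recodeE_eval h3.tables (hword' k3 (by decide)) hw h3.len Inst.tgtDigit_lt tgtDigitE_eval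
    have new3 : σ3.reg .new = new := by simp [hσ3]
    refine Runs.seq (Q' := fun σ' => Keep [] [.f] σ3 σ' ∧ Small M σ' ∧
      ∀ T < 4 ^ I.c, σ'.arr .f T = I.tab (l + 1) (w + 1) T) (Runs.ite hL s3 (by decide) (by decide)
        ?_ ?_) ?_
    · intro hlt
      simp only [E.eval, htgt, f3 _ (Inst.tgt_lt w), new3] at hlt
      have hlt' : I.tab (l + 1) w (I.tgt w) < new := by by_contra h; simp [h] at hlt
      refine Runs.store hL s3 (by decide) (by decide) (by decide) (by decide)
        ⟨(Keep.refl _ _ _).setCell (by decide) _ _, s3.setCell (by simp [Arr.small]),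
          fun T hT => ?_⟩
      rw [Inst.tab, if_pos ⟨hadm, hold0, hlt'⟩, htgt, E.eval, new3]
      by_cases hTw : T = I.tgt w
      · simp [hTw, ← hold, hnew]
      · simp [hTw, f3 T hT]
    · intro hlt
      simp only [E.eval, htgt, f3 _ (Inst.tgt_lt w), new3] at hlt
      have hlt' : ¬ I.tab (l + 1) w (I.tgt w) < new := fun h => by simp [h] at hlt
      refine (Runs.skip ⟨Keep.refl _ _ _, s3, fun T hT => ?_⟩).time (by omega)
      rw [Inst.tab, if_neg fun h => hlt' h.2.2, f3 T hT]
    rintro σ4 ⟨k34, s4, f4⟩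
    have h4 := h3.keep k34 (by decide) (by decide)
    have k4 := k3.trans k34 (by decide) (by decide)
    have l4 : I.LabAt w σ4 := fun u hu => by rw [k34.arr .lab (by decide)]; exact l2 u hu
    have a4 : σ4.reg .ans = σ.reg .ans := by rw [k34.reg .ans (by decide), hσ3]; simpa using a2
    have hans : (andE (notE (clsE 0)) (.lt (.add (.add (.var .size) (.var .lim)) (.lit 1))
          (.add (.add (.var .new) isoE) (.var .bound)))).eval σ4 ≠ 0 ↔ I.Success (l + 1) k w := by
      rw [andE_ne_zero, notE_eval]
      simp only [E.eval, Inst.clsE_eval h4 l4, Inst.isoE_eval h4 l4, h4.size,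
        k4.reg .lim (by decide), hlim, k4.reg .bound (by decide), hbound,
        k34.reg .new (by decide), new3, Inst.Success, ← hold, hnew]
      simp [hadm, hold0]
      omega
    refine Runs.ite hL s4 (by decide) (by decide) ?_ ?_
    · intro hc'
      refine Runs.assign hL s4 (by decide) (by decide) ⟨k4.set (by decide) _,
        s4.set (by intro; simp [E.eval]; omega), f4, ?_⟩
      rw [if_pos (hans.1 hc')]; simp [E.eval]
    · intro hc'
      refine (Runs.skip ⟨k4, s4, f4, ?_⟩).time (by omega)
      rw [if_neg fun h => hans.2 h hc', a4]
  · intro hc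
    have hc' : ¬ (old ≠ 0 ∧ I.Adm (l + 1) w) := fun h => hcond.2 h hc
    refine (Runs.skip ⟨k2, s2, fun T hT => ?_, ?_⟩).time (by omega)
    · rw [Inst.tab, if_neg fun h => hc' ⟨h.2.1, h.1⟩, f2 T hT]
    · rw [if_neg fun h => hc' ⟨h.2.1, h.1⟩, a2]

/-- The registers that `dp` changes. -/
abbrev dpRegs : List Var := [.src, .old, .new, .ans, .lim, .word]

theorem runs_dp {M L k : ℕ} {I : Inst} {σ : Store} (hL : Clock M L) (hσ : Small M σ)
    (hM : I.n + 1 ≤ M) (h : I.At σ) (hbound : σ.reg .bound = k) :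
    Runs dp σ (L ^ 6 * 4 ^ I.c) fun σ' => Keep dpRegs [.lab, .f] σ σ' ∧ Small M σ' ∧
      (σ'.reg .ans = 1 ∨ σ'.reg .ans = σ.reg .ans) ∧
      (σ'.reg .ans = 1 ↔ σ.reg .ans = 1 ∨
        ∃ l < I.n, ∃ w < 4 ^ I.c, I.Success (l + 1) k w) := by
  classical
  have hbig := hL.big
  have hML := hL.le
  set P := 4 ^ I.c with hP
  have hP1 : 1 ≤ P := Nat.one_le_pow _ _ (by omega)
  have hT : L + I.n * (((L + P * (2 * L + 3)) + (L + P * (L ^ 4 + 3))) + 3) ≤ L ^ 6 * P := by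
    have h1 : 64 * L ≤ L * L := Nat.mul_le_mul_right _ hbig
    have h4 : 64 * L ^ 4 ≤ L * L ^ 4 := Nat.mul_le_mul_right _ hbig
    have h3 : L ≤ L ^ 4 := Nat.le_self_pow (by omega) _
    calc _ ≤ L * P + L * (((L * P + P * (2 * L + 3)) + (L * P + P * (L ^ 4 + 3))) + 3 * P) := by
          gcongr
          any_goals exact Nat.le_mul_of_pos_right _ hP1
          omega
      _ = L * (L ^ 4 + 4 * L + 10) * P := by ring
      _ ≤ L * (L * L ^ 4) * P := Nat.mul_le_mul_right _ (Nat.mul_le_mul_left _ (by omega))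
      _ = _ := by ring
  refine (Runs.loop hL hσ (by decide) (by decide) (m := I.n) (fun m σ' =>
    Keep dpRegs [.lab, .f] σ σ' ∧ Small M σ' ∧ (σ'.reg .ans = 1 ∨ σ'.reg .ans = σ.reg .ans) ∧
      (σ'.reg .ans = 1 ↔ σ.reg .ans = 1 ∨ ∃ l < m, ∃ w < P, I.Success (l + 1) k w))
    (by simpa [E.eval] using h.size) ⟨Keep.refl _ _ _, hσ, .inr rfl, by simp⟩ ?_
    fun σ' h => h).time hT
  rintro l hl σ1 ⟨k1, s1, a1, b1⟩
  have s2 := s1.set (x := .lim) (m := l) (by intro; omega)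
  have k2 := k1.set (x := .lim) (by decide) l
  have h2 := h.keep k2 (by decide) (by decide)
  refine Runs.seq (Q' := fun σ' => Keep [.word] [.f] (σ1.set .lim l) σ' ∧ Small M σ' ∧
    ∀ T < P, σ'.arr .f T = 0) (Runs.loop hL s2 (by decide) (by decide) (m := P) (fun m σ' =>
      Keep [.word] [.f] (σ1.set .lim l) σ' ∧ Small M σ' ∧ ∀ T < m, σ'.arr .f T = 0)
      (by simpa [E.eval] using h2.pow) ⟨Keep.refl _ _ _, s2, by simp⟩ ?_ fun σ' h => h) ?_
  · rintro w hw σ3 ⟨k3, s3, f3⟩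
    have s4 := s3.set (x := .word) (m := w) (by simp [Var.small])
    refine Runs.store hL s4 (by decide) (by decide) (by decide) (by decide)
      ⟨(k3.set (by decide) _).setCell (by decide) _ _, s4.setCell (by simp [Arr.small]),
        fun T hT => ?_⟩
    by_cases hTw : T = w
    · simp [hTw, E.eval]
    · simp [hTw, E.eval, f3 T (by omega)]
  rintro σ3 ⟨k23, s3, f3⟩
  have k3 := k2.trans k23 (by decide) (by decide)
  have h3 := h2.keep k23 (by decide) (by decide)
  have a3 : σ3.reg .ans = σ1.reg .ans := by rw [k23.reg .ans (by decide)]; simp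
  have l3 : σ3.reg .lim = l := by rw [k23.reg .lim (by decide)]; simp
  refine Runs.loop hL s3 (by decide) (by decide) (m := P) (T := L ^ 4) (fun m σ' =>
    Keep dpRegs [.lab, .f] σ σ' ∧ Small M σ' ∧ σ'.reg .lim = l ∧
      (∀ T < P, σ'.arr .f T = I.tab (l + 1) m T) ∧
      (σ'.reg .ans = 1 ∨ σ'.reg .ans = σ.reg .ans) ∧
      (σ'.reg .ans = 1 ↔ σ1.reg .ans = 1 ∨ ∃ w < m, I.Success (l + 1) k w))
    (by simpa [E.eval] using h3.pow)
    ⟨k3, s3, l3, by simpa [Inst.tab] using f3, by rwa [a3], by simp [a3]⟩ ?_ ?_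
  · rintro w hw σ4 ⟨k4, s4, l4, f4, a4, b4⟩
    have s5 := s4.set (x := .word) (m := w) (by simp [Var.small])
    have k5 := k4.set (x := .word) (by decide) w
    refine (runs_dpStep hL s5 hM (h.keep k5 (by decide) (by decide)) (w := w) (by simp) hw
      (by simpa using l4) (by rw [k5.reg .bound (by decide), hbound]) f4).mono le_rfl ?_
    rintro σ6 ⟨k6, s6, f6, a6⟩
    refine ⟨k5.trans k6 (by decide) (by decide), s6, ?_, f6, ?_, ?_⟩
    · rw [k6.reg .lim (by decide)]; simpa using l4
    · rw [a6]
      split_ifs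
      · exact .inl rfl
      · simpa using a4
    · have : (∃ w' < w + 1, I.Success (l + 1) k w') ↔
          (∃ w' < w, I.Success (l + 1) k w') ∨ I.Success (l + 1) k w := by
        simp only [Nat.lt_succ_iff_lt_or_eq, or_and_right, exists_or, exists_eq_left]
      rw [a6, this, ← or_assoc, ← b4]
      split_ifs with hs <;> simp [hs]
  · rintro σ4 ⟨k4, s4, l4, f4, a4, b4⟩
    refine ⟨k4, s4, a4, ?_⟩
    have : (∃ l' < l + 1, ∃ w < P, I.Success (l' + 1) k w) ↔
        (∃ l' < l, ∃ w < P, I.Success (l' + 1) k w) ∨ ∃ w < P, I.Success (l + 1) k w := by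
      simp only [Nat.lt_succ_iff_lt_or_eq, or_and_right, exists_or, exists_eq_left]
    rw [this, ← or_assoc, ← b1, b4]

/-! ### Vertex integrity of graphs on numbers -/

/-- Adjacency in a graph on `Fin n`, as a relation on numbers. -/
def numAdj {n : ℕ} (G : SimpleGraph (Fin n)) (u v : ℕ) : Prop :=
  ∃ (hu : u < n) (hv : v < n), G.Adj ⟨u, hu⟩ ⟨v, hv⟩

theorem numAdj_symm {n : ℕ} {G : SimpleGraph (Fin n)} (u v : ℕ) (h : numAdj G u v) :
    numAdj G v u :=
  let ⟨hu, hv, h⟩ := h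
  ⟨hv, hu, h.symm⟩

theorem vertexIntegrity_le_iff {V : Type*} [Finite V] {G : SimpleGraph V} {m : ℕ} :
    vertexIntegrity G ≤ m ↔ ∃ (S : Set V) (l : ℕ), S.ncard + l ≤ m ∧
      ∀ D : (G.induce Sᶜ).ConnectedComponent, D.supp.ncard ≤ l := by
  constructor
  · intro h
    obtain ⟨S, hS⟩ := Nat.sInf_mem (Set.range_nonempty fun S : Set V =>
      S.ncard + ⨆ D : (G.induce Sᶜ).ConnectedComponent, D.supp.ncard)
    exact ⟨S, _, hS.trans_le h, fun D => le_ciSup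
      (f := fun D : (G.induce Sᶜ).ConnectedComponent => D.supp.ncard)
      (Set.finite_range _).bddAbove D⟩
  · rintro ⟨S, l, h, hD⟩
    exact ((ciInf_le' _ S).trans (Nat.add_le_add_left (ciSup_le' hD) _)).trans h

theorem Splits.vertexIntegrity_le {n l m : ℕ} {G : SimpleGraph (Fin n)}
    (h : Splits (numAdj G) n l m) : vertexIntegrity G ≤ m := by
  obtain ⟨K, hK, col, hcol, hl, hm⟩ := h
  let S : Set (Fin n) := {v | v.val ∉ K}
  have hc : Sᶜ.ncard = K.card := by
    rw [← Set.ncard_image_of_injective _ Fin.val_injective, ← Set.ncard_coe_finset]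
    congr 1
    ext u
    simp only [S, Set.mem_image, Set.mem_compl_iff, Set.mem_ofPred_eq, not_not, Finset.mem_coe]
    exact ⟨by rintro ⟨v, hv, rfl⟩; exact hv,
      fun hu => ⟨⟨u, Finset.mem_range.1 (hK hu)⟩, hu, rfl⟩⟩
  have hS := Set.ncard_add_ncard_compl S
  rw [Nat.card_fin, hc] at hS
  refine vertexIntegrity_le_iff.2 ⟨S, l, by omega, fun D => ?_⟩
  induction D using SimpleGraph.ConnectedComponent.ind with | h v => ?_
  have hmem : ∀ u : ↑Sᶜ, u.1.val ∈ K := fun u => not_not.1 u.2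
  have hreach : ∀ u : ↑Sᶜ, (G.induce Sᶜ).Reachable v u → col u.1.val = col v.1.val := by
    intro u hu
    rw [SimpleGraph.reachable_iff_reflTransGen] at hu
    induction hu with
    | refl => rfl
    | @tail a b _ hab ih =>
      rw [← ih]
      exact (hcol _ (hmem a) _ (hmem b) ⟨a.1.2, b.1.2, hab⟩).symm
  refine le_trans ?_ (hl (col v.1.val))
  rw [← Set.ncard_coe_finset]
  refine Set.ncard_le_ncard_of_injOn (fun u : ↑Sᶜ => u.1.val) (fun u hu => ?_)
    (fun a _ b _ h => Subtype.ext (Fin.ext h)) (Finset.finite_toSet _)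
  rw [SimpleGraph.ConnectedComponent.mem_supp_iff, SimpleGraph.ConnectedComponent.eq] at hu
  simpa using ⟨hmem u, hreach u hu.symm⟩

theorem exists_splits_of_vertexIntegrity_le {n m : ℕ} {G : SimpleGraph (Fin n)}
    (h : vertexIntegrity G ≤ m) (hm : m < n) : ∃ l < n, Splits (numAdj G) n (l + 1) m := by
  classical
  obtain ⟨S, l, hl, hD⟩ := vertexIntegrity_le_iff.1 h
  have hS := Set.ncard_add_ncard_compl S
  rw [Nat.card_fin] at hS
  obtain ⟨v, hv⟩ : Sᶜ.Nonempty := Set.nonempty_of_ncard_ne_zero (by omega)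
  have hpos : 0 < l := lt_of_lt_of_le
    ((Set.ncard_pos).2 ((G.induce Sᶜ).connectedComponentMk ⟨v, hv⟩).nonempty_supp) (hD _)
  obtain ⟨f, hf⟩ := Countable.exists_injective_nat (G.induce Sᶜ).ConnectedComponent
  -- the blocks are the components, numbered by `f`
  let comp : ↑Sᶜ → ℕ := fun u => f ((G.induce Sᶜ).connectedComponentMk u)
  let K : Finset ℕ := Sᶜ.toFinset.image Fin.val
  have hK : ∀ u, u ∈ K ↔ ∃ w : ↑Sᶜ, w.1.val = u := by simp [K]
  let col : ℕ → ℕ := fun u => if h : ∃ w : ↑Sᶜ, w.1.val = u then comp h.choose else 0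
  have hcol : ∀ w : ↑Sᶜ, col w.1.val = comp w := fun w => by
    have h : ∃ w' : ↑Sᶜ, w'.1.val = w.1.val := ⟨w, rfl⟩
    have e : h.choose = w := Subtype.ext (Fin.ext h.choose_spec)
    simp only [col, dif_pos h, e]
  have hcard : K.card = Sᶜ.ncard := by
    rw [Finset.card_image_of_injective _ Fin.val_injective, Set.ncard_eq_toFinset_card']
  refine ⟨l - 1, by omega, K, fun u hu => ?_, col, ?_, fun x => ?_, by omega⟩
  · obtain ⟨w, rfl⟩ := (hK u).1 hu
    exact Finset.mem_range.2 w.1.2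
  · rintro u hu v hv ⟨h1, h2, hA⟩
    obtain ⟨a, rfl⟩ := (hK u).1 hu
    obtain ⟨b, rfl⟩ := (hK v).1 hv
    rw [hcol, hcol]
    exact congrArg f (SimpleGraph.ConnectedComponent.sound
      (SimpleGraph.Adj.reachable (G := G.induce Sᶜ) hA))
  · rcases (K.filter (col · = x)).eq_empty_or_nonempty with he | ⟨u, hu⟩
    · simp [he]
    · obtain ⟨hu', rfl⟩ := Finset.mem_filter.1 hu
      obtain ⟨a, rfl⟩ := (hK u).1 hu'
      refine le_trans ?_
        ((hD ((G.induce Sᶜ).connectedComponentMk a)).trans (by omega : l ≤ l - 1 + 1))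
      rw [← Set.ncard_image_of_injective _
        (Fin.val_injective.comp Subtype.val_injective : Function.Injective fun w : ↑Sᶜ => w.1.val),
        ← Set.ncard_coe_finset]
      refine Set.ncard_le_ncard (fun v hv => ?_) (Set.toFinite _)
      obtain ⟨hv, e⟩ := Finset.mem_filter.1 hv
      obtain ⟨b, rfl⟩ := (hK v).1 hv
      rw [hcol, hcol] at e
      exact ⟨b, hf e, rfl⟩

/-- Either everything is deleted, or the vertices that are kept fall into blocks with at most `l +
1` vertices, where `l` is less than `n`. Blocks need not be connected. -/
theorem vertexIntegrity_le_iff_splits {n m : ℕ} {G : SimpleGraph (Fin n)} :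
    vertexIntegrity G ≤ m ↔ n ≤ m ∨ ∃ l < n, Splits (numAdj G) n (l + 1) m := by
  constructor
  · intro h
    by_cases hm : n ≤ m
    · exact .inl hm
    · exact .inr (exists_splits_of_vertexIntegrity_le h (by omega))
  · rintro (h | ⟨l, -, h⟩)
    · refine vertexIntegrity_le_iff.2 ⟨Set.univ, 0, by simpa using h, fun D => ?_⟩
      induction D using SimpleGraph.ConnectedComponent.ind with | h v => exact absurd trivial v.2
    · exact h.vertexIntegrity_le

/-! ### The program -/

/-- The input `k`, cut down to at most `n`, is compared with the vertex integrity. The vertex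
integrity is at most `n`, so that this has the same answer; it keeps the register `bound` small,
although `k` may be arbitrarily large. A negative `k` is dealt with last. -/
def main : Cmd :=
  .assign .bound (.ite (.lt (.var .size) (.var .kin)) (.var .size) (.var .kin)) ;;
  .assign .ans (.ite (.lt (.var .bound) (.var .size)) (.lit 0) (.lit 1)) ;;
  findCover ;;
  dp ;;
  .assign .size (.ite (.eq (.var .sgn) (.lit 1)) (.lit 0) (.var .ans))

/-- the contents of the named registers and arrays for the input `(G, k)` -/
noncomputable def inputStore {n : ℕ} (G : SimpleGraph (Fin n)) (k : ℤ) : Store where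
  reg x := (inputState G k).reg x.num
  arr a := (inputState G k).arr a.num

theorem adjCells_inputStore {n : ℕ} (G : SimpleGraph (Fin n)) (k : ℤ) :
    AdjCells (numAdj G) n (inputStore G k) := by
  intro u v hu hv
  simp only [inputStore, inputState, show Arr.num .adj = 0 from rfl, true_and, ne_eq,
    ite_eq_right_iff, one_ne_zero, imp_false, not_not, numAdj]
  constructor
  · rintro ⟨a, b, h, hA⟩
    have hn : 0 < n := by omega
    have e1 : u = a := by
      have := congrArg (· / n) h
      simpa [Nat.add_div_of_dvd_right, Nat.mul_add_div, mul_comm _ n, hn, Nat.div_eq_of_lt hv,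
        Nat.div_eq_of_lt b.2] using this
    have e2 : v = b := by subst e1; omega
    subst e1 e2
    exact ⟨hu, hv, hA⟩
  · rintro ⟨_, _, hA⟩
    exact ⟨⟨u, hu⟩, ⟨v, hv⟩, rfl, hA⟩

theorem rep_inputStore {n : ℕ} (G : SimpleGraph (Fin n)) (k : ℤ) :
    Rep (inputState G k) (inputStore G k) :=
  ⟨fun _ => rfl, fun _ => rfl⟩

theorem small_inputStore {n M : ℕ} (G : SimpleGraph (Fin n)) (k : ℤ) (hM : n + 1 ≤ M) :
    Small M (inputStore G k) := by
  refine ⟨fun x hx => ?_, fun a ha i => ?_⟩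
  · have h1 : x.num ≠ 1 := by cases x <;> simp_all [Var.small, Var.num, Var.ctorIdx]
    simp only [inputStore, inputState, h1, if_false]
    split_ifs <;> omega
  · have h0 : a.num ≠ 0 := by cases a <;> simp_all [Arr.small, Arr.num, Arr.ctorIdx]
    simp [inputStore, inputState, h0]

theorem runs_main {M L n : ℕ} (hL : Clock M L) (hM : n + 4 ≤ M) (G : SimpleGraph (Fin n)) (k : ℤ) :
    Runs main (inputStore G k) (L ^ 8 * 4 ^ G.vertexCoverNum.toNat) fun σ' =>
      σ'.reg .size = if (vertexIntegrity G : ℤ) ≤ k then 1 else 0 := by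
  classical
  obtain ⟨S, hSc, hS⟩ := G.vertexCoverNum_exists
  set K : Finset ℕ := S.toFinset.image Fin.val with hK
  have hKc : K.card = G.vertexCoverNum.toNat := by
    rw [← hSc, hK, Finset.card_image_of_injective _ Fin.val_injective,
      ← Set.ncard_eq_toFinset_card',
      Set.ncard_def]
  rw [← hKc]
  have hKn : K.card ≤ n := by
    rw [hK, Finset.card_image_of_injective _ Fin.val_injective]
    simpa using Finset.card_le_univ S.toFinset
  have hcover : ∀ u v, u < n → v < n → numAdj G u v → u ∈ K ∨ v ∈ K := by
    rintro u v - - ⟨hu, hv, hA⟩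
    exact (hS hA).imp (fun h => Finset.mem_image_of_mem Fin.val (Set.mem_toFinset.2 h))
      fun h => Finset.mem_image_of_mem Fin.val (Set.mem_toFinset.2 h)
  set B := if n < k.natAbs then n else k.natAbs with hB
  set a := if B < n then 0 else 1 with ha
  have hT : L + (L + (L ^ 7 * 4 ^ K.card + (L ^ 6 * 4 ^ K.card + L))) ≤ L ^ 8 * 4 ^ K.card := by
    have hbig := hL.big
    have h1 : 64 * L ^ 7 ≤ L * L ^ 7 := Nat.mul_le_mul_right _ hbig
    have h2 : L ^ 6 ≤ L ^ 7 := Nat.pow_le_pow_right (by omega) (by omega)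
    have h3 : L ≤ L ^ 7 := Nat.le_self_pow (by omega) _
    have h4 : 1 ≤ 4 ^ K.card := Nat.one_le_pow _ _ (by omega)
    have h5 : L ^ 7 * 1 ≤ L ^ 7 * 4 ^ K.card := Nat.mul_le_mul_left _ h4
    have h6 := Nat.mul_le_mul_right (4 ^ K.card) h2
    have h7 := Nat.mul_le_mul_right (4 ^ K.card) h1
    have h8 : L ^ 8 = L * L ^ 7 := by ring
    rw [h8]
    rw [mul_assoc] at h7
    omega
  have h0 := small_inputStore G k (show n + 1 ≤ M by omega)
  have hsize : (inputStore G k).reg .size = n := rfl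
  have hkin : (inputStore G k).reg .kin = k.natAbs := rfl
  have hsgn : (inputStore G k).reg .sgn = if k < 0 then 1 else 0 := rfl
  have hBn : B ≤ n := by rw [hB]; split_ifs <;> omega
  refine (Runs.assign_seq hL h0 (by decide) (by decide) (m := B)
    (by simp [E.eval, hsize, hkin, hB]) ?_).time hT
  have h1 : Small M ((inputStore G k).set .bound B) := h0.set fun _ => by omega
  refine Runs.assign_seq hL h1 (by decide) (by decide) (m := a)
    (by simp [E.eval, hsize, ha]) ?_
  have h2 := h1.set (x := .ans) (m := a) fun _ => by rw [ha]; split_ifs <;> omega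
  refine (runs_findCover hL h2 hM (by simpa using hsize) (adjCells_inputStore G k)
    (fun i _ => by simp [inputStore, inputState, Arr.num, Arr.ctorIdx]) K hcover hKn).seq ?_
  rintro σ ⟨hk, h3, c, hc, hC⟩
  let I : Inst := ⟨numAdj G, n, c, σ.arr .cov, σ.arr .pos, numAdj_symm, hC.cover⟩
  have hI : I.At σ := ⟨by rw [hk.reg _ (by decide)]; simpa using hsize,
    AdjCells.keep (σ := ((inputStore G k).set .bound B).set .ans a) (adjCells_inputStore G k) hk
      (by decide), rfl, rfl, hC.len, hC.pow, hC.tables⟩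
  refine ((runs_dp (k := B) hL h3 (show n + 1 ≤ M by omega) hI
    (by rw [hk.reg _ (by decide)]; simp)).time
    (Nat.mul_le_mul_left _ (Nat.pow_le_pow_right (by omega) hc))).seq ?_
  rintro σ' ⟨hk', h4, h5, h6⟩
  refine Runs.assign hL h4 (by decide) (by decide) ?_
  have hans : σ.reg .ans = a := by rw [hk.reg _ (by decide)]; simp
  have hsgn' : σ'.reg .sgn = if k < 0 then 1 else 0 := by
    rw [hk'.reg _ (by decide), hk.reg _ (by decide)]; simpa using hsgn
  have hvi : σ'.reg .ans = 1 ↔ vertexIntegrity G ≤ B := by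
    rw [h6, vertexIntegrity_le_iff_splits, hans]
    refine or_congr (by rw [ha]; split_ifs <;> simp <;> omega) (exists_congr fun l =>
      and_congr_right fun _ => ⟨?_, fun h => Inst.splits_success (I := I) h⟩)
    rintro ⟨w, -, h⟩
    exact Inst.Success.splits (Nat.succ_pos l) h
  have hvn : vertexIntegrity G ≤ n := vertexIntegrity_le_iff_splits.2 (.inl le_rfl)
  have hcut : vertexIntegrity G ≤ B ↔ vertexIntegrity G ≤ k.natAbs := by
    rw [hB]; split_ifs <;> omega
  rw [hcut] at hvi
  have h01 : σ'.reg .ans = 1 ∨ σ'.reg .ans = 0 := by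
    rw [hans] at h5
    have : a = 0 ∨ a = 1 := by rw [ha]; split_ifs <;> simp
    omega
  simp only [Store.set_reg, if_true, E.eval, hsgn']
  by_cases hneg : k < 0
  · simp [hneg, show ¬ (vertexIntegrity G : ℤ) ≤ k by omega]
  · simp only [hneg, if_false, zero_ne_one, ne_eq, not_true_eq_false]
    split_ifs <;> omega

end RAM

theorem mainTheorem6 :
    ∃ (P : RAM.Program) (C c : ℕ), ∀ (n : ℕ) (G : SimpleGraph (Fin n)) (k : ℤ),
      ∃ (t : ℕ) (s : RAM.State), RAM.Exec P (RAM.inputState G k) t s ∧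
        s.reg 0 = (if (vertexIntegrity G : ℤ) ≤ k then 1 else 0) ∧
        t ≤ C * 5 ^ G.vertexCoverNum.toNat * (n + 1) ^ c := by
  -- the exponent is hidden behind a variable, so that no power is ever evaluated
  obtain ⟨D, hD⟩ : ∃ D, D = RAM.maxDeg + 3 := ⟨_, rfl⟩
  refine ⟨RAM.main 32, 6 ^ (D * 8), D * 8, fun n G k => ?_⟩
  obtain ⟨t, s, σ, h1, h2, h3, -, h5⟩ := RAM.runs_main (hD ▸ RAM.clock_pow (n + 4)) le_rfl G k 32 _
    le_rfl (RAM.rep_inputStore G k)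
  refine ⟨t, s, h1, (h3.reg .size).trans h5, h2.trans ?_⟩
  rw [← pow_mul]
  calc (n + 4 + 2) ^ (D * 8) * 4 ^ G.vertexCoverNum.toNat
      ≤ (6 * (n + 1)) ^ (D * 8) * 5 ^ G.vertexCoverNum.toNat :=
        Nat.mul_le_mul (Nat.pow_le_pow_left (by omega) _) (Nat.pow_le_pow_left (by omega) _)
    _ = _ := by rw [mul_pow]; ring
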